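/- **Queueing model.** There are $K$ job types. In slot $t=1,2,\dots$ a random vector $\mathbf A_t\in\mathbb R_+^K$ of jobs arrives, one queue $a_t\in[K]$ is served, and with $\mathbf Q_0=\mathbf 0$ $$Q_{t,i}=\max\{Q_{t-1,i}+A_{t,i}-S_{t,i}\mathbf 1[i=a_t],\,0\},$$ where $\mathbf S_t\in\mathbb R_+^K$ is the random vector of maximal services. The vectors $\mathbf A_1,\mathbf S_1,\mathbf A_2,\mathbf S_2,\dots$ are independent; $\vec\lambda_t=\mathbb E\mathbf A_t$ and $\vec\sigma_t=\mathbb E\mathbf S_t$. Let $\mathcal F_t$ be the $\sigma$-algebra generated by $a_s,\mathbf A_s,S_{s,a_s}$ $(1\le s\le t)$ and $\mathbf Q_0,\dots,\mathbf Q_t$. **Assumptions.** Let $M>0$, $\alpha\ge 2$, $0<\delta\le\frac12$, $\epsilon>0$, $C_W\ge 0$, $C_V>0$, and let $\triangle^{[K]}$ be the probability simplex. 1. (Piecewise stabilizability) There are $\vec\theta_1,\vec\theta_2,\dots\in\triangle^{[K]}$ and a partition of $\{1,2,\dots\}$ into intervals $W_0,W_1,\dots$ such that $\sum_{i:\min W_i<T}(|W_i|-1)^2\le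 C_WT$ for all $T\ge1$, and $\frac1{|W_i|}\sum_{t\in W_i}\theta_{t,j}\sigma_{t,j}\ge\epsilon+\frac1{|W_i|}\sum_{t\in W_i}\lambda_{t,j}$ for all $i\ge 0$, $j\in[K]$. 2. (Reference policy stationarity) For the same $\vec\theta_t$, $\sum_{t=1}^{T-1}\|\vec\theta_{t+1}-\vec\theta_t\|_1\le C_VT^{\frac12-\delta}$ for all $T\ge1$. 3. (Bounded moments) $\mathbb E[A_{t,i}^\alpha\mid\mathcal F_{t-1}]\le M^\alpha$ and $\mathbb E[S_{t,i}^\alpha\mid\mathcal F_{t-1}]\le M^\alpha$ for all $t\ge1$, $i\in[K]$. **Algorithm (SoftMW+).** Put $L_0=M$, $\mathbf x_1=(1/K,\dots,1/K)$, $\Psi(\mathbf x)=\sum_i(x_i\ln x_i-x_i)$, and let $D_\Psi$ be the Bregman divergence of $\Psi$. In slot $t$ set $\beta_t=t^{-4}/K$, $$\eta_t=\Big(t^{-(\frac14-\frac\delta2)}L_{t-1}\sqrt{86L_{t-1}^2K^6t^{3/2}+\textstyle\sum_{s=0}^{t-1}\|\mathbf Q_s\|_2^2}\Big)^{-1},\quad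 \mathbf e_t=\frac{\mathbf Q_{t-1}}{\|\mathbf Q_{t-1}\|_1},\quad \gamma_t=Mt^{\delta/4}\eta_t\|\mathbf Q_{t-1}\|_1$$ ($\mathbf e_t$ is irrelevant if $\mathbf Q_{t-1}=\mathbf 0$, since then $\gamma_t=0$), and $\mathbf p_t=(1-\gamma_t)\mathbf x_t+\gamma_t\mathbf e_t$. Sample $a_t\sim\mathbf p_t$, i.e. $\mathbb P[a_t=i\mid\mathcal F_{t-1}]=p_{t,i}$ for all $i$, with $(\mathbf A_t,\mathbf S_t)$ independent of $\mathcal F_{t-1}\vee\sigma(a_t)$. Serve queue $a_t$ and observe $S_{t,a_t}$. Let $S'_t=S_{t,a_t}$ if $S_{t,a_t}\le Mt^{\delta/4}$ and $S'_t=0$ otherwise. Let $\tilde{\mathbf g}_t$ have $a_t$-th coordinate $Q_{t-1,a_t}S'_t/p_{t,a_t}$ and all other coordinates $0$, and set $$\mathbf x_{t+1}=\operatorname*{arg\,min}\big\{\langle-\eta_t\tilde{\mathbf g}_t,\mathbf x'\rangle+D_\Psi(\mathbf x',\mathbf x_t)\;:\;\mathbf x'\in\triangle^{[K]},\ x'_i\ge\beta_t\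 \forall i\big\},\qquad L_t=\max\{L_{t-1},\|\mathbf Q_t-\mathbf Q_{t-1}\|_\infty\}.$$ **Theorem.** Suppose $\delta\alpha>7$. Then there is a sequence $r_T\to0$, depending only on $K,M,\alpha,\delta,\epsilon,C_W,C_V$, such that for every system satisfying Assumptions 1–3 and scheduled by SoftMW+, all $Q_{t,i}$ are integrable and, for every $T\ge1$, $$\frac1T\,\mathbb E\Big[\sum_{t=1}^T\|\mathbf Q_t\|_1\Big]\le\frac{2(K+1)M^2+4C_W(KM^2+\epsilon KM)}{\epsilon}+r_T .$$ In particular the system is stable: $\frac1T\sum_{t=0}^{T-1}\sum_{i=1}^K\mathbb E[Q_{t,i}]=O(1)$ as $T\to\infty$. -/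

import Mathlib

open MeasureTheory ProbabilityTheory Filter Topology

noncomputable section

namespace SoftMWPlus

variable {K : ℕ} {Ω : Type*}

/-! ### The queueing system (deterministic, along one sample path)

Job types are `Fin K`.  Time slots are `1, 2, 3, …`; the values of `A`, `S`, `a`, … at index `0`
are never used. -/

/-- The `ℓ¹` norm of a vector. -/
def l1norm (v : Fin K → ℝ) : ℝ := ∑ i, |v i|

/-- Queue lengths: `Q₀ = 0` and `Q_{t,i} = max {Q_{t-1,i} + A_{t,i} - S_{t,i} 1[i = a_t], 0}`. -/
def queueLength (A S : ℕ → Fin K → ℝ) (a : ℕ → Fin K) : ℕ → Fin K → ℝ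
  | 0 => fun _ => 0
  | t + 1 => fun i =>
      max (queueLength A S a t i + A (t + 1) i - (if i = a (t + 1) then S (t + 1) i else 0)) 0

/-! ### EXP3.S+ -/

/-- The truncated simplex `Δ^{[K],β}`. -/
def truncSimplex (K : ℕ) (β : ℝ) : Set (Fin K → ℝ) :=
  {y | y ∈ stdSimplex ℝ (Fin K) ∧ ∀ i, β ≤ y i}

/-- The regulariser `Ψ(y) = ∑ᵢ (yᵢ ln yᵢ - yᵢ)`. -/
def negEntropy (y : Fin K → ℝ) : ℝ := ∑ i, (y i * Real.log (y i) - y i)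

/-- The Bregman divergence `D_f(y, z) = f(y) - f(z) - ⟨∇f(z), y - z⟩`. -/
def bregman (f : (Fin K → ℝ) → ℝ) (y z : Fin K → ℝ) : ℝ :=
  f y - f z - fderiv ℝ f z (y - z)

/-- The mixed action from which the action is sampled: `p = (1 - γ) x + γ e`. -/
def mixedAction (γ : ℝ) (e x : Fin K → ℝ) : Fin K → ℝ := fun i => (1 - γ) * x i + γ * e i

/-- The importance-weighted feedback vector: `g / p_b` in the coordinate `b` of the action taken,
`0` in all other coordinates. -/
def feedbackEstimate (p : Fin K → ℝ) (b : Fin K) (g : ℝ) : Fin K → ℝ :=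
  fun i => if i = b then g / p b else 0

/-- `x₁, x₂, …` are the iterates of EXP3.S+ started from the uniform mixed action, when it is run
with truncation levels `β`, learning rates `η`, exploration rates `γ` and exploration vectors `e`,
and when in slot `t` the action `a t` was taken and the scalar feedback `g t` was received:
`x_{t+1}` minimises `⟨-η_t g̃_t, y⟩ + D_Ψ(y, x_t)` over `y ∈ Δ^{[K],β_t}`. -/
structure IsExp3SPlus (β η γ : ℕ → ℝ) (e : ℕ → Fin K → ℝ) (a : ℕ → Fin K) (g : ℕ → ℝ)
    (x : ℕ → Fin K → ℝ) : Prop where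
  init : ∀ i, x 1 i = 1 / (K : ℝ)
  mem : ∀ t, 1 ≤ t → x (t + 1) ∈ truncSimplex K (β t)
  isMinOn : ∀ t, 1 ≤ t →
    IsMinOn
      (fun y : Fin K → ℝ =>
        (∑ i, (-η t * feedbackEstimate (mixedAction (γ t) (e t) (x t)) (a t) (g t) i) * y i)
          + bregman negEntropy y (x t))
      (truncSimplex K (β t)) (x (t + 1))

/-! ### Parameters of SoftMW+, as functions of the queue-length path `Q` -/

/-- `L₀ = M`, `L_t = max {L_{t-1}, ‖Q_t - Q_{t-1}‖_∞}`
(the norm on `Fin K → ℝ` is the maximum norm). -/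
def maxIncrement (M : ℝ) (Q : ℕ → Fin K → ℝ) : ℕ → ℝ
  | 0 => M
  | t + 1 => max (maxIncrement M Q t) ‖Q (t + 1) - Q t‖

/-- `β_t = t⁻⁴ / K`. -/
def softBeta (K : ℕ) (t : ℕ) : ℝ := ((t : ℝ) ^ 4)⁻¹ / K

/-- `η_t = (t^{-(1/4 - δ/2)} L_{t-1} √(86 L_{t-1}² K⁶ t^{3/2} + ∑_{s=0}^{t-1} ‖Q_s‖₂²))⁻¹`. -/
def softEta (M δ : ℝ) (Q : ℕ → Fin K → ℝ) (t : ℕ) : ℝ :=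
  ((t : ℝ) ^ (-(1 / 4 - δ / 2)) * maxIncrement M Q (t - 1) *
    Real.sqrt (86 * maxIncrement M Q (t - 1) ^ 2 * (K : ℝ) ^ 6 * (t : ℝ) ^ ((3 : ℝ) / 2)
      + ∑ s ∈ Finset.range t, ∑ i, Q s i ^ 2))⁻¹

/-- `e_t = Q_{t-1} / ‖Q_{t-1}‖₁`.  If `Q_{t-1} = 0` the value is irrelevant, because then
`γ_t = 0`. -/
def softExplore (Q : ℕ → Fin K → ℝ) (t : ℕ) : Fin K → ℝ :=
  fun i => Q (t - 1) i / l1norm (Q (t - 1))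

/-- `γ_t = M t^{δ/4} η_t ‖Q_{t-1}‖₁`. -/
def softGamma (M δ : ℝ) (Q : ℕ → Fin K → ℝ) (t : ℕ) : ℝ :=
  M * (t : ℝ) ^ (δ / 4) * softEta M δ Q t * l1norm (Q (t - 1))

/-- The clipped service: `s` if `s ≤ M t^{δ/4}`, and `0` otherwise. -/
def clip (M δ : ℝ) (t : ℕ) (s : ℝ) : ℝ := if s ≤ M * (t : ℝ) ^ (δ / 4) then s else 0

/-- The feedback `g_t = Q_{t-1,a_t} S'_t` with `S'_t` the clipped value of `S_{t,a_t}`. -/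
def softFeedback (M δ : ℝ) (Q S : ℕ → Fin K → ℝ) (a : ℕ → Fin K) (t : ℕ) : ℝ :=
  Q (t - 1) (a t) * clip M δ t (S t (a t))

/-- The distribution `p_t` from which SoftMW+ samples the queue to serve in slot `t`. -/
def softMixed (M δ : ℝ) (Q x : ℕ → Fin K → ℝ) (t : ℕ) : Fin K → ℝ :=
  mixedAction (softGamma M δ Q t) (softExplore Q t) (x t)

/-! ### The stochastic model -/

/-- The queue-length process. -/
def queueProc (A S : ℕ → Ω → Fin K → ℝ) (a : ℕ → Ω → Fin K) (t : ℕ) (ω : Ω) : Fin K → ℝ :=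
  queueLength (fun s => A s ω) (fun s => S s ω) (fun s => a s ω) t

/-- `F_t`, the `σ`-algebra generated by `a₁, …, a_t`, `A₁, …, A_t`, `S_{1,a₁}, …, S_{t,a_t}` and
`Q₀, …, Q_t`: everything visible to the scheduler at the end of slot `t`. -/
abbrev history (A S : ℕ → Ω → Fin K → ℝ) (a : ℕ → Ω → Fin K) (t : ℕ) : MeasurableSpace Ω :=
  (⨆ s ∈ Finset.Icc 1 t,
      (MeasurableSpace.comap (a s) inferInstance ⊔ MeasurableSpace.comap (A s) inferInstance ⊔
        MeasurableSpace.comap (fun ω => S s ω (a s ω)) inferInstance)) ⊔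
    ⨆ s ∈ Finset.range (t + 1), MeasurableSpace.comap (queueProc A S a s) inferInstance

/-- The arrival vectors `A₁, A₂, …` and service vectors `S₁, S₂, …` are independent random
vectors. -/
structure IsEnvironment [MeasurableSpace Ω] (μ : Measure Ω) (A S : ℕ → Ω → Fin K → ℝ) : Prop where
  measurable_arrival : ∀ t, 1 ≤ t → Measurable (A t)
  measurable_service : ∀ t, 1 ≤ t → Measurable (S t)
  indep : iIndepFun (fun j : ℕ ⊕ ℕ => Sum.elim (fun t => A (t + 1)) (fun t => S (t + 1)) j) μ

/-- `a₁, a₂, …` is the sequence of queues served by SoftMW+ in the environment `A, S`, and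
`x₁, x₂, …` are the iterates of its EXP3.S+ instance.  In slot `t` the action `a_t` is sampled from
`p_t`, that is: conditionally on `F_{t-1}` it has law `p_t`, and the new pair `(A_t, S_t)` is
independent of the past and of the action just sampled. -/
structure IsSoftMWPlus [MeasurableSpace Ω] (μ : Measure Ω) (M δ : ℝ)
    (A S : ℕ → Ω → Fin K → ℝ) (a : ℕ → Ω → Fin K) (x : ℕ → Ω → Fin K → ℝ) : Prop where
  measurable_action : ∀ t, 1 ≤ t → Measurable (a t)
  exp3 : ∀ ω, IsExp3SPlus (softBeta K) (softEta M δ (fun t => queueProc A S a t ω))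
    (softGamma M δ (fun t => queueProc A S a t ω)) (softExplore (fun t => queueProc A S a t ω))
    (fun t => a t ω)
    (softFeedback M δ (fun t => queueProc A S a t ω) (fun t => S t ω) (fun t => a t ω))
    (fun t => x t ω)
  sampling : ∀ t, 1 ≤ t → ∀ i,
    μ[{ω | a t ω = i}.indicator (fun _ => (1 : ℝ)) | history A S a (t - 1)] =ᵐ[μ]
      fun ω => softMixed M δ (fun s => queueProc A S a s ω) (fun s => x s ω) t i
  fresh : ∀ t, 1 ≤ t →
    Indep (MeasurableSpace.comap (fun ω => (A t ω, S t ω)) inferInstance)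
      (history A S a (t - 1) ⊔ MeasurableSpace.comap (a t) inferInstance) μ

/-! ### Assumptions -/

/-- Mean vector in slot `t` (`λ_t` for arrivals, `σ_t` for services). -/
def meanRate [MeasurableSpace Ω] (μ : Measure Ω) (X : ℕ → Ω → Fin K → ℝ) (t : ℕ) (i : Fin K) : ℝ :=
  ∫ ω, X t ω i ∂μ

/-- Piecewise stabilizability with reference policy `θ` and constants `C_W`, `ε`.  The partition of
the positive integers into intervals is given by the increasing sequence `τ` of the left end points:
`W_n = {τ_n, …, τ_{n+1} - 1}`.  (The first inequality forces every interval to be finite.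
Since `n < τ_n`, the sum over `n < T` with `τ_n < T` is the sum over all `n` with `min W_n < T`.) -/
def PiecewiseStabilizable (rateA rateS : ℕ → Fin K → ℝ) (θ : ℕ → Fin K → ℝ) (CW ε : ℝ) : Prop :=
  (∀ t, 1 ≤ t → θ t ∈ stdSimplex ℝ (Fin K)) ∧
  ∃ τ : ℕ → ℕ, StrictMono τ ∧ τ 0 = 1 ∧
    (∀ T : ℕ, 1 ≤ T →
      ∑ n ∈ (Finset.range T).filter (fun n => τ n < T),
        (((Finset.Ico (τ n) (τ (n + 1))).card : ℝ) - 1) ^ 2 ≤ CW * T) ∧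
    ∀ (n : ℕ) (j : Fin K),
      ε + (1 / ((Finset.Ico (τ n) (τ (n + 1))).card : ℝ)) *
          ∑ t ∈ Finset.Ico (τ n) (τ (n + 1)), rateA t j ≤
        (1 / ((Finset.Ico (τ n) (τ (n + 1))).card : ℝ)) *
          ∑ t ∈ Finset.Ico (τ n) (τ (n + 1)), θ t j * rateS t j

/-- Stationarity of the reference policy: `∑_{t=1}^{T-1} ‖θ_{t+1} - θ_t‖₁ ≤ C_V T^{1/2 - δ}` for
all `T ≥ 1`. -/
def ReferenceStationary (θ : ℕ → Fin K → ℝ) (CV δ : ℝ) : Prop :=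
  ∀ T : ℕ, 1 ≤ T →
    ∑ t ∈ Finset.Ico 1 T, l1norm (θ (t + 1) - θ t) ≤ CV * (T : ℝ) ^ (1 / 2 - δ)

/-- Arrivals and services are nonnegative and their `α`-th moments, conditionally on `F_{t-1}`, are
at most `M^α`. -/
structure BoundedMoments [MeasurableSpace Ω] (μ : Measure Ω) (M α : ℝ)
    (A S : ℕ → Ω → Fin K → ℝ) (a : ℕ → Ω → Fin K) : Prop where
  nonneg_arrival : ∀ t, 1 ≤ t → ∀ i, ∀ᵐ ω ∂μ, 0 ≤ A t ω i
  nonneg_service : ∀ t, 1 ≤ t → ∀ i, ∀ᵐ ω ∂μ, 0 ≤ S t ω i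
  integrable_arrival : ∀ t, 1 ≤ t → ∀ i, Integrable (fun ω => A t ω i ^ α) μ
  integrable_service : ∀ t, 1 ≤ t → ∀ i, Integrable (fun ω => S t ω i ^ α) μ
  moment_arrival : ∀ t, 1 ≤ t → ∀ i,
    μ[fun ω => A t ω i ^ α | history A S a (t - 1)] ≤ᵐ[μ] fun _ => M ^ α
  moment_service : ∀ t, 1 ≤ t → ∀ i,
    μ[fun ω => S t ω i ^ α | history A S a (t - 1)] ≤ᵐ[μ] fun _ => M ^ α

/-- The system is stable: `(1/T) ∑_{t=0}^{T-1} ∑_i E[Q_{t,i}] = O(1)`. -/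
def IsStable [MeasurableSpace Ω] (μ : Measure Ω) (Q : ℕ → Ω → Fin K → ℝ) : Prop :=
  (∀ t i, Integrable (fun ω => Q t ω i) μ) ∧
  (fun T : ℕ => (1 / (T : ℝ)) * ∑ t ∈ Finset.range T, ∑ i, ∫ ω, Q t ω i ∂μ)
    =O[atTop] (fun _ => (1 : ℝ))

end SoftMWPlus

end

open SoftMWPlus

noncomputable section

namespace SoftMWPlus

variable {K : ℕ} {Ω : Type*}

/-! ### Nonnegative sequences with bounded upward increments -/

/-! The Lyapunov function is E‖Q_t‖₂². Given the past, slot t+1 brings a fresh environment, so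
squaring the recursion and telescoping (`Model.sum_drift_le`) bounds the sum over t < n and i of
E[Q_{t,i} p_{t+1,i}] σ_{t+1,i} − E[Q_{t,i}] λ_{t+1,i} by (K+1)M²n/2. If the sampling probabilities p
were replaced by the reference policy θ, this sum would be at least ε ∑ E‖Q_t‖₁ up to a window cost:
mean queues move by at most M per slot, so freezing one at the start of a window W costs at most (M²
+ εM)(|W| − 1)² (`le_sum_mul_of_average`), in total O(n). The price of the replacement is the
dynamic regret of a bandit with rewards Q_{t,i} S_{t+1,i}, which are unbounded and depend on the
algorithm itself.

The regret is bounded along sample paths by entropic mirror descent. Exploration proportional to Q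
makes η g̃ ≤ 1 however small the iterate is, which is what `mirror_step` needs, and the constant 86
in η keeps γ ≤ 1/2. Summation by parts against a comparator of path length O(T^{1/2−δ}) gives, up to
a logarithm, T^{1/4−δ/2}(L² T^{3/4} + L Z), where L is the largest increment and Z² = ∑‖Q_s‖₂². The
second-order term and the exploration cost are in expectation at most multiples of T^{δ/4} E ∑
η‖Q‖₂², and `sum_softEta_mul_sq_le` bounds ∑ η‖Q‖₂² by a multiple of T^{1/4−δ/2} Z.

The bound closes on itself. A queue with increments at most L is large only after having been large
for long: Z⁴ ≤ 2L X³ with X = ∑‖Q_s‖₁ (`IsQueuePath.sqSum_sq_le`). By Young's inequality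
(`mul_le_add_of_pow_four_le`) every term G·Z is at most a small multiple of X plus a multiple of L
G⁴. Since L^α is dominated by M^α plus the sum of the α-th powers of all arrivals and services, its
mean is O(T), so a factor L costs T^{1/α} with 1/α < δ/7. The regret is thus at most (ε/2) E X +
O(T^{1−δ/7}), and half of the drift ε E X survives. The argument runs up to the end of a window, and
every T has one within O(√T).

In sums over slots the index t stands for slot t+1, so that Q_t meets η_{t+1}, x_{t+1}, A_{t+1} and
S_{t+1}. -/

theorem sq_le_of_increments {y : ℕ → ℝ} (h0 : y 0 = 0) (hy : ∀ t, 0 ≤ y t) {L : ℝ} (t : ℕ)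
    (h : ∀ s < t, y (s + 1) - y s ≤ L) :
    y t ^ 2 ≤ 2 * L * ∑ s ∈ Finset.range t, y s + L * y t := by
  induction t with
  | zero => simp [h0]
  | succ n ih =>
    have ih := ih fun s hs => h s (by omega)
    have h1 := h n (by omega)
    rw [Finset.sum_range_succ]
    -- Uses y_{n+1}² − y_n² = (y_{n+1} − y_n)(y_{n+1} + y_n); only upward jumps need a bound.
    nlinarith [mul_le_mul_of_nonneg_right h1 (add_nonneg (hy (n + 1)) (hy n))]

/-- Telescoping u³ − v³ = (u − v)(u² + uv + v²). The cubic version is what keeps the exploration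
rate below 1/2. -/
theorem cube_le_of_increments {y : ℕ → ℝ} (h0 : y 0 = 0) (hy : ∀ t, 0 ≤ y t) {L : ℝ}
    (hL : 0 ≤ L) (t : ℕ) (h : ∀ s < t, y (s + 1) - y s ≤ L) :
    y t ^ 3 ≤ 3 * L * ∑ s ∈ Finset.range t, y s ^ 2 + 3 / 2 * L * y t ^ 2 := by
  induction t with
  | zero => simp [h0]
  | succ n ih =>
    have ih := ih fun s hs => h s (by omega)
    have h1 := h n (by omega)
    rw [Finset.sum_range_succ]
    set u := y (n + 1)
    set v := y n
    have hu : 0 ≤ u := hy _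
    have hv : 0 ≤ v := hy _
    have key : u ^ 3 - v ^ 3 ≤ 3 / 2 * L * (u ^ 2 + v ^ 2) := by
      have e : u ^ 3 - v ^ 3 = (u - v) * (u ^ 2 + u * v + v ^ 2) := by ring
      have p1 : 0 ≤ u ^ 2 + u * v + v ^ 2 := by positivity
      have p2 : u ^ 2 + u * v + v ^ 2 ≤ 3 / 2 * (u ^ 2 + v ^ 2) := by
        nlinarith [sq_nonneg (u - v)]
      calc u ^ 3 - v ^ 3 ≤ L * (u ^ 2 + u * v + v ^ 2) := by
            rw [e]; exact mul_le_mul_of_nonneg_right h1 p1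
        _ ≤ L * (3 / 2 * (u ^ 2 + v ^ 2)) := mul_le_mul_of_nonneg_left p2 hL
        _ = _ := by ring
    linarith

/-! ### Queue paths -/

theorem queueLength_nonneg (A S : ℕ → Fin K → ℝ) (a : ℕ → Fin K) (t : ℕ) (i : Fin K) :
    0 ≤ queueLength A S a t i := by
  cases t with
  | zero => simp [queueLength]
  | succ t => simp [queueLength]

theorem maxIncrement_mono (M : ℝ) (Q : ℕ → Fin K → ℝ) : Monotone (maxIncrement M Q) :=
  monotone_nat_of_le_succ fun t => by
    change _ ≤ max _ _
    exact le_max_left _ _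

theorem le_maxIncrement (M : ℝ) (Q : ℕ → Fin K → ℝ) (t : ℕ) : M ≤ maxIncrement M Q t :=
  maxIncrement_mono M Q (Nat.zero_le t)

theorem abs_sub_le_maxIncrement (M : ℝ) (Q : ℕ → Fin K → ℝ) {s t : ℕ} (h : s < t) (i : Fin K) :
    |Q (s + 1) i - Q s i| ≤ maxIncrement M Q t := by
  refine le_trans ?_ (maxIncrement_mono M Q (Nat.succ_le_of_lt h))
  refine le_trans ?_ (le_max_right _ _)
  simpa using norm_le_pi_norm (Q (s + 1) - Q s) i

theorem l1norm_nonneg (v : Fin K → ℝ) : 0 ≤ l1norm v :=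
  Finset.sum_nonneg fun _ _ => abs_nonneg _

theorem l1norm_of_nonneg {v : Fin K → ℝ} (hv : ∀ i, 0 ≤ v i) : l1norm v = ∑ i, v i :=
  Finset.sum_congr rfl fun i _ => abs_of_nonneg (hv i)

theorem sq_l1norm_le (v : Fin K → ℝ) : l1norm v ^ 2 ≤ K * ∑ i, v i ^ 2 := by
  have := sq_sum_le_card_mul_sum_sq (s := Finset.univ) (f := fun i => |v i|)
  simpa [l1norm] using this

/-- `∑_{s<t} ‖Q_s‖₂²`. -/
def sqSum (Q : ℕ → Fin K → ℝ) (t : ℕ) : ℝ := ∑ s ∈ Finset.range t, ∑ i, Q s i ^ 2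

/-- `∑_{s<t} ‖Q_s‖₁`. -/
def l1Sum (Q : ℕ → Fin K → ℝ) (t : ℕ) : ℝ := ∑ s ∈ Finset.range t, l1norm (Q s)

theorem sqSum_nonneg (Q : ℕ → Fin K → ℝ) (t : ℕ) : 0 ≤ sqSum Q t :=
  Finset.sum_nonneg fun _ _ => Finset.sum_nonneg fun _ _ => sq_nonneg _

theorem l1Sum_nonneg (Q : ℕ → Fin K → ℝ) (t : ℕ) : 0 ≤ l1Sum Q t :=
  Finset.sum_nonneg fun _ _ => l1norm_nonneg _

theorem sqSum_succ (Q : ℕ → Fin K → ℝ) (t : ℕ) :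
    sqSum Q (t + 1) = sqSum Q t + ∑ i, Q t i ^ 2 := Finset.sum_range_succ _ _

theorem sqSum_mono (Q : ℕ → Fin K → ℝ) : Monotone (sqSum Q) :=
  monotone_nat_of_le_succ fun t => by
    rw [sqSum_succ]
    exact le_add_of_nonneg_right (Finset.sum_nonneg fun _ _ => sq_nonneg _)

/-- The queue paths along which the learning parameters are controlled. -/
structure IsQueuePath (Q : ℕ → Fin K → ℝ) : Prop where
  zero : ∀ i, Q 0 i = 0
  nonneg : ∀ t i, 0 ≤ Q t i

theorem isQueuePath_queueLength (A S : ℕ → Fin K → ℝ) (a : ℕ → Fin K) :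
    IsQueuePath (queueLength A S a) :=
  ⟨fun _ => rfl, queueLength_nonneg A S a⟩

namespace IsQueuePath

theorem sum_le_l1Sum {Q : ℕ → Fin K → ℝ} (hQ : IsQueuePath Q) {s t : ℕ} (h : s ≤ t) (i : Fin K) :
    ∑ r ∈ Finset.range s, Q r i ≤ l1Sum Q t := by
  calc ∑ r ∈ Finset.range s, Q r i ≤ ∑ r ∈ Finset.range s, l1norm (Q r) := by
        refine Finset.sum_le_sum fun r _ => ?_
        rw [l1norm_of_nonneg (hQ.nonneg r)]
        exact Finset.single_le_sum (fun j _ => hQ.nonneg r j) (Finset.mem_univ i)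
    _ ≤ l1Sum Q t := Finset.sum_le_sum_of_subset_of_nonneg (Finset.range_mono h)
        fun _ _ _ => l1norm_nonneg _

theorem sq_le {Q : ℕ → Fin K → ℝ} (hQ : IsQueuePath Q) {M : ℝ} (hM : 0 < M) {s T : ℕ}
    (h : s ≤ T) (i : Fin K) :
    Q s i ^ 2 ≤ 2 * maxIncrement M Q T * l1Sum Q (T + 1) := by
  have hL : 0 < maxIncrement M Q T := hM.trans_le (le_maxIncrement M Q T)
  have h1 := sq_le_of_increments (y := fun s => Q s i) (hQ.zero i) (fun t => hQ.nonneg t i)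
    (L := maxIncrement M Q T) s fun r hr =>
      (le_abs_self _).trans (abs_sub_le_maxIncrement M Q (hr.trans_le h) i)
  have h2 := hQ.sum_le_l1Sum (Nat.succ_le_succ h) i
  rw [Finset.sum_range_succ] at h2
  nlinarith [hQ.nonneg s i, mul_le_mul_of_nonneg_left h2 hL.le,
    mul_nonneg hL.le (hQ.nonneg s i)]

/-- `(∑ ‖Q_s‖₂²)² ≤ 2 L (∑ ‖Q_s‖₁)³`. -/
theorem sqSum_sq_le {Q : ℕ → Fin K → ℝ} (hQ : IsQueuePath Q) {M : ℝ} (hM : 0 < M) (T : ℕ) :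
    sqSum Q (T + 1) ^ 2 ≤ 2 * maxIncrement M Q T * l1Sum Q (T + 1) ^ 3 := by
  have hL : 0 < maxIncrement M Q T := hM.trans_le (le_maxIncrement M Q T)
  have hX := l1Sum_nonneg Q (T + 1)
  set B := 2 * maxIncrement M Q T * l1Sum Q (T + 1) with hB
  have hB0 : 0 ≤ B := by positivity
  -- Each single queue length is at most √B, and this replaces one factor of each square.
  have h1 : sqSum Q (T + 1) ≤ Real.sqrt B * l1Sum Q (T + 1) := by
    rw [sqSum, l1Sum, Finset.mul_sum]
    refine Finset.sum_le_sum fun s hs => ?_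
    rw [l1norm_of_nonneg (hQ.nonneg s), Finset.mul_sum]
    refine Finset.sum_le_sum fun i _ => ?_
    rw [sq]
    refine mul_le_mul_of_nonneg_right ?_ (hQ.nonneg s i)
    exact Real.le_sqrt_of_sq_le (hQ.sq_le hM (Nat.lt_succ_iff.mp (Finset.mem_range.mp hs)) i)
  calc sqSum Q (T + 1) ^ 2 ≤ (Real.sqrt B * l1Sum Q (T + 1)) ^ 2 :=
        pow_le_pow_left₀ (sqSum_nonneg _ _) h1 2
    _ = _ := by rw [mul_pow, Real.sq_sqrt hB0, hB]; ring

theorem cube_le {Q : ℕ → Fin K → ℝ} (hQ : IsQueuePath Q) {M : ℝ} (hM : 0 < M) (t : ℕ)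
    (i : Fin K) :
    Q t i ^ 3 ≤ 3 * maxIncrement M Q t * sqSum Q (t + 1) := by
  have hL : 0 < maxIncrement M Q t := hM.trans_le (le_maxIncrement M Q t)
  have h1 := cube_le_of_increments (y := fun s => Q s i) (hQ.zero i) (fun t => hQ.nonneg t i)
    hL.le t fun r hr => (le_abs_self _).trans (abs_sub_le_maxIncrement M Q hr i)
  have h2 : ∑ r ∈ Finset.range (t + 1), Q r i ^ 2 ≤ sqSum Q (t + 1) :=
    Finset.sum_le_sum fun r _ => Finset.single_le_sum (f := fun j => Q r j ^ 2)
      (fun j _ => sq_nonneg _) (Finset.mem_univ i)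
  rw [Finset.sum_range_succ] at h2
  nlinarith [mul_le_mul_of_nonneg_left h2 hL.le, mul_nonneg hL.le (sq_nonneg (Q t i))]

end IsQueuePath

/-! ### The learning rate -/

/-- The nondecreasing factor `N_t` of `1 / η_t = t^{-(1/4 - δ/2)} N_t`. -/
def softScale (M : ℝ) (Q : ℕ → Fin K → ℝ) (t : ℕ) : ℝ :=
  maxIncrement M Q (t - 1) *
    Real.sqrt (86 * maxIncrement M Q (t - 1) ^ 2 * (K : ℝ) ^ 6 * (t : ℝ) ^ ((3 : ℝ) / 2)
      + sqSum Q t)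

theorem softEta_eq (M δ : ℝ) (Q : ℕ → Fin K → ℝ) (t : ℕ) :
    softEta M δ Q t = ((t : ℝ) ^ (-(1 / 4 - δ / 2)) * softScale M Q t)⁻¹ := by
  rw [softEta, softScale, sqSum, mul_assoc]

/-- The full 1/η_t also carries a nonincreasing power of t and need not be monotone. Isolating a
monotone factor is what makes the later summation by parts work. -/
theorem softScale_mono {M : ℝ} (hM : 0 < M) (Q : ℕ → Fin K → ℝ) : Monotone (softScale M Q) := by
  intro s t h
  have hL : ∀ t, 0 ≤ maxIncrement M Q t := fun t => (hM.trans_le (le_maxIncrement M Q t)).le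
  have h1 := maxIncrement_mono M Q (Nat.sub_le_sub_right h 1)
  have h2 := sqSum_mono Q h
  have := hL (s - 1)
  have := hL (t - 1)
  unfold softScale
  gcongr

theorem softScale_pos {M : ℝ} (hM : 0 < M) (hK : 0 < K) (Q : ℕ → Fin K → ℝ) {t : ℕ} (ht : 0 < t) :
    0 < softScale M Q t := by
  have hL : 0 < maxIncrement M Q (t - 1) := hM.trans_le (le_maxIncrement M Q _)
  have := sqSum_nonneg Q t
  have hK' : (0 : ℝ) < K := by exact_mod_cast hK
  have ht' : (0 : ℝ) < t := by exact_mod_cast ht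
  unfold softScale
  positivity

theorem softEta_pos {M : ℝ} (δ : ℝ) (hM : 0 < M) (hK : 0 < K) (Q : ℕ → Fin K → ℝ) {t : ℕ}
    (ht : 0 < t) : 0 < softEta M δ Q t := by
  have := softScale_pos hM hK Q ht
  have ht' : (0 : ℝ) < t := by exact_mod_cast ht
  rw [softEta_eq]
  positivity

theorem softScale_succ_le {M : ℝ} (hM : 0 < M) (Q : ℕ → Fin K → ℝ) (t : ℕ) :
    softScale M Q (t + 1) ≤
      10 * (K : ℝ) ^ 3 * maxIncrement M Q t ^ 2 * ((t + 1 : ℕ) : ℝ) ^ ((3 : ℝ) / 4)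
        + maxIncrement M Q t * Real.sqrt (sqSum Q (t + 1)) := by
  have hL : 0 < maxIncrement M Q t := hM.trans_le (le_maxIncrement M Q _)
  have e : ((t + 1 : ℕ) : ℝ) ^ ((3 : ℝ) / 2) = (((t + 1 : ℕ) : ℝ) ^ ((3 : ℝ) / 4)) ^ 2 := by
    rw [← Real.rpow_natCast, ← Real.rpow_mul (by positivity)]; norm_num
  have hp : 0 ≤ ((t + 1 : ℕ) : ℝ) ^ ((3 : ℝ) / 4) := by positivity
  unfold softScale
  rw [Nat.add_sub_cancel, e]
  set L := maxIncrement M Q t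
  set y := ((t + 1 : ℕ) : ℝ) ^ ((3 : ℝ) / 4)
  have h1 : Real.sqrt (86 * L ^ 2 * (K : ℝ) ^ 6 * y ^ 2 + sqSum Q (t + 1)) ≤
      10 * L * (K : ℝ) ^ 3 * y + Real.sqrt (sqSum Q (t + 1)) := by
    have h2 := Real.sqrt_nonneg (sqSum Q (t + 1))
    have h3 := Real.sq_sqrt (sqSum_nonneg Q (t + 1))
    have h4 : 0 ≤ L * (K : ℝ) ^ 3 * y := by positivity
    rw [Real.sqrt_le_iff]
    refine ⟨by positivity, ?_⟩
    nlinarith [mul_nonneg h4 h2, sq_nonneg (L * (K : ℝ) ^ 3 * y)]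
  calc _ ≤ L * (10 * L * (K : ℝ) ^ 3 * y + Real.sqrt (sqSum Q (t + 1))) := by gcongr
    _ = _ := by ring

theorem softGamma_nonneg {M : ℝ} (δ : ℝ) (hM : 0 < M) (hK : 0 < K) (Q : ℕ → Fin K → ℝ) {t : ℕ}
    (ht : 0 < t) : 0 ≤ softGamma M δ Q t := by
  have h1 := softEta_pos δ hM hK Q ht
  have h2 := l1norm_nonneg (Q (t - 1))
  unfold softGamma
  positivity

/-- Let q be the largest queue length. Then ‖Q‖₁ ≤ Kq, and q³/(3L) is at most the sum of squares
under the root in η. What remains is a cubic inequality in q, in which 86 L²K⁶t^{3/2} takes care of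
the small values of q. -/
theorem softGamma_le_half {Q : ℕ → Fin K → ℝ} (hQ : IsQueuePath Q) {M δ : ℝ} (hM : 0 < M)
    (hδ : 0 < δ) (hK : 0 < K) (t : ℕ) : softGamma M δ Q (t + 1) ≤ 1 / 2 := by
  have hL : 0 < maxIncrement M Q t := hM.trans_le (le_maxIncrement M Q _)
  have hML := le_maxIncrement M Q t
  have hK' : (0 : ℝ) < K := by exact_mod_cast hK
  have ht1 : (1 : ℝ) ≤ ((t + 1 : ℕ) : ℝ) := by exact_mod_cast Nat.succ_pos t
  have ht0 : (0 : ℝ) < ((t + 1 : ℕ) : ℝ) := by linarith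
  have hN := softScale_pos hM hK Q (Nat.succ_pos t)
  have : Nonempty (Fin K) := ⟨⟨0, hK⟩⟩
  obtain ⟨j, -, hj⟩ := Finset.exists_max_image Finset.univ (fun i => Q t i) Finset.univ_nonempty
  have hq := hQ.nonneg t j
  have hl1 : l1norm (Q t) ≤ K * Q t j := by
    rw [l1norm_of_nonneg (hQ.nonneg t)]
    simpa using Finset.sum_le_card_nsmul Finset.univ (fun i => Q t i) (Q t j) fun i hi => hj i hi
  have hcube := hQ.cube_le hM t j
  have e : ((t + 1 : ℕ) : ℝ) ^ ((3 : ℝ) / 2) = (((t + 1 : ℕ) : ℝ) ^ ((1 : ℝ) / 4)) ^ 6 := by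
    rw [← Real.rpow_natCast, ← Real.rpow_mul (by positivity)]; norm_num
  have hs : 0 < ((t + 1 : ℕ) : ℝ) ^ ((1 : ℝ) / 4) := by positivity
  have hexp : ((t + 1 : ℕ) : ℝ) ^ (δ / 4) ≤
      ((t + 1 : ℕ) : ℝ) ^ (-(1 / 4 - δ / 2)) * ((t + 1 : ℕ) : ℝ) ^ ((1 : ℝ) / 4) := by
    rw [← Real.rpow_add ht0]
    exact Real.rpow_le_rpow_of_exponent_le ht1 (by linarith)
  have hmain : ((t + 1 : ℕ) : ℝ) ^ ((1 : ℝ) / 4) * l1norm (Q t) ≤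
      1 / 2 * Real.sqrt (86 * maxIncrement M Q t ^ 2 * (K : ℝ) ^ 6 *
        ((t + 1 : ℕ) : ℝ) ^ ((3 : ℝ) / 2) + sqSum Q (t + 1)) := by
    rw [e]
    set s := ((t + 1 : ℕ) : ℝ) ^ ((1 : ℝ) / 4)
    set L := maxIncrement M Q t
    set q := Q t j
    have h1 : s * l1norm (Q t) ≤ s * (K * q) := by gcongr
    suffices 2 * (s * (K * q)) ≤
        Real.sqrt (86 * L ^ 2 * (K : ℝ) ^ 6 * s ^ 6 + sqSum Q (t + 1)) by linarith
    refine Real.le_sqrt_of_sq_le ?_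
    have h3 : 4 * (L * K ^ 2 * s ^ 2) * q ^ 2 ≤ 86 * (L * K ^ 2 * s ^ 2) ^ 3 + q ^ 3 / 3 := by
      set a := L * K ^ 2 * s ^ 2
      have ha : 0 < a := by positivity
      -- The minimum of q³/3 − 4aq² over q ≥ 0 is −(256/3)a³, attained at q = 8a, and 86 ≥ 256/3:
      -- hence the constant in η. The certificate is (q − 8a)²(q + 4a) = q³ − 12aq² + 256a³.
      nlinarith [mul_nonneg (sq_nonneg (q - 8 * a)) (by positivity : 0 ≤ q + 4 * a),
        pow_pos ha 3]
    have h4 : L * (2 * (s * (K * q))) ^ 2 ≤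
        L * (86 * L ^ 2 * (K : ℝ) ^ 6 * s ^ 6 + sqSum Q (t + 1)) := by nlinarith
    exact le_of_mul_le_mul_left h4 hL
  have hmain2 : M * ((t + 1 : ℕ) : ℝ) ^ (δ / 4) * l1norm (Q t) ≤
      1 / 2 * (((t + 1 : ℕ) : ℝ) ^ (-(1 / 4 - δ / 2)) * softScale M Q (t + 1)) := by
    have hl := l1norm_nonneg (Q t)
    calc M * ((t + 1 : ℕ) : ℝ) ^ (δ / 4) * l1norm (Q t)
        ≤ maxIncrement M Q t * (((t + 1 : ℕ) : ℝ) ^ (-(1 / 4 - δ / 2)) *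
            ((t + 1 : ℕ) : ℝ) ^ ((1 : ℝ) / 4)) * l1norm (Q t) := by gcongr
      _ = maxIncrement M Q t * ((t + 1 : ℕ) : ℝ) ^ (-(1 / 4 - δ / 2)) *
            (((t + 1 : ℕ) : ℝ) ^ ((1 : ℝ) / 4) * l1norm (Q t)) := by ring
      _ ≤ maxIncrement M Q t * ((t + 1 : ℕ) : ℝ) ^ (-(1 / 4 - δ / 2)) * _ :=
          mul_le_mul_of_nonneg_left hmain (by positivity)
      _ = _ := by rw [softScale, Nat.add_sub_cancel]; ring
  have hc : 0 < ((t + 1 : ℕ) : ℝ) ^ (-(1 / 4 - δ / 2)) * softScale M Q (t + 1) := by positivity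
  rw [softGamma, softEta_eq, Nat.add_sub_cancel]
  calc _ = M * ((t + 1 : ℕ) : ℝ) ^ (δ / 4) * l1norm (Q t) /
        (((t + 1 : ℕ) : ℝ) ^ (-(1 / 4 - δ / 2)) * softScale M Q (t + 1)) := by
          rw [div_eq_mul_inv]; ring
    _ ≤ 1 / 2 := by rw [div_le_iff₀ hc]; exact hmain2

/-- `∑ η_t ‖Q_{t-1}‖₂² ≤ (2 / M) T^{1/4 - δ/2} √(∑ ‖Q_s‖₂²)`. -/
theorem sum_softEta_mul_sq_le {M δ : ℝ} (hM : 0 < M) (hδ : δ ≤ 1 / 2) (hK : 0 < K)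
    (Q : ℕ → Fin K → ℝ) (T : ℕ) :
    ∑ t ∈ Finset.range T, softEta M δ Q (t + 1) * ∑ i, Q t i ^ 2 ≤
      2 / M * (T : ℝ) ^ (1 / 4 - δ / 2) * Real.sqrt (sqSum Q T) := by
  have key : ∀ t < T, softEta M δ Q (t + 1) * ∑ i, Q t i ^ 2 ≤
      2 / M * (T : ℝ) ^ (1 / 4 - δ / 2) *
        (Real.sqrt (sqSum Q (t + 1)) - Real.sqrt (sqSum Q t)) := by
    intro t ht
    have hL : 0 < maxIncrement M Q t := hM.trans_le (le_maxIncrement M Q _)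
    have hML := le_maxIncrement M Q t
    have hK' : (0 : ℝ) < K := by exact_mod_cast hK
    have ht0 : (0 : ℝ) < ((t + 1 : ℕ) : ℝ) := by positivity
    have hN := softScale_pos hM hK Q (Nat.succ_pos t)
    set z := ∑ i, Q t i ^ 2 with hz
    have hz0 : 0 ≤ z := Finset.sum_nonneg fun _ _ => sq_nonneg _
    have hR0 := Real.sqrt_nonneg (sqSum Q t)
    have hR1 := Real.sqrt_nonneg (sqSum Q (t + 1))
    have hmono : Real.sqrt (sqSum Q t) ≤ Real.sqrt (sqSum Q (t + 1)) :=
      Real.sqrt_le_sqrt (sqSum_mono Q (Nat.le_succ t))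
    -- With r ≤ r' the two roots, z = r'² − r² ≤ 2r'(r' − r). The factor r' cancels against the root
    -- inside η, and r' − r telescopes.
    have hzz : z ≤ 2 * Real.sqrt (sqSum Q (t + 1)) *
        (Real.sqrt (sqSum Q (t + 1)) - Real.sqrt (sqSum Q t)) := by
      have e1 := Real.sq_sqrt (sqSum_nonneg Q t)
      have e2 := Real.sq_sqrt (sqSum_nonneg Q (t + 1))
      rw [sqSum_succ, ← hz] at e2
      rw [sqSum_succ, ← hz] at *
      nlinarith
    have hscale : M * Real.sqrt (sqSum Q (t + 1)) ≤ softScale M Q (t + 1) := by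
      rw [softScale, Nat.add_sub_cancel]
      gcongr
      exact le_add_of_nonneg_left (by positivity)
    have hpow : ((t + 1 : ℕ) : ℝ) ^ (1 / 4 - δ / 2) ≤ (T : ℝ) ^ (1 / 4 - δ / 2) :=
      Real.rpow_le_rpow ht0.le (by exact_mod_cast ht) (by linarith)
    have hp0 : 0 < ((t + 1 : ℕ) : ℝ) ^ (1 / 4 - δ / 2) := by positivity
    rw [softEta_eq, mul_inv, Real.rpow_neg ht0.le, inv_inv]
    set D := Real.sqrt (sqSum Q (t + 1)) - Real.sqrt (sqSum Q t)
    have hD : 0 ≤ D := sub_nonneg.2 hmono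
    have h5 : (softScale M Q (t + 1))⁻¹ * z ≤ 2 / M * D := by
      rw [inv_mul_le_iff₀ hN]
      calc z ≤ 2 * Real.sqrt (sqSum Q (t + 1)) * D := hzz
        _ = M * Real.sqrt (sqSum Q (t + 1)) * (2 / M * D) := by field_simp
        _ ≤ _ := mul_le_mul_of_nonneg_right hscale (by positivity)
    calc ((t + 1 : ℕ) : ℝ) ^ (1 / 4 - δ / 2) * (softScale M Q (t + 1))⁻¹ * z
        = ((t + 1 : ℕ) : ℝ) ^ (1 / 4 - δ / 2) * ((softScale M Q (t + 1))⁻¹ * z) := by ring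
      _ ≤ (T : ℝ) ^ (1 / 4 - δ / 2) * (2 / M * D) := by
          have : 0 ≤ (softScale M Q (t + 1))⁻¹ * z := by positivity
          gcongr
      _ = _ := by ring
  calc _ ≤ ∑ t ∈ Finset.range T, 2 / M * (T : ℝ) ^ (1 / 4 - δ / 2) *
        (Real.sqrt (sqSum Q (t + 1)) - Real.sqrt (sqSum Q t)) :=
        Finset.sum_le_sum fun t ht => key t (Finset.mem_range.mp ht)
    _ = _ := by
        rw [← Finset.mul_sum, Finset.sum_range_sub (fun t => Real.sqrt (sqSum Q t))]
        simp [sqSum]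

/-! ### One step of mirror descent with the entropy regulariser -/

theorem hasFDerivAt_negEntropy {z : Fin K → ℝ} (hz : ∀ i, 0 < z i) :
    HasFDerivAt negEntropy
      (∑ i, Real.log (z i) • ContinuousLinearMap.proj (R := ℝ) (φ := fun _ : Fin K => ℝ) i) z := by
  unfold negEntropy
  refine HasFDerivAt.fun_sum fun i _ => ?_
  have h1 : HasDerivAt (fun r : ℝ => r * Real.log r - r) (Real.log (z i)) (z i) := by
    have := (Real.hasDerivAt_mul_log (hz i).ne').fun_sub (hasDerivAt_id' (z i))
    rwa [add_sub_cancel_right] at this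
  have h2 : HasFDerivAt (fun y : Fin K → ℝ => y i)
      (ContinuousLinearMap.proj (R := ℝ) (φ := fun _ : Fin K => ℝ) i) z :=
    (ContinuousLinearMap.proj (R := ℝ) (φ := fun _ : Fin K => ℝ) i).hasFDerivAt
  exact h1.comp_hasFDerivAt z h2

/-- The generalised Kullback–Leibler divergence, the Bregman divergence of `negEntropy`. -/
def kl (y z : Fin K → ℝ) : ℝ :=
  ∑ i, (y i * Real.log (y i) - y i * Real.log (z i) - y i + z i)

theorem mul_log_sub_mul_log_ge {y z : ℝ} (hy : 0 ≤ y) (hz : 0 < z) :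
    0 ≤ y * Real.log y - y * Real.log z - y + z := by
  rcases hy.eq_or_lt with rfl | hy
  · simpa using hz.le
  · have h := Real.log_le_sub_one_of_pos (div_pos hz hy)
    rw [Real.log_div hz.ne' hy.ne'] at h
    have h2 := mul_le_mul_of_nonneg_left h hy.le
    have h3 : y * (z / y - 1) = z - y := by field_simp
    nlinarith

theorem kl_nonneg {y z : Fin K → ℝ} (hy : ∀ i, 0 ≤ y i) (hz : ∀ i, 0 < z i) : 0 ≤ kl y z :=
  Finset.sum_nonneg fun i _ => mul_log_sub_mul_log_ge (hy i) (hz i)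

theorem truncSimplex_anti {b c : ℝ} (h : b ≤ c) : truncSimplex K c ⊆ truncSimplex K b :=
  fun _ hy => ⟨hy.1, fun i => h.trans (hy.2 i)⟩

theorem convex_truncSimplex (K : ℕ) (b : ℝ) : Convex ℝ (truncSimplex K b) := by
  intro y hy z hz r s hr hs hrs
  refine ⟨convex_stdSimplex ℝ (Fin K) hy.1 hz.1 hr hs hrs, fun i => ?_⟩
  have h1 := mul_le_mul_of_nonneg_left (hy.2 i) hr
  have h2 := mul_le_mul_of_nonneg_left (hz.2 i) hs
  simp only [Pi.add_apply, Pi.smul_apply, smul_eq_mul]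
  calc b = r * b + s * b := by rw [← add_mul, hrs, one_mul]
    _ ≤ _ := add_le_add h1 h2

/-- The variational inequality at a minimiser over a convex set. A positive truncation level keeps
x' off the boundary, where the gradient of Ψ blows up. -/
theorem isMinOn_first_order {b : ℝ} (hb : 0 < b) {c z x' u : Fin K → ℝ} (hz : ∀ i, 0 < z i)
    (hx' : x' ∈ truncSimplex K b) (hu : u ∈ truncSimplex K b)
    (hmin : IsMinOn (fun y : Fin K → ℝ => (∑ i, c i * y i) + bregman negEntropy y z)
      (truncSimplex K b) x') :
    0 ≤ ∑ i, (c i + Real.log (x' i) - Real.log (z i)) * (u i - x' i) := by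
  have hpos : ∀ i, 0 < x' i := fun i => hb.trans_le (hx'.2 i)
  have h1 : HasFDerivAt (fun y : Fin K → ℝ => ∑ i, c i * y i)
      (∑ i, c i • ContinuousLinearMap.proj (R := ℝ) (φ := fun _ : Fin K => ℝ) i) x' :=
    HasFDerivAt.fun_sum fun i _ =>
      ((ContinuousLinearMap.proj (R := ℝ) (φ := fun _ : Fin K => ℝ) i).hasFDerivAt).const_mul (c i)
  have h2 : HasFDerivAt (fun y : Fin K → ℝ => bregman negEntropy y z)
      ((∑ i, Real.log (x' i) • ContinuousLinearMap.proj (R := ℝ) (φ := fun _ : Fin K => ℝ) i)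
        - fderiv ℝ negEntropy z) x' := by
    have h3 : HasFDerivAt (fun y : Fin K → ℝ => fderiv ℝ negEntropy z (y - z))
        (fderiv ℝ negEntropy z) x' := by
      simp only [map_sub]
      exact (fderiv ℝ negEntropy z).hasFDerivAt.sub_const _
    exact ((hasFDerivAt_negEntropy hpos).sub_const (negEntropy z)).sub h3
  have h4 := (hmin.localize).hasFDerivWithinAt_nonneg (h1.add h2).hasFDerivWithinAt
    (mem_posTangentConeAt_of_segment_subset (y := u - x') (by
      rw [add_sub_cancel]
      exact (convex_truncSimplex K b).segment_subset hx' hu))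
  rw [(hasFDerivAt_negEntropy hz).fderiv] at h4
  simp only [add_apply, sub_apply,
    sum_apply, smul_apply,
    ContinuousLinearMap.proj_apply, Pi.sub_apply, smul_eq_mul] at h4
  rw [← Finset.sum_sub_distrib, ← Finset.sum_add_distrib] at h4
  convert h4 using 1
  exact Finset.sum_congr rfl fun i _ => by ring

/-- First-order optimality handles the part u − x'. The part x' − z is paid for by the divergence of
x' from z, which leaves z(e^h − 1 − h) ≤ z h² in each coordinate; the last inequality is where h ≤ 1
enters. -/
theorem mirror_step {b : ℝ} (hb : 0 < b) {h z x' u : Fin K → ℝ} (hz : ∀ i, 0 < z i)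
    (hx' : x' ∈ truncSimplex K b) (hu : u ∈ truncSimplex K b) (h0 : ∀ i, 0 ≤ h i)
    (h1 : ∀ i, h i ≤ 1)
    (hmin : IsMinOn (fun y : Fin K → ℝ => (∑ i, (-h i) * y i) + bregman negEntropy y z)
      (truncSimplex K b) x') :
    ∑ i, h i * (u i - z i) ≤ kl u z - kl u x' + ∑ i, z i * h i ^ 2 := by
  have hpos : ∀ i, 0 < x' i := fun i => hb.trans_le (hx'.2 i)
  have hopt := isMinOn_first_order hb hz hx' hu hmin
  have key : ∀ i, h i * (x' i - z i) -
      (x' i * Real.log (x' i) - x' i * Real.log (z i) - x' i + z i) ≤ z i * h i ^ 2 := by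
    intro i
    have e1 := Real.add_one_le_exp (h i - (Real.log (x' i) - Real.log (z i)))
    have e2 : x' i * Real.exp (h i - (Real.log (x' i) - Real.log (z i))) =
        z i * Real.exp (h i) := by
      rw [Real.exp_sub, Real.exp_sub, Real.exp_log (hpos i), Real.exp_log (hz i)]
      have := (hpos i).ne'
      have := (hz i).ne'
      field_simp
    have e3 := (abs_le.1 (Real.abs_exp_sub_one_sub_id_le
      (abs_le.2 ⟨by linarith [h0 i], h1 i⟩))).2
    have e4 := mul_le_mul_of_nonneg_left e1 (hpos i).le
    rw [e2] at e4
    have e5 := mul_le_mul_of_nonneg_left e3 (hz i).le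
    nlinarith
  have hsum := Finset.sum_le_sum fun i (_ : i ∈ Finset.univ) => key i
  -- The three-point identity of the Bregman divergence.
  have e : ∑ i, h i * (u i - z i) =
      kl u z - kl u x' - ∑ i, (-h i + Real.log (x' i) - Real.log (z i)) * (u i - x' i) +
        ∑ i, (h i * (x' i - z i) -
          (x' i * Real.log (x' i) - x' i * Real.log (z i) - x' i + z i)) := by
    rw [kl, kl, ← Finset.sum_sub_distrib, ← Finset.sum_sub_distrib, ← Finset.sum_add_distrib]
    exact Finset.sum_congr rfl fun i _ => by ring
  rw [e]
  linarith

theorem log_mem_of_mem_truncSimplex {b : ℝ} (hb : 0 < b) {y : Fin K → ℝ}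
    (hy : y ∈ truncSimplex K b) (i : Fin K) :
    Real.log b ≤ Real.log (y i) ∧ Real.log (y i) ≤ 0 := by
  refine ⟨Real.log_le_log hb (hy.2 i), Real.log_nonpos (hy.1.1 i) ?_⟩
  calc y i ≤ ∑ j, y j := Finset.single_le_sum (fun j _ => hy.1.1 j) (Finset.mem_univ i)
    _ = 1 := hy.1.2

theorem kl_le {b : ℝ} (hb : 0 < b) {u x : Fin K → ℝ} (hu : u ∈ truncSimplex K b)
    (hx : x ∈ truncSimplex K b) : kl u x ≤ -Real.log b := by
  have h : ∀ i, u i * Real.log (u i) - u i * Real.log (x i) - u i + x i ≤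
      u i * (-Real.log b) + (x i - u i) := by
    intro i
    have h1 := log_mem_of_mem_truncSimplex hb hu i
    have h2 := log_mem_of_mem_truncSimplex hb hx i
    nlinarith [hu.1.1 i, mul_le_mul_of_nonneg_left h1.2 (hu.1.1 i),
      mul_le_mul_of_nonneg_left h2.1 (hu.1.1 i)]
  refine (Finset.sum_le_sum fun i _ => h i).trans ?_
  rw [Finset.sum_add_distrib, ← Finset.sum_mul, Finset.sum_sub_distrib, hu.1.2, hx.1.2]
  simp

/-- Convexity in the first argument: the difference is at most ⟨log u − log x, u − v⟩, and both
logarithms lie in [log b, 0]. This prices the motion of the comparator. -/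
theorem kl_sub_kl_le {b : ℝ} (hb : 0 < b) {u v x : Fin K → ℝ} (hu : u ∈ truncSimplex K b)
    (hv : v ∈ truncSimplex K b) (hx : x ∈ truncSimplex K b) :
    kl u x - kl v x ≤ -Real.log b * l1norm (u - v) := by
  have h : ∀ i, (u i * Real.log (u i) - u i * Real.log (x i) - u i + x i) -
      (v i * Real.log (v i) - v i * Real.log (x i) - v i + x i) ≤
      -Real.log b * |u i - v i| := by
    intro i
    have h1 := log_mem_of_mem_truncSimplex hb hu i
    have h2 := log_mem_of_mem_truncSimplex hb hx i
    have h3 := mul_log_sub_mul_log_ge (hv.1.1 i) (hb.trans_le (hu.2 i))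
    have h4 : |Real.log (u i) - Real.log (x i)| ≤ -Real.log b :=
      abs_le.2 ⟨by linarith, by linarith⟩
    have h5 := mul_le_mul_of_nonneg_right h4 (abs_nonneg (u i - v i))
    rw [← abs_mul] at h5
    have h6 := le_abs_self ((Real.log (u i) - Real.log (x i)) * (u i - v i))
    nlinarith
  rw [kl, kl, ← Finset.sum_sub_distrib, l1norm, Finset.mul_sum]
  exact Finset.sum_le_sum fun i _ => h i

/-! ### Summation by parts -/

/-- Summation by parts with weights 1/η_t = b_t N_t. Since b is nonincreasing and at most 1, the
increments of b N are at most those of N, so the telescoped divergences cost Λ N_n, while the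
comparator's motion keeps its discount b_t. -/
theorem sum_mul_sub_le_of_factor {b N d d' w : ℕ → ℝ} {Λ : ℝ} (hb0 : ∀ t, 0 ≤ b t)
    (hb1 : ∀ t, b t ≤ 1) (hb : Antitone b) (hN0 : ∀ t, 0 ≤ N t) (hN : Monotone N)
    (hd0 : ∀ t, 0 ≤ d t) (n : ℕ) (hdΛ : ∀ t ≤ n, d t ≤ Λ)
    (hw : ∀ t < n, d (t + 1) - d' t ≤ Λ * w t) :
    ∑ t ∈ Finset.range (n + 1), b t * N t * (d t - d' t) ≤
      Λ * (N n + ∑ t ∈ Finset.range n, b t * N t * w t) - b n * N n * d' n := by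
  induction n with
  | zero =>
    have h1 := mul_le_mul_of_nonneg_right (hb1 0) (hN0 0)
    have h2 := hdΛ 0 le_rfl
    have h3 := mul_le_mul h1 h2 (hd0 0) (by linarith [hN0 0])
    simp
    nlinarith
  | succ n ih =>
    have ih := ih (fun t ht => hdΛ t (by omega)) fun t ht => hw t (by omega)
    have h1 := hw n (by omega)
    have h2 := hdΛ (n + 1) le_rfl
    have hΛ : 0 ≤ Λ := (hd0 _).trans h2
    rw [Finset.sum_range_succ, Finset.sum_range_succ (fun t => b t * N t * w t)]
    have h3 := mul_le_mul_of_nonneg_left h1 (mul_nonneg (hb0 n) (hN0 n))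
    have h4 : b (n + 1) * N (n + 1) - b n * N n ≤ N (n + 1) - N n := by
      have e1 := mul_le_mul_of_nonneg_right (hb (Nat.le_succ n)) (hN0 n)
      have e2 := mul_le_mul_of_nonneg_right (hb1 (n + 1)) (sub_nonneg.2 (hN (Nat.le_succ n)))
      nlinarith
    have h5 : (b (n + 1) * N (n + 1) - b n * N n) * d (n + 1) ≤ (N (n + 1) - N n) * Λ :=
      (mul_le_mul_of_nonneg_right h4 (hd0 _)).trans
        (mul_le_mul_of_nonneg_left h2 (sub_nonneg.2 (hN (Nat.le_succ n))))
    nlinarith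

/-- A path length of order n^{2p}, discounted by t^{-p}, is of order n^p. With p = 1/4 − δ/2 this is
the reason for the power of t in η_t. -/
theorem sum_rpow_neg_mul_le {w : ℕ → ℝ} {C p : ℝ} (hp0 : 0 ≤ p) (hp1 : p ≤ 1)
    (n : ℕ) (hw : ∀ m ≤ n, ∑ t ∈ Finset.range m, w t ≤ C * ((m + 1 : ℕ) : ℝ) ^ (2 * p)) :
    ∑ t ∈ Finset.range n, ((t + 1 : ℕ) : ℝ) ^ (-p) * w t ≤
      3 * C * ((n + 1 : ℕ) : ℝ) ^ p := by
  have hC : 0 ≤ C := by simpa using hw 0 (Nat.zero_le n)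
  -- The partial sum stays in the induction claim. Changing its weight from P⁻¹ to R⁻¹ costs at most
  -- (P⁻¹ − R⁻¹)·C R² = C(R − P)R/P ≤ 2C(R − P), which telescopes.
  have key : ∀ m ≤ n, ∑ t ∈ Finset.range m, ((t + 1 : ℕ) : ℝ) ^ (-p) * w t ≤
      ((m + 1 : ℕ) : ℝ) ^ (-p) * ∑ t ∈ Finset.range m, w t +
        2 * C * (((m + 1 : ℕ) : ℝ) ^ p - 1) := by
    intro m hm
    induction m with
    | zero => simp
    | succ m ih =>
      have ih := ih (by omega)
      have h1 := hw (m + 1) hm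
      rw [Finset.sum_range_succ]
      rw [Finset.sum_range_succ] at h1 ⊢
      have hA : (0 : ℝ) < ((m + 1 : ℕ) : ℝ) := by positivity
      have hB : (0 : ℝ) < ((m + 1 + 1 : ℕ) : ℝ) := by positivity
      rw [mul_comm 2 p, Real.rpow_mul hB.le] at h1
      rw [Real.rpow_neg hA.le] at ih
      rw [Real.rpow_neg hA.le, Real.rpow_neg hB.le]
      have hPR : ((m + 1 : ℕ) : ℝ) ^ p ≤ ((m + 1 + 1 : ℕ) : ℝ) ^ p :=
        Real.rpow_le_rpow hA.le (by exact_mod_cast Nat.le_succ _) hp0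
      have hRP : ((m + 1 + 1 : ℕ) : ℝ) ^ p ≤ 2 * ((m + 1 : ℕ) : ℝ) ^ p := by
        have h2 : ((m + 1 + 1 : ℕ) : ℝ) ≤ 2 * ((m + 1 : ℕ) : ℝ) := by
          push_cast; linarith [(Nat.cast_nonneg m : (0 : ℝ) ≤ m)]
        calc ((m + 1 + 1 : ℕ) : ℝ) ^ p ≤ (2 * ((m + 1 : ℕ) : ℝ)) ^ p :=
              Real.rpow_le_rpow hB.le h2 hp0
          _ = 2 ^ p * ((m + 1 : ℕ) : ℝ) ^ p := Real.mul_rpow (by norm_num) hA.le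
          _ ≤ 2 ^ (1 : ℝ) * ((m + 1 : ℕ) : ℝ) ^ p := by
              gcongr
              norm_num
          _ = _ := by norm_num
      have hP : 0 < ((m + 1 : ℕ) : ℝ) ^ p := by positivity
      have hR : 0 < ((m + 1 + 1 : ℕ) : ℝ) ^ p := by positivity
      set P := ((m + 1 : ℕ) : ℝ) ^ p
      set R := ((m + 1 + 1 : ℕ) : ℝ) ^ p
      set s := ∑ t ∈ Finset.range m, w t
      have h2 : (P⁻¹ - R⁻¹) * (s + w m) ≤ 2 * C * (R - P) := by
        have e0 : 0 ≤ P⁻¹ - R⁻¹ := sub_nonneg.2 (inv_anti₀ hP hPR)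
        have e1 := mul_le_mul_of_nonneg_left h1 e0
        have e2 : (P⁻¹ - R⁻¹) * (C * R ^ (2 : ℝ)) = C * (R - P) * (R / P) := by
          rw [Real.rpow_two]; field_simp
        have e3 : R / P ≤ 2 := by rw [div_le_iff₀ hP]; exact hRP
        have e4 := mul_le_mul_of_nonneg_left e3 (mul_nonneg hC (sub_nonneg.2 hPR))
        rw [e2] at e1
        linarith
      nlinarith
  have h1 := key n le_rfl
  have h2 := hw n le_rfl
  have hA : (0 : ℝ) < ((n + 1 : ℕ) : ℝ) := by positivity
  rw [mul_comm 2 p, Real.rpow_mul hA.le, Real.rpow_two] at h2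
  rw [Real.rpow_neg hA.le] at h1
  have hP : 0 < ((n + 1 : ℕ) : ℝ) ^ p := by positivity
  set P := ((n + 1 : ℕ) : ℝ) ^ p
  have h3 := mul_le_mul_of_nonneg_left h2 (inv_pos.2 hP).le
  have h4 : P⁻¹ * (C * P ^ 2) = C * P := by field_simp
  nlinarith

/-! ### The comparator -/

theorem inv_pow_four_le_one {t : ℕ} (ht : 1 ≤ t) : ((t : ℝ) ^ 4)⁻¹ ≤ 1 :=
  inv_le_one_of_one_le₀ (one_le_pow₀ (by exact_mod_cast ht))

theorem softBeta_pos (hK : 0 < K) {t : ℕ} (ht : 1 ≤ t) : 0 < softBeta K t := by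
  have hK' : (0 : ℝ) < K := by exact_mod_cast hK
  have ht' : (0 : ℝ) < t := by exact_mod_cast ht
  unfold softBeta
  positivity

theorem softBeta_anti {s t : ℕ} (hs : 1 ≤ s) (h : s ≤ t) : softBeta K t ≤ softBeta K s := by
  have hs' : (0 : ℝ) < s := by exact_mod_cast hs
  have h' : (s : ℝ) ≤ t := by exact_mod_cast h
  unfold softBeta
  gcongr

/-- The reference policy, mixed with the uniform distribution so as to lie in the truncated
simplex. -/
def comparator (θ : ℕ → Fin K → ℝ) (t : ℕ) : Fin K → ℝ :=
  fun i => (1 - ((t : ℝ) ^ 4)⁻¹) * θ t i + softBeta K t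

theorem comparator_mem {θ : ℕ → Fin K → ℝ} (hK : 0 < K) {t : ℕ} (ht : 1 ≤ t)
    (hθ : θ t ∈ stdSimplex ℝ (Fin K)) : comparator θ t ∈ truncSimplex K (softBeta K t) := by
  have h1 := inv_pow_four_le_one ht
  have h2 := softBeta_pos hK ht
  have h3 : ∀ i, softBeta K t ≤ comparator θ t i := fun i =>
    le_add_of_nonneg_left (mul_nonneg (by linarith) (hθ.1 i))
  refine ⟨⟨fun i => h2.le.trans (h3 i), ?_⟩, h3⟩
  have hK' : (K : ℝ) ≠ 0 := by exact_mod_cast hK.ne'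
  simp only [comparator]
  rw [Finset.sum_add_distrib, ← Finset.mul_sum, hθ.2]
  simp only [softBeta, Finset.sum_const, Finset.card_univ, Fintype.card_fin, nsmul_eq_mul]
  field_simp
  ring

/-- The mixing weights t⁻⁴ decrease, so their contribution telescopes and adds at most 2 to the path
length of θ. -/
theorem l1norm_comparator_sub_le {θ : ℕ → Fin K → ℝ} (hK : 0 < K) {t : ℕ} (ht : 1 ≤ t)
    (hθ : θ t ∈ stdSimplex ℝ (Fin K)) :
    l1norm (comparator θ (t + 1) - comparator θ t) ≤
      l1norm (θ (t + 1) - θ t) + 2 * (((t : ℝ) ^ 4)⁻¹ - (((t + 1 : ℕ) : ℝ) ^ 4)⁻¹) := by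
  have hK' : (0 : ℝ) < K := by exact_mod_cast hK
  have ht' : (0 : ℝ) < t := by exact_mod_cast ht
  have hc1 := inv_pow_four_le_one (t := t + 1) (by omega)
  have hc : (((t + 1 : ℕ) : ℝ) ^ 4)⁻¹ ≤ ((t : ℝ) ^ 4)⁻¹ := by
    gcongr
    exact Nat.le_succ t
  have hc0 : 0 ≤ (((t + 1 : ℕ) : ℝ) ^ 4)⁻¹ := by positivity
  simp only [l1norm, comparator, softBeta, Pi.sub_apply]
  set c := ((t : ℝ) ^ 4)⁻¹
  set c' := (((t + 1 : ℕ) : ℝ) ^ 4)⁻¹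
  have key : ∀ i, |(1 - c') * θ (t + 1) i + c' / K - ((1 - c) * θ t i + c / K)| ≤
      |θ (t + 1) i - θ t i| + ((c - c') * θ t i + (c - c') / K) := by
    intro i
    have e : (1 - c') * θ (t + 1) i + c' / K - ((1 - c) * θ t i + c / K) =
        (1 - c') * (θ (t + 1) i - θ t i) + ((c - c') * θ t i - (c - c') / K) := by ring
    have h1 : |(1 - c') * (θ (t + 1) i - θ t i)| ≤ |θ (t + 1) i - θ t i| := by
      rw [abs_mul, abs_of_nonneg (by linarith : 0 ≤ 1 - c')]
      exact mul_le_of_le_one_left (abs_nonneg _) (by linarith)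
    have h2 : 0 ≤ (c - c') * θ t i := mul_nonneg (by linarith) (hθ.1 i)
    have h3 : 0 ≤ (c - c') / K := div_nonneg (by linarith) hK'.le
    rw [e]
    refine (abs_add_le _ _).trans (add_le_add h1 (abs_le.2 ⟨by linarith, by linarith⟩))
  refine (Finset.sum_le_sum fun i _ => key i).trans (le_of_eq ?_)
  rw [Finset.sum_add_distrib, Finset.sum_add_distrib, ← Finset.mul_sum, hθ.2]
  simp only [Finset.sum_const, Finset.card_univ, Fintype.card_fin, nsmul_eq_mul]
  field_simp
  ring

theorem sum_l1norm_comparator_le {θ : ℕ → Fin K → ℝ} {CV δ : ℝ} (hK : 0 < K) (hδ : δ ≤ 1 / 2)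
    (hθ : ∀ t, 1 ≤ t → θ t ∈ stdSimplex ℝ (Fin K)) (hV : ReferenceStationary θ CV δ) (m : ℕ) :
    ∑ t ∈ Finset.range m, l1norm (comparator θ (t + 1 + 1) - comparator θ (t + 1)) ≤
      (CV + 2) * ((m + 1 : ℕ) : ℝ) ^ (2 * (1 / 4 - δ / 2)) := by
  have h1 := hV (m + 1) (by omega)
  rw [Finset.sum_Ico_eq_sum_range, Nat.add_sub_cancel] at h1
  have h2 : ∑ t ∈ Finset.range m,
      ((((t + 1 : ℕ) : ℝ) ^ 4)⁻¹ - (((t + 1 + 1 : ℕ) : ℝ) ^ 4)⁻¹) ≤ 1 := by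
    rw [Finset.sum_range_sub' (fun t => (((t + 1 : ℕ) : ℝ) ^ 4)⁻¹)]
    simp
    positivity
  have h3 : (1 : ℝ) ≤ ((m + 1 : ℕ) : ℝ) ^ (2 * (1 / 4 - δ / 2)) :=
    Real.one_le_rpow (by exact_mod_cast Nat.succ_pos m) (by linarith)
  have h4 : ∑ t ∈ Finset.range m, l1norm (comparator θ (t + 1 + 1) - comparator θ (t + 1)) ≤
      ∑ t ∈ Finset.range m, (l1norm (θ (1 + t + 1) - θ (1 + t)) +
        2 * ((((t + 1 : ℕ) : ℝ) ^ 4)⁻¹ - (((t + 1 + 1 : ℕ) : ℝ) ^ 4)⁻¹)) := by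
    refine Finset.sum_le_sum fun t _ => ?_
    rw [add_comm 1 t]
    exact l1norm_comparator_sub_le hK (by omega) (hθ _ (by omega))
  rw [Finset.sum_add_distrib, ← Finset.mul_sum] at h4
  rw [show 2 * (1 / 4 - δ / 2) = 1 / 2 - δ by ring] at *
  nlinarith

/-! ### Regret along a sample path -/

/-- The importance-weighted service estimate of SoftMW+. -/
def softEstimate (M δ : ℝ) (Q S : ℕ → Fin K → ℝ) (a : ℕ → Fin K) (x : ℕ → Fin K → ℝ) (t : ℕ) :
    Fin K → ℝ :=
  feedbackEstimate (softMixed M δ Q x t) (a t) (softFeedback M δ Q S a t)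

/-- `x` are the iterates of SoftMW+ along a sample path. -/
abbrev IsSoftPath (M δ : ℝ) (Q S : ℕ → Fin K → ℝ) (a : ℕ → Fin K) (x : ℕ → Fin K → ℝ) : Prop :=
  IsExp3SPlus (softBeta K) (softEta M δ Q) (softGamma M δ Q) (softExplore Q) a
    (softFeedback M δ Q S a) x

theorem clip_nonneg {M δ s : ℝ} (t : ℕ) (hs : 0 ≤ s) : 0 ≤ clip M δ t s := by
  unfold clip
  split_ifs <;> simp [hs]

theorem clip_le {M : ℝ} (δ s : ℝ) (t : ℕ) (hM : 0 ≤ M) : clip M δ t s ≤ M * (t : ℝ) ^ (δ / 4) := by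
  unfold clip
  split_ifs with h
  · exact h
  · positivity

theorem clip_le_self {M δ s : ℝ} (t : ℕ) (hs : 0 ≤ s) : clip M δ t s ≤ s := by
  unfold clip
  split_ifs <;> simp [hs]

section Path

variable {M δ : ℝ} {Q S : ℕ → Fin K → ℝ} {a : ℕ → Fin K} {x : ℕ → Fin K → ℝ}

theorem uniform_mem_truncSimplex (hK : 0 < K) {y : Fin K → ℝ} (hy : ∀ i, y i = 1 / (K : ℝ)) {t : ℕ}
    (ht : 1 ≤ t) : y ∈ truncSimplex K (softBeta K t) := by
  have hK' : (0 : ℝ) < K := by exact_mod_cast hK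
  refine ⟨⟨fun i => by rw [hy]; positivity, by simp [hy, hK'.ne']⟩, fun i => ?_⟩
  rw [hy, softBeta]
  exact div_le_div_of_nonneg_right (inv_pow_four_le_one ht) hK'.le

/-- The truncation levels decrease, so iterates up to a horizon share the last and largest truncated
simplex. The first iterate comes from no minimisation but is uniform. -/
theorem IsExp3SPlus.mem_of_le {η γ : ℕ → ℝ} {e : ℕ → Fin K → ℝ} {g : ℕ → ℝ}
    (hx : IsExp3SPlus (softBeta K) η γ e a g x) (hK : 0 < K) {t T : ℕ} (ht : t ≤ T) (hT : 1 ≤ T) :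
    x (t + 1) ∈ truncSimplex K (softBeta K T) := by
  rcases Nat.eq_zero_or_pos t with rfl | h
  · exact uniform_mem_truncSimplex hK hx.init hT
  · exact truncSimplex_anti (softBeta_anti h ht) (hx.mem t h)

theorem IsExp3SPlus.pos {η γ : ℕ → ℝ} {e : ℕ → Fin K → ℝ} {g : ℕ → ℝ}
    (hx : IsExp3SPlus (softBeta K) η γ e a g x) (hK : 0 < K) (t : ℕ) (i : Fin K) :
    0 < x (t + 1) i :=
  (softBeta_pos hK (Nat.succ_pos t)).trans_le
    ((hx.mem_of_le hK (Nat.le_succ t) (Nat.succ_pos t)).2 i)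

theorem softExplore_nonneg (hQ : IsQueuePath Q) (t : ℕ) (i : Fin K) : 0 ≤ softExplore Q t i :=
  div_nonneg (hQ.nonneg _ i) (l1norm_nonneg _)

theorem half_le_softMixed (hQ : IsQueuePath Q) (hM : 0 < M) (hδ : 0 < δ) (hK : 0 < K) (t : ℕ)
    (i : Fin K) (hx : 0 ≤ x (t + 1) i) : x (t + 1) i / 2 ≤ softMixed M δ Q x (t + 1) i := by
  have h1 := softGamma_nonneg δ hM hK Q (Nat.succ_pos t)
  have h2 := softGamma_le_half hQ hM hδ hK t
  have h3 := softExplore_nonneg hQ (t + 1) i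
  unfold softMixed mixedAction
  nlinarith [mul_nonneg h1 h3]

theorem explore_le_softMixed (hQ : IsQueuePath Q) (hM : 0 < M) (hδ : 0 < δ) (hK : 0 < K) (t : ℕ)
    (i : Fin K) (hx : 0 ≤ x (t + 1) i) :
    M * ((t + 1 : ℕ) : ℝ) ^ (δ / 4) * softEta M δ Q (t + 1) * Q t i ≤
      softMixed M δ Q x (t + 1) i := by
  have h2 := softGamma_le_half hQ hM hδ hK t
  have e : softGamma M δ Q (t + 1) * softExplore Q (t + 1) i =
      M * ((t + 1 : ℕ) : ℝ) ^ (δ / 4) * softEta M δ Q (t + 1) * Q t i := by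
    unfold softGamma softExplore
    rw [Nat.add_sub_cancel]
    rcases (l1norm_nonneg (Q t)).eq_or_lt with h | h
    · have : Q t i = 0 := by
        have h3 := (Finset.sum_eq_zero_iff_of_nonneg (fun i _ => abs_nonneg (Q t i))).1 h.symm i
          (Finset.mem_univ i)
        exact abs_eq_zero.1 h3
      simp [this]
    · field_simp
  rw [← e]
  unfold softMixed mixedAction
  nlinarith

theorem softEstimate_nonneg (hQ : IsQueuePath Q) (hM : 0 < M) (hδ : 0 < δ) (hK : 0 < K) (t : ℕ)
    (hx : ∀ i, 0 < x (t + 1) i) (hS : 0 ≤ S (t + 1) (a (t + 1))) (i : Fin K) :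
    0 ≤ softEstimate M δ Q S a x (t + 1) i := by
  unfold softEstimate feedbackEstimate
  split_ifs
  · have h1 := half_le_softMixed hQ hM hδ hK t (a (t + 1)) (hx _).le
    exact div_nonneg (mul_nonneg (hQ.nonneg _ _) (clip_nonneg _ hS))
      (by linarith [hx (a (t + 1))])
  · exact le_rfl

/-- The purpose of clipping and exploration: the clipped service is at most Mt^{δ/4}, so the
numerator of η g̃ is at most Mt^{δ/4} η Q_{t-1,i}, which is exactly the exploration part of the
sampling probability. -/
theorem softEta_mul_softEstimate_le_one (hQ : IsQueuePath Q) (hM : 0 < M) (hδ : 0 < δ)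
    (hK : 0 < K) (t : ℕ) (hx : ∀ i, 0 < x (t + 1) i) (i : Fin K) :
    softEta M δ Q (t + 1) * softEstimate M δ Q S a x (t + 1) i ≤ 1 := by
  unfold softEstimate feedbackEstimate
  split_ifs
  · have h1 := half_le_softMixed hQ hM hδ hK t (a (t + 1)) (hx _).le
    have h2 := explore_le_softMixed hQ hM hδ hK t (a (t + 1)) (hx _).le
    have h3 := clip_le δ (S (t + 1) (a (t + 1))) (t + 1) hM.le
    have hη := softEta_pos δ hM hK Q (Nat.succ_pos t)
    have hp : 0 < softMixed M δ Q x (t + 1) (a (t + 1)) := by linarith [hx (a (t + 1))]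
    rw [← mul_div_assoc, div_le_one hp, softFeedback, Nat.add_sub_cancel]
    refine le_trans ?_ h2
    have h4 := mul_le_mul_of_nonneg_left h3 (mul_nonneg hη.le (hQ.nonneg t (a (t + 1))))
    linarith
  · simp

/-- Each mirror step is divided by η_t and the results are summed by parts, with every divergence at
most −log β_{T+1}. The second-order term is kept as it stands: it is controlled only in expectation.
-/
theorem sum_softEstimate_mul_le (hQ : IsQueuePath Q) (hM : 0 < M) (hδ : 0 < δ) (hδ' : δ ≤ 1 / 2)
    (hK : 0 < K) (hx : IsSoftPath M δ Q S a x) (hS : ∀ t, 1 ≤ t → 0 ≤ S t (a t))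
    {θ : ℕ → Fin K → ℝ} {CV : ℝ} (hθ : ∀ t, 1 ≤ t → θ t ∈ stdSimplex ℝ (Fin K))
    (hV : ReferenceStationary θ CV δ) (T : ℕ) :
    ∑ t ∈ Finset.range (T + 1), ∑ i,
        softEstimate M δ Q S a x (t + 1) i * (comparator θ (t + 1) i - x (t + 1) i) ≤
      -Real.log (softBeta K (T + 1)) * (softScale M Q (T + 1) *
          (1 + 3 * (CV + 2) * ((T + 1 : ℕ) : ℝ) ^ (1 / 4 - δ / 2))) +
        ∑ t ∈ Finset.range (T + 1), softEta M δ Q (t + 1) *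
          ∑ i, x (t + 1) i * softEstimate M δ Q S a x (t + 1) i ^ 2 := by
  have hβ := softBeta_pos hK (Nat.succ_pos T)
  have hu : ∀ t ≤ T, comparator θ (t + 1) ∈ truncSimplex K (softBeta K (T + 1)) := fun t ht =>
    truncSimplex_anti (softBeta_anti (by omega) (by omega))
      (comparator_mem hK (by omega) (hθ _ (by omega)))
  have hxm : ∀ t ≤ T + 1, x (t + 1) ∈ truncSimplex K (softBeta K (T + 1)) := fun t ht =>
    hx.mem_of_le hK ht (by omega)
  set b : ℕ → ℝ := fun t => ((t + 1 : ℕ) : ℝ) ^ (-(1 / 4 - δ / 2)) with hb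
  set N : ℕ → ℝ := fun t => softScale M Q (t + 1) with hN
  have hN0 : ∀ t, 0 < N t := fun t => softScale_pos hM hK Q (Nat.succ_pos t)
  have hb0 : ∀ t, 0 < b t := fun t => Real.rpow_pos_of_pos (by positivity) _
  have hη : ∀ t, softEta M δ Q (t + 1) = (b t * N t)⁻¹ := fun t => softEta_eq M δ Q (t + 1)
  have step : ∀ t < T + 1, ∑ i, softEstimate M δ Q S a x (t + 1) i *
      (comparator θ (t + 1) i - x (t + 1) i) ≤
      b t * N t * (kl (comparator θ (t + 1)) (x (t + 1)) -
        kl (comparator θ (t + 1)) (x (t + 2))) +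
      softEta M δ Q (t + 1) * ∑ i, x (t + 1) i * softEstimate M δ Q S a x (t + 1) i ^ 2 := by
    intro t ht
    have hη0 := softEta_pos δ hM hK Q (Nat.succ_pos t)
    have hpos : ∀ i, 0 < x (t + 1) i := hx.pos hK t
    have h1 := mirror_step (softBeta_pos hK (Nat.succ_pos t))
      (h := fun i => softEta M δ Q (t + 1) * softEstimate M δ Q S a x (t + 1) i)
      (z := x (t + 1)) (x' := x (t + 2)) (u := comparator θ (t + 1)) hpos
      (hx.mem (t + 1) (by omega)) (comparator_mem hK (by omega) (hθ _ (by omega)))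
      (fun i => mul_nonneg hη0.le
        (softEstimate_nonneg hQ hM hδ hK t hpos (hS _ (by omega)) i))
      (softEta_mul_softEstimate_le_one hQ hM hδ hK t hpos)
      (by
        simpa only [neg_mul, softEstimate, softMixed] using hx.isMinOn (t + 1) (by omega))
    have e1 : ∑ i, softEta M δ Q (t + 1) * softEstimate M δ Q S a x (t + 1) i *
        (comparator θ (t + 1) i - x (t + 1) i) = softEta M δ Q (t + 1) *
        ∑ i, softEstimate M δ Q S a x (t + 1) i * (comparator θ (t + 1) i - x (t + 1) i) := by
      rw [Finset.mul_sum]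
      exact Finset.sum_congr rfl fun i _ => by ring
    have e2 : ∑ i, x (t + 1) i *
        (softEta M δ Q (t + 1) * softEstimate M δ Q S a x (t + 1) i) ^ 2 =
        softEta M δ Q (t + 1) * (softEta M δ Q (t + 1) *
          ∑ i, x (t + 1) i * softEstimate M δ Q S a x (t + 1) i ^ 2) := by
      rw [Finset.mul_sum, Finset.mul_sum]
      exact Finset.sum_congr rfl fun i _ => by ring
    rw [e1, e2] at h1
    have h2 : b t * N t = (softEta M δ Q (t + 1))⁻¹ := by rw [hη, inv_inv]
    rw [h2]
    refine le_of_mul_le_mul_left ?_ hη0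
    rw [mul_add, ← mul_assoc (softEta M δ Q (t + 1)) (softEta M δ Q (t + 1))⁻¹,
      mul_inv_cancel₀ hη0.ne', one_mul]
    exact h1
  refine (Finset.sum_le_sum fun t ht => step t (Finset.mem_range.mp ht)).trans ?_
  rw [Finset.sum_add_distrib]
  refine add_le_add_left ?_ _
  have hΛ : 0 ≤ -Real.log (softBeta K (T + 1)) :=
    (kl_nonneg (fun i => (hu 0 (Nat.zero_le T)).1.1 i) (hx.pos hK 0)).trans
      (kl_le hβ (hu 0 (Nat.zero_le T)) (hxm 0 (by omega)))
  have abel := sum_mul_sub_le_of_factor (b := b) (N := N)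
    (d := fun t => kl (comparator θ (t + 1)) (x (t + 1)))
    (d' := fun t => kl (comparator θ (t + 1)) (x (t + 2)))
    (w := fun t => l1norm (comparator θ (t + 1 + 1) - comparator θ (t + 1)))
    (Λ := -Real.log (softBeta K (T + 1)))
    (fun t => (hb0 t).le)
    (fun t => Real.rpow_le_one_of_one_le_of_nonpos (by exact_mod_cast Nat.succ_pos t)
      (by linarith))
    (antitone_nat_of_succ_le fun t => Real.rpow_le_rpow_of_nonpos (by positivity)
      (by exact_mod_cast Nat.le_succ _) (by linarith))
    (fun t => (hN0 t).le) (fun s t h => softScale_mono hM Q (Nat.succ_le_succ h))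
    (fun t => kl_nonneg
      (fun i => (comparator_mem hK (by omega) (hθ (t + 1) (by omega))).1.1 i) (hx.pos hK t)) T
    (fun t ht => kl_le hβ (hu t ht) (hxm t (by omega)))
    (fun t ht => kl_sub_kl_le hβ (hu (t + 1) ht) (hu t ht.le) (hxm (t + 1) (by omega)))
  have hlast : 0 ≤ kl (comparator θ (T + 1)) (x (T + 2)) :=
    kl_nonneg (fun i => (hu T le_rfl).1.1 i) (hx.pos hK (T + 1))
  have htv := sum_rpow_neg_mul_le (by linarith : 0 ≤ 1 / 4 - δ / 2)
    (by linarith : 1 / 4 - δ / 2 ≤ 1) T fun m _ => sum_l1norm_comparator_le hK hδ' hθ hV m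
  have hsum : ∑ t ∈ Finset.range T,
      b t * N t * l1norm (comparator θ (t + 1 + 1) - comparator θ (t + 1)) ≤
      N T * (3 * (CV + 2) * ((T + 1 : ℕ) : ℝ) ^ (1 / 4 - δ / 2)) := by
    refine le_trans ?_ (mul_le_mul_of_nonneg_left htv (hN0 T).le)
    rw [Finset.mul_sum]
    refine Finset.sum_le_sum fun t ht => ?_
    have h1 : N t ≤ N T :=
      softScale_mono hM Q (Nat.succ_le_succ (Finset.mem_range.mp ht).le)
    have h2 := mul_le_mul_of_nonneg_right h1 (mul_nonneg (hb0 t).le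
      (l1norm_nonneg (comparator θ (t + 1 + 1) - comparator θ (t + 1))))
    calc _ = N t * (b t * l1norm (comparator θ (t + 1 + 1) - comparator θ (t + 1))) := by ring
      _ ≤ _ := h2
  have h3 := mul_nonneg (mul_nonneg (hb0 T).le (hN0 T).le) hlast
  refine abel.trans ?_
  calc _ ≤ -Real.log (softBeta K (T + 1)) * (N T + ∑ t ∈ Finset.range T,
        b t * N t * l1norm (comparator θ (t + 1 + 1) - comparator θ (t + 1))) :=
        sub_le_self _ h3
    _ ≤ -Real.log (softBeta K (T + 1)) *
        (N T + N T * (3 * (CV + 2) * ((T + 1 : ℕ) : ℝ) ^ (1 / 4 - δ / 2))) := by gcongr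
    _ = _ := by rw [hN]; ring

end Path

/-! ### Collecting powers of the horizon -/

/-- Young's inequality with exponents 4 and 4/3, in the form (GZ)⁴ ≤ Y(κX)³ ≤ (κX + Y)⁴. This is the
self-bounding step, trading √∑‖Q‖₂² for a small multiple of ∑‖Q‖₁. -/
theorem mul_le_add_of_pow_four_le {G Z X L κ : ℝ} (hX : 0 ≤ X) (hL : 0 ≤ L)
    (hκ : 0 < κ) (h : Z ^ 4 ≤ 2 * L * X ^ 3) : G * Z ≤ κ * X + 2 * L * G ^ 4 / κ ^ 3 := by
  set Y := 2 * L * G ^ 4 / κ ^ 3 with hY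
  have hG4 : 0 ≤ G ^ 4 := by positivity
  have hY0 : 0 ≤ Y := by positivity
  have hκX : 0 ≤ κ * X := by positivity
  have h1 : (G * Z) ^ 4 ≤ (κ * X + Y) ^ 4 := by
    calc (G * Z) ^ 4 = G ^ 4 * Z ^ 4 := by ring
      _ ≤ G ^ 4 * (2 * L * X ^ 3) := mul_le_mul_of_nonneg_left h hG4
      _ = Y * (κ * X) ^ 3 := by rw [hY]; field_simp
      _ ≤ (κ * X + Y) * (κ * X + Y) ^ 3 := by gcongr <;> linarith
      _ = _ := by ring
  exact le_of_abs_le ((pow_le_pow_iff_left₀ (abs_nonneg _) (by positivity) four_ne_zero).1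
    (by rwa [Even.pow_abs (by decide)]))

theorem neg_log_softBeta_le {δ : ℝ} (hδ : 0 < δ) (hK : 0 < K) {t : ℕ} (ht : 1 ≤ t) :
    -Real.log (softBeta K t) ≤ (K + 56 / δ) * (t : ℝ) ^ (δ / 14) := by
  have hK' : (0 : ℝ) < K := by exact_mod_cast hK
  have ht' : (1 : ℝ) ≤ t := by exact_mod_cast ht
  have ht0 : (0 : ℝ) < t := by linarith
  have h1 : Real.log (softBeta K t) = -(4 * Real.log t) - Real.log K := by
    rw [softBeta, Real.log_div (by positivity) hK'.ne', Real.log_inv, Real.log_pow]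
    norm_num
  have h2 := Real.log_le_sub_one_of_pos hK'
  have h3 := Real.log_le_rpow_div ht0.le (by positivity : 0 < δ / 14)
  have h4 : (1 : ℝ) ≤ (t : ℝ) ^ (δ / 14) := Real.one_le_rpow ht' (by positivity)
  have h5 : (t : ℝ) ^ (δ / 14) / (δ / 14) = 14 / δ * (t : ℝ) ^ (δ / 14) := by
    field_simp
  rw [h5] at h3
  have h6 := mul_le_mul_of_nonneg_left h4 hK'.le
  have h7 : (K + 56 / δ) * (t : ℝ) ^ (δ / 14) =
      K * (t : ℝ) ^ (δ / 14) + 4 * (14 / δ * (t : ℝ) ^ (δ / 14)) := by ring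
  rw [h1, h7]
  linarith

theorem pow_le_one_add_rpow {y α : ℝ} (hy : 0 ≤ y) {m : ℕ} (hm : (m : ℝ) ≤ α) :
    y ^ m ≤ 1 + y ^ α := by
  rcases le_total y 1 with h | h
  · have := pow_le_one₀ hy h (n := m)
    have := Real.rpow_nonneg hy α
    linarith
  · have := Real.rpow_le_rpow_of_exponent_le h hm
    rw [Real.rpow_natCast] at this
    linarith

/-- After normalising L by τ^{1/α}, each factor L costs τ^{1/α}. The leftover L^α/τ has bounded mean
once E[L^α] = O(τ). -/
theorem pow_mul_rpow_le {L τ α q r : ℝ} (hL : 0 ≤ L) (hτ : 1 ≤ τ) (hα : 0 < α) {m : ℕ}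
    (hm : (m : ℝ) ≤ α) (hq : q + m / α ≤ r) :
    L ^ m * τ ^ q ≤ τ ^ r * (1 + L ^ α / τ) := by
  have hτ0 : 0 < τ := by linarith
  have h1 := pow_le_one_add_rpow (y := L / τ ^ (1 / α)) (by positivity) hm
  have h2 : (L / τ ^ (1 / α)) ^ α = L ^ α / τ := by
    rw [Real.div_rpow hL (by positivity), ← Real.rpow_mul hτ0.le, one_div_mul_cancel hα.ne',
      Real.rpow_one]
  have h3 : (L / τ ^ (1 / α)) ^ m = L ^ m / τ ^ (m / α) := by
    rw [div_pow, ← Real.rpow_natCast (τ ^ (1 / α)), ← Real.rpow_mul hτ0.le]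
    congr 2
    ring
  rw [h2, h3, div_le_iff₀ (by positivity)] at h1
  calc L ^ m * τ ^ q ≤ (1 + L ^ α / τ) * τ ^ (m / α) * τ ^ q := by gcongr
    _ = τ ^ (q + m / α) * (1 + L ^ α / τ) := by rw [Real.rpow_add hτ0]; ring
    _ ≤ τ ^ r * (1 + L ^ α / τ) := by
        have : 0 ≤ 1 + L ^ α / τ := by positivity
        gcongr

/-- The constant in front of the sublinear part of the regret. -/
def regretConst (K : ℕ) (M δ ε CV : ℝ) : ℝ :=
  10 * (K : ℝ) ^ 3 * ((K + 56 / δ) * (3 * CV + 7)) +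
    128 / ε ^ 3 * ((((K : ℝ) + 56 / δ) * (3 * CV + 7)) ^ 4 + (2 * M * (2 + K)) ^ 4)

theorem regretConst_nonneg (K : ℕ) {M δ ε CV : ℝ} (hδ : 0 < δ) (hε : 0 < ε)
    (hCV : 0 < CV) : 0 ≤ regretConst K M δ ε CV := by
  have : 0 ≤ (2 * M * (2 + K)) ^ 4 := by positivity
  unfold regretConst
  positivity

/-- The bookkeeping of exponents, with 1/α < δ/7 and the logarithm absorbed in τ^{δ/14}. The term
L²τ^{3/4} uses up the whole exponent 1 − δ/7. The two terms with Z take ε/4 each in Young's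
inequality and leave L⁵ and L times powers of τ, within the exponents 1 − δ and 1 − 6δ/7. -/
theorem regret_terms_le {M α δ ε CV τ L X Z Λ N : ℝ} (hM : 0 < M) (hα : 5 ≤ α)
    (hδ : 0 < δ) (hδ' : δ ≤ 1 / 2) (hε : 0 < ε) (hCV : 0 < CV) (hδα : 7 < δ * α) (hτ : 1 ≤ τ)
    (hL : 0 ≤ L) (hX : 0 ≤ X) (hZ0 : 0 ≤ Z) (hZ : Z ^ 4 ≤ 2 * L * X ^ 3)
    (hΛ : Λ ≤ (K + 56 / δ) * τ ^ (δ / 14)) (hN0 : 0 ≤ N)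
    (hN : N ≤ 10 * (K : ℝ) ^ 3 * L ^ 2 * τ ^ ((3 : ℝ) / 4) + L * Z) :
    Λ * (N * (1 + 3 * (CV + 2) * τ ^ (1 / 4 - δ / 2))) +
        (2 * M ^ 2 + K * M ^ 2) * τ ^ (δ / 4) * (2 / M * τ ^ (1 / 4 - δ / 2) * Z) ≤
      ε / 2 * X + regretConst K M δ ε CV * (τ ^ (1 - δ / 7) * (1 + L ^ α / τ)) := by
  have hτ0 : 0 < τ := by linarith
  have hα0 : 0 < α := by linarith
  have hinv : 1 / α < δ / 7 := by
    rw [div_lt_div_iff₀ hα0 (by norm_num)]; linarith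
  have hp : (1 : ℝ) ≤ τ ^ (1 / 4 - δ / 2) := Real.one_le_rpow hτ (by linarith)
  have hP : 0 < τ ^ (1 / 4 - δ / 2) := by positivity
  set c := ((K : ℝ) + 56 / δ) * (3 * CV + 7) with hc
  have hc0 : 0 < c := by positivity
  set W := τ ^ (1 - δ / 7) * (1 + L ^ α / τ) with hW
  have b2 : L ^ 2 * τ ^ (δ / 14 + (1 / 4 - δ / 2) + 3 / 4) ≤ W :=
    pow_mul_rpow_le hL hτ hα0 (by push_cast; linarith) (by
      have : ((2 : ℕ) : ℝ) / α = 2 * (1 / α) := by push_cast; ring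
      rw [this]; linarith)
  have b5 : L ^ 5 * τ ^ (4 * (δ / 14 + (1 / 4 - δ / 2))) ≤ W :=
    pow_mul_rpow_le hL hτ hα0 (by push_cast; linarith) (by
      have : ((5 : ℕ) : ℝ) / α = 5 * (1 / α) := by push_cast; ring
      rw [this]; linarith)
  have b1 : L ^ 1 * τ ^ (4 * (δ / 4 + (1 / 4 - δ / 2))) ≤ W :=
    pow_mul_rpow_le hL hτ hα0 (by push_cast; linarith) (by
      have : ((1 : ℕ) : ℝ) / α = 1 / α := by push_cast; ring
      rw [this]; linarith)
  have pow4 : ∀ e : ℝ, (τ ^ e) ^ 4 = τ ^ (4 * e) := fun e => by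
    rw [← Real.rpow_natCast, ← Real.rpow_mul hτ0.le]; congr 1; push_cast; ring
  set G₁ := c * τ ^ (δ / 14 + (1 / 4 - δ / 2)) * L with hG₁
  set G₂ := 2 * M * (2 + K) * τ ^ (δ / 4 + (1 / 4 - δ / 2)) with hG₂
  have y1 := mul_le_add_of_pow_four_le (G := G₁) hX hL (by positivity : 0 < ε / 4) hZ
  have y2 := mul_le_add_of_pow_four_le (G := G₂) hX hL (by positivity : 0 < ε / 4) hZ
  have e1 : 2 * L * G₁ ^ 4 / (ε / 4) ^ 3 =
      128 / ε ^ 3 * c ^ 4 * (L ^ 5 * τ ^ (4 * (δ / 14 + (1 / 4 - δ / 2)))) := by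
    rw [hG₁, ← pow4]; field_simp; ring
  have e2 : 2 * L * G₂ ^ 4 / (ε / 4) ^ 3 =
      128 / ε ^ 3 * (2 * M * (2 + K)) ^ 4 * (L ^ 1 * τ ^ (4 * (δ / 4 + (1 / 4 - δ / 2)))) := by
    rw [hG₂, ← pow4]; field_simp; ring
  rw [e1] at y1
  rw [e2] at y2
  have d1 := mul_le_mul_of_nonneg_left b5 (by positivity : 0 ≤ 128 / ε ^ 3 * c ^ 4)
  have d2 := mul_le_mul_of_nonneg_left b1 (by positivity :
    0 ≤ 128 / ε ^ 3 * (2 * M * (2 + K)) ^ 4)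
  have d3 := mul_le_mul_of_nonneg_left b2 (by positivity : 0 ≤ 10 * (K : ℝ) ^ 3 * c)
  have first : Λ * (N * (1 + 3 * (CV + 2) * τ ^ (1 / 4 - δ / 2))) ≤
      10 * (K : ℝ) ^ 3 * c * (L ^ 2 * τ ^ (δ / 14 + (1 / 4 - δ / 2) + 3 / 4)) + G₁ * Z := by
    have f1 : 1 + 3 * (CV + 2) * τ ^ (1 / 4 - δ / 2) ≤ (3 * CV + 7) * τ ^ (1 / 4 - δ / 2) := by
      linarith
    calc Λ * (N * (1 + 3 * (CV + 2) * τ ^ (1 / 4 - δ / 2)))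
        ≤ (K + 56 / δ) * τ ^ (δ / 14) *
          ((10 * (K : ℝ) ^ 3 * L ^ 2 * τ ^ ((3 : ℝ) / 4) + L * Z) *
            ((3 * CV + 7) * τ ^ (1 / 4 - δ / 2))) := by gcongr
      _ = _ := by
          rw [hG₁, hc, Real.rpow_add hτ0, Real.rpow_add hτ0]; ring
  have second : (2 * M ^ 2 + K * M ^ 2) * τ ^ (δ / 4) * (2 / M * τ ^ (1 / 4 - δ / 2) * Z) =
      G₂ * Z := by
    rw [hG₂, Real.rpow_add hτ0]; field_simp
  have e3 : regretConst K M δ ε CV * W = 10 * (K : ℝ) ^ 3 * c * W +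
      (128 / ε ^ 3 * c ^ 4 * W + 128 / ε ^ 3 * (2 * M * (2 + K)) ^ 4 * W) := by
    rw [regretConst]; ring
  rw [second, e3]
  linarith

/-- The pathwise regret bound of the mirror descent part of SoftMW+ together with the exploration
cost. -/
theorem sum_softEstimate_mul_add_le {M α δ ε CV : ℝ} {Q S : ℕ → Fin K → ℝ} {a : ℕ → Fin K}
    {x : ℕ → Fin K → ℝ} (hQ : IsQueuePath Q) (hM : 0 < M) (hα : 5 ≤ α) (hδ : 0 < δ)
    (hδ' : δ ≤ 1 / 2) (hε : 0 < ε) (hCV : 0 < CV) (hδα : 7 < δ * α)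
    (hK : 0 < K) (hx : IsSoftPath M δ Q S a x) (hS : ∀ t, 1 ≤ t → 0 ≤ S t (a t))
    {θ : ℕ → Fin K → ℝ} (hθ : ∀ t, 1 ≤ t → θ t ∈ stdSimplex ℝ (Fin K))
    (hV : ReferenceStationary θ CV δ) (T : ℕ) :
    ∑ t ∈ Finset.range (T + 1), ∑ i,
        softEstimate M δ Q S a x (t + 1) i * (comparator θ (t + 1) i - x (t + 1) i) +
      (2 * M ^ 2 + K * M ^ 2) * ((T + 1 : ℕ) : ℝ) ^ (δ / 4) *
        ∑ t ∈ Finset.range (T + 1), softEta M δ Q (t + 1) * ∑ i, Q t i ^ 2 ≤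
      ∑ t ∈ Finset.range (T + 1), softEta M δ Q (t + 1) *
          ∑ i, x (t + 1) i * softEstimate M δ Q S a x (t + 1) i ^ 2 +
      (ε / 2 * l1Sum Q (T + 1) + regretConst K M δ ε CV * (((T + 1 : ℕ) : ℝ) ^ (1 - δ / 7) *
        (1 + maxIncrement M Q T ^ α / ((T + 1 : ℕ) : ℝ)))) := by
  have h1 := sum_softEstimate_mul_le hQ hM hδ hδ' hK hx hS hθ hV T
  have h2 := sum_softEta_mul_sq_le hM hδ' hK Q (T + 1)
  have hZ : Real.sqrt (sqSum Q (T + 1)) ^ 4 ≤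
      2 * maxIncrement M Q T * l1Sum Q (T + 1) ^ 3 := by
    have h3 := hQ.sqSum_sq_le hM T
    have h4 : Real.sqrt (sqSum Q (T + 1)) ^ 4 = sqSum Q (T + 1) ^ 2 := by
      rw [show (4 : ℕ) = 2 * 2 by norm_num, pow_mul, Real.sq_sqrt (sqSum_nonneg _ _)]
    rwa [h4]
  have h3 := regret_terms_le (K := K) hM hα hδ hδ' hε hCV hδα
    (by exact_mod_cast Nat.succ_pos T : (1 : ℝ) ≤ ((T + 1 : ℕ) : ℝ))
    (hM.le.trans (le_maxIncrement M Q T)) (l1Sum_nonneg Q (T + 1)) (Real.sqrt_nonneg _) hZ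
    (neg_log_softBeta_le hδ hK (Nat.succ_pos T)) (softScale_pos hM hK Q (Nat.succ_pos T)).le
    (softScale_succ_le hM Q T)
  have h4 := mul_le_mul_of_nonneg_left h2 (by positivity :
    0 ≤ (2 * M ^ 2 + K * M ^ 2) * ((T + 1 : ℕ) : ℝ) ^ (δ / 4))
  linarith

/-! ### Increments of the queue lengths -/

section Increments

variable {A S : ℕ → Fin K → ℝ} {a : ℕ → Fin K}

theorem queueLength_succ_le {t : ℕ} {i : Fin K} (hA : 0 ≤ A (t + 1) i) (hS : 0 ≤ S (t + 1) i) :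
    queueLength A S a (t + 1) i ≤ queueLength A S a t i + A (t + 1) i := by
  have := queueLength_nonneg A S a t i
  simp only [queueLength]
  split_ifs <;> exact max_le (by linarith) (by linarith)

theorem le_queueLength_succ {t : ℕ} {i : Fin K} (hA : 0 ≤ A (t + 1) i) (hS : 0 ≤ S (t + 1) i) :
    queueLength A S a t i ≤ queueLength A S a (t + 1) i + S (t + 1) i := by
  simp only [queueLength]
  split_ifs
  · linarith [le_max_left (queueLength A S a t i + A (t + 1) i - S (t + 1) i) 0]
  · linarith [le_max_left (queueLength A S a t i + A (t + 1) i - 0) 0]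

theorem queueLength_succ_sq_le {t : ℕ} {i : Fin K} (hA : 0 ≤ A (t + 1) i)
    (hS : 0 ≤ S (t + 1) i) :
    queueLength A S a (t + 1) i ^ 2 ≤ queueLength A S a t i ^ 2 +
      2 * (queueLength A S a t i * A (t + 1) i) -
      2 * (queueLength A S a t i * (if i = a (t + 1) then S (t + 1) i else 0)) +
      A (t + 1) i ^ 2 + (if i = a (t + 1) then S (t + 1) i ^ 2 else 0) := by
  set q := queueLength A S a t i
  have h : ∀ y : ℝ, (max y 0) ^ 2 ≤ y ^ 2 := fun y => by
    rcases le_total y 0 with h | h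
    · rw [max_eq_right h]; simpa using sq_nonneg y
    · rw [max_eq_left h]
  simp only [queueLength]
  refine (h _).trans ?_
  split_ifs <;> nlinarith [mul_nonneg hA hS]

/-- A queue moves up by at most its arrival and down by at most its service, and a maximum of α-th
powers is at most their sum. The crude sum suffices: only E[L^α] = O(T) is needed. -/
theorem maxIncrement_rpow_le {M α : ℝ} (hM : 0 < M) (hα : 0 < α)
    (hA : ∀ t, 1 ≤ t → ∀ i, 0 ≤ A t i) (hS : ∀ t, 1 ≤ t → ∀ i, 0 ≤ S t i) (T : ℕ) :
    maxIncrement M (queueLength A S a) T ^ α ≤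
      M ^ α + ∑ t ∈ Finset.range T, ∑ i, (A (t + 1) i ^ α + S (t + 1) i ^ α) := by
  induction T with
  | zero => simp [maxIncrement]
  | succ t ih =>
    have hL := hM.trans_le (le_maxIncrement M (queueLength A S a) t)
    rw [Finset.sum_range_succ, ← add_assoc]
    set B := ∑ i, (A (t + 1) i ^ α + S (t + 1) i ^ α) with hB
    have hterm : ∀ i, 0 ≤ A (t + 1) i ^ α + S (t + 1) i ^ α := fun i =>
      add_nonneg (Real.rpow_nonneg (hA _ (by omega) i) _) (Real.rpow_nonneg (hS _ (by omega) i) _)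
    have hB0 : 0 ≤ B := Finset.sum_nonneg fun i _ => hterm i
    have h1 : ‖queueLength A S a (t + 1) - queueLength A S a t‖ ^ α ≤ B := by
      have h2 : ‖queueLength A S a (t + 1) - queueLength A S a t‖ ≤ B ^ (1 / α) := by
        rw [pi_norm_le_iff_of_nonneg (by positivity)]
        intro i
        have hAi := hA (t + 1) (by omega) i
        have hSi := hS (t + 1) (by omega) i
        have h3 := queueLength_succ_le (a := a) hAi hSi
        have h4 := le_queueLength_succ (a := a) hAi hSi
        have h5 : A (t + 1) i ^ α + S (t + 1) i ^ α ≤ B :=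
          Finset.single_le_sum (f := fun i => A (t + 1) i ^ α + S (t + 1) i ^ α)
            (fun j _ => hterm j) (Finset.mem_univ i)
        have h6 := Real.rpow_nonneg hAi α
        have h7 := Real.rpow_nonneg hSi α
        have root : ∀ y : ℝ, 0 ≤ y → y ^ α ≤ B → y ≤ B ^ (1 / α) := fun y hy hyB => by
          have := Real.rpow_le_rpow (Real.rpow_nonneg hy α) hyB (by positivity : 0 ≤ 1 / α)
          rwa [← Real.rpow_mul hy, mul_one_div_cancel hα.ne', Real.rpow_one] at this
        have h8 := root _ hAi (by linarith)
        have h9 := root _ hSi (by linarith)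
        rw [Real.norm_eq_abs, Pi.sub_apply]
        exact abs_le.2 ⟨by linarith, by linarith⟩
      have h3 := Real.rpow_le_rpow (norm_nonneg _) h2 hα.le
      rwa [← Real.rpow_mul hB0, one_div_mul_cancel hα.ne', Real.rpow_one] at h3
    have h2 := Real.rpow_nonneg hL.le α
    rw [maxIncrement]
    rcases max_choice (maxIncrement M (queueLength A S a) t)
      ‖queueLength A S a (t + 1) - queueLength A S a t‖ with h | h <;> rw [h] <;> linarith

end Increments

/-! ### The probabilistic model -/

/-- The queue-length path of the sample point `ω`. -/
abbrev queuePath (A S : ℕ → Ω → Fin K → ℝ) (a : ℕ → Ω → Fin K) (ω : Ω) : ℕ → Fin K → ℝ :=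
  fun s => queueProc A S a s ω

/-- A queueing system with bounded moments that is scheduled by SoftMW+. -/
structure Model [MeasurableSpace Ω] (μ : Measure Ω) (M α δ : ℝ) (A S : ℕ → Ω → Fin K → ℝ)
    (a : ℕ → Ω → Fin K) (x : ℕ → Ω → Fin K → ℝ) : Prop where
  pos_moment : 0 < M
  pos_delta : 0 < δ
  delta_le : δ ≤ 1 / 2
  lt_mul : 7 < δ * α
  pos_types : 0 < K
  env : IsEnvironment μ A S
  alg : IsSoftMWPlus μ M δ A S a x
  moments : BoundedMoments μ M α A S a

theorem isQueuePath_queuePath (A S : ℕ → Ω → Fin K → ℝ) (a : ℕ → Ω → Fin K) (ω : Ω) :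
    IsQueuePath (queuePath A S a ω) :=
  isQueuePath_queueLength _ _ _

theorem aestronglyMeasurable_inv {m m₀ : MeasurableSpace Ω} {μ : Measure[m₀] Ω} {f : Ω → ℝ}
    (hf : AEStronglyMeasurable[m] f μ) : AEStronglyMeasurable[m] (fun ω => (f ω)⁻¹) μ := by
  obtain ⟨g, hg, h⟩ := hf
  refine ⟨fun ω => (g ω)⁻¹, hg.measurable.inv.stronglyMeasurable, ?_⟩
  filter_upwards [h] with ω hω
  rw [hω]

/-! ### Measurability of the learning parameters -/

section Measurability

variable {m : MeasurableSpace Ω} {Q : ℕ → Ω → Fin K → ℝ}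

theorem measurable_maxIncrement (M : ℝ) {t : ℕ} (h : ∀ s ≤ t, Measurable (Q s)) :
    Measurable fun ω => maxIncrement M (fun s => Q s ω) t := by
  induction t with
  | zero => exact measurable_const
  | succ t ih =>
    exact (ih fun s hs => h s (by omega)).max
      ((h (t + 1) le_rfl).sub (h t (Nat.le_succ t))).norm

theorem measurable_softEta (M δ : ℝ) {t : ℕ} (h : ∀ s ≤ t, Measurable (Q s)) :
    Measurable fun ω => softEta M δ (fun s => Q s ω) (t + 1) := by
  have h1 := measurable_maxIncrement M h
  have h2 : Measurable fun ω => ∑ s ∈ Finset.range (t + 1), ∑ i, Q s ω i ^ 2 :=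
    Finset.measurable_sum _ fun s hs => Finset.measurable_sum _ fun i _ =>
      ((measurable_pi_apply i).comp (h s (Nat.lt_succ_iff.mp (Finset.mem_range.mp hs)))).pow_const 2
  unfold softEta
  simp only [Nat.add_sub_cancel]
  fun_prop

theorem measurable_l1norm_apply {t : ℕ} (h : Measurable (Q t)) :
    Measurable fun ω => l1norm (Q t ω) := by
  unfold l1norm
  exact Finset.measurable_sum _ fun i _ => ((measurable_pi_apply i).comp h).abs

theorem measurable_softGamma (M δ : ℝ) {t : ℕ} (h : ∀ s ≤ t, Measurable (Q s)) :
    Measurable fun ω => softGamma M δ (fun s => Q s ω) (t + 1) := by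
  have h1 := measurable_softEta M δ h
  have h2 := measurable_l1norm_apply (h t le_rfl)
  unfold softGamma
  simp only [Nat.add_sub_cancel]
  fun_prop

theorem measurable_softExplore {t : ℕ} (h : Measurable (Q t)) (i : Fin K) :
    Measurable fun ω => softExplore (fun s => Q s ω) (t + 1) i := by
  have h2 := measurable_l1norm_apply h
  have h3 : Measurable fun ω => Q t ω i := (measurable_pi_apply i).comp h
  unfold softExplore
  simp only [Nat.add_sub_cancel]
  fun_prop

end Measurability

theorem measurable_clip (M δ : ℝ) (t : ℕ) : Measurable (clip M δ t) := by
  unfold clip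
  exact Measurable.ite measurableSet_Iic measurable_id measurable_const

namespace Model

theorem measurable_queueProc_history (A S : ℕ → Ω → Fin K → ℝ) (a : ℕ → Ω → Fin K) {s t : ℕ}
    (h : s ≤ t) : Measurable[history A S a t] (queueProc A S a s) := by
  rw [measurable_iff_comap_le]
  refine le_trans ?_ le_sup_right
  exact le_iSup₂_of_le (f := fun s (_ : s ∈ Finset.range (t + 1)) =>
    MeasurableSpace.comap (queueProc A S a s) inferInstance) s
    (Finset.mem_range.mpr (Nat.lt_succ_of_le h)) le_rfl

theorem measurable_queue_apply_history (A S : ℕ → Ω → Fin K → ℝ) (a : ℕ → Ω → Fin K) (t : ℕ)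
    (i : Fin K) : Measurable[history A S a t] fun ω => queueProc A S a t ω i :=
  (measurable_pi_apply i).comp (measurable_queueProc_history A S a le_rfl)

variable [MeasurableSpace Ω] {μ : Measure Ω} {M α δ : ℝ}
  {A S : ℕ → Ω → Fin K → ℝ} {a : ℕ → Ω → Fin K} {x : ℕ → Ω → Fin K → ℝ}

theorem measurable_action_eq (H : Model μ M α δ A S a x) (t : ℕ) (i : Fin K) :
    MeasurableSet {ω | a (t + 1) ω = i} :=
  H.alg.measurable_action (t + 1) (by omega) (measurableSet_singleton i)

theorem measurable_arrival_apply (H : Model μ M α δ A S a x) (t : ℕ) (i : Fin K) :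
    Measurable fun ω => A (t + 1) ω i :=
  (measurable_pi_apply i).comp (H.env.measurable_arrival (t + 1) (by omega))

theorem measurable_service_apply (H : Model μ M α δ A S a x) (t : ℕ) (i : Fin K) :
    Measurable fun ω => S (t + 1) ω i :=
  (measurable_pi_apply i).comp (H.env.measurable_service (t + 1) (by omega))

theorem measurable_queueProc (H : Model μ M α δ A S a x) (t : ℕ) :
    Measurable (queueProc A S a t) := by
  induction t with
  | zero => exact measurable_const
  | succ t ih =>
    refine measurable_pi_lambda _ fun i => ?_
    have h1 : Measurable fun ω => queueProc A S a t ω i := (measurable_pi_apply i).comp ih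
    have h2 : Measurable fun ω => if i = a (t + 1) ω then S (t + 1) ω i else 0 := by
      refine Measurable.ite ?_ (H.measurable_service_apply t i) measurable_const
      simpa only [eq_comm] using H.measurable_action_eq t i
    exact ((h1.add (H.measurable_arrival_apply t i)).sub h2).max measurable_const

theorem history_le (H : Model μ M α δ A S a x) (t : ℕ) :
    history A S a t ≤ (inferInstance : MeasurableSpace Ω) := by
  refine sup_le (iSup₂_le fun s hs => ?_) (iSup₂_le fun s _ => (H.measurable_queueProc s).comap_le)
  have hs1 : 1 ≤ s := (Finset.mem_Icc.mp hs).1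
  refine sup_le (sup_le (H.alg.measurable_action s hs1).comap_le
    (H.env.measurable_arrival s hs1).comap_le) (Measurable.comap_le ?_)
  have e : (fun ω => S s ω (a s ω)) = fun ω => ∑ i, if a s ω = i then S s ω i else 0 := by
    ext ω; simp
  rw [e]
  exact Finset.measurable_sum _ fun i _ => Measurable.ite
    (H.alg.measurable_action s hs1 (measurableSet_singleton i))
    ((measurable_pi_apply i).comp (H.env.measurable_service s hs1)) measurable_const

theorem measurable_queue_apply (H : Model μ M α δ A S a x) (t : ℕ) (i : Fin K) :
    Measurable fun ω => queueProc A S a t ω i :=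
  (measurable_pi_apply i).comp (H.measurable_queueProc t)

theorem iterate_pos (H : Model μ M α δ A S a x) (t : ℕ) (ω : Ω) (i : Fin K) :
    0 < x (t + 1) ω i :=
  (H.alg.exp3 ω).pos H.pos_types t i

theorem iterate_mem (H : Model μ M α δ A S a x) (t : ℕ) (ω : Ω) :
    x (t + 1) ω ∈ truncSimplex K (softBeta K (t + 1)) :=
  (H.alg.exp3 ω).mem_of_le H.pos_types (Nat.le_succ t) (Nat.succ_pos t)

theorem iterate_le_one (H : Model μ M α δ A S a x) (t : ℕ) (ω : Ω) (i : Fin K) :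
    x (t + 1) ω i ≤ 1 :=
  calc x (t + 1) ω i ≤ ∑ j, x (t + 1) ω j :=
        Finset.single_le_sum (fun j _ => (H.iterate_pos t ω j).le) (Finset.mem_univ i)
    _ = 1 := (H.iterate_mem t ω).1.2

/-- The sampling distribution of SoftMW+ at the sample point `ω`. -/
abbrev mixed (M δ : ℝ) (A S : ℕ → Ω → Fin K → ℝ) (a : ℕ → Ω → Fin K) (x : ℕ → Ω → Fin K → ℝ)
    (t : ℕ) (ω : Ω) : Fin K → ℝ :=
  softMixed M δ (fun s => queueProc A S a s ω) (fun s => x s ω) t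

theorem half_le_mixed (H : Model μ M α δ A S a x) (t : ℕ) (ω : Ω) (i : Fin K) :
    x (t + 1) ω i / 2 ≤ mixed M δ A S a x (t + 1) ω i :=
  half_le_softMixed (x := fun s => x s ω) (isQueuePath_queuePath A S a ω) H.pos_moment H.pos_delta
    H.pos_types t i (H.iterate_pos t ω i).le

theorem mixed_pos (H : Model μ M α δ A S a x) (t : ℕ) (ω : Ω) (i : Fin K) :
    0 < mixed M δ A S a x (t + 1) ω i := by
  linarith [H.half_le_mixed t ω i, H.iterate_pos t ω i]

theorem mixed_le_one (H : Model μ M α δ A S a x) (t : ℕ) (ω : Ω) (i : Fin K) :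
    mixed M δ A S a x (t + 1) ω i ≤ 1 := by
  have hQ := isQueuePath_queuePath A S a ω
  have h1 := H.iterate_le_one t ω i
  have h2 := softGamma_nonneg δ H.pos_moment H.pos_types (queuePath A S a ω) (Nat.succ_pos t)
  have h3 := softGamma_le_half hQ H.pos_moment H.pos_delta H.pos_types t
  have h4 : softExplore (queuePath A S a ω) (t + 1) i ≤ 1 := by
    refine div_le_one_of_le₀ ?_ (l1norm_nonneg _)
    rw [l1norm_of_nonneg (hQ.nonneg _)]
    exact Finset.single_le_sum (fun j _ => hQ.nonneg _ j) (Finset.mem_univ i)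
  simp only [mixed, softMixed, mixedAction]
  nlinarith

theorem mixed_aestronglyMeasurable (H : Model μ M α δ A S a x) (t : ℕ) (i : Fin K) :
    AEStronglyMeasurable[history A S a t] (fun ω => mixed M δ A S a x (t + 1) ω i) μ :=
  ⟨_, stronglyMeasurable_condExp, (H.alg.sampling (t + 1) (by omega) i).symm⟩

/-- No measurable choice of minimisers is made. The sampling rule identifies p almost everywhere
with a conditional expectation given the history, and p = (1 − γ)x + γe can be solved for x because
γ ≤ 1/2. -/
theorem iterate_aestronglyMeasurable (H : Model μ M α δ A S a x) (t : ℕ) (i : Fin K) :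
    AEStronglyMeasurable[history A S a t] (fun ω => x (t + 1) ω i) μ := by
  have hm : ∀ s ≤ t, Measurable[history A S a t] (queueProc A S a s) := fun s hs =>
    measurable_queueProc_history A S a hs
  have hγ := (@measurable_softGamma K Ω (history A S a t) (queueProc A S a) M δ t hm)
  have he := (@measurable_softExplore K Ω (history A S a t) (queueProc A S a) t (hm t le_rfl) i)
  have h1 : AEStronglyMeasurable[history A S a t] (fun ω => (1 - softGamma M δ
      (fun s => queueProc A S a s ω) (t + 1))⁻¹) μ :=
    (measurable_const.sub hγ).inv.stronglyMeasurable.aestronglyMeasurable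
  have h2 : AEStronglyMeasurable[history A S a t] (fun ω => softGamma M δ
      (fun s => queueProc A S a s ω) (t + 1) *
      softExplore (fun s => queueProc A S a s ω) (t + 1) i) μ :=
    (hγ.mul he).stronglyMeasurable.aestronglyMeasurable
  have h3 := ((H.mixed_aestronglyMeasurable t i).sub h2).mul h1
  refine h3.congr (ae_of_all _ fun ω => ?_)
  have h4 := softGamma_le_half (isQueuePath_queuePath A S a ω) H.pos_moment H.pos_delta
    H.pos_types t
  have h5 : 1 - softGamma M δ (fun s => queueProc A S a s ω) (t + 1) ≠ 0 := by
    have : softGamma M δ (fun s => queueProc A S a s ω) (t + 1) ≤ 1 / 2 := h4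
    linarith
  simp only [Pi.mul_apply, Pi.sub_apply, mixed, softMixed, mixedAction]
  field_simp
  ring

theorem queue_aestronglyMeasurable (A S : ℕ → Ω → Fin K → ℝ) (a : ℕ → Ω → Fin K)
    (μ : Measure Ω) (t : ℕ) (i : Fin K) :
    AEStronglyMeasurable[history A S a t] (fun ω => queueProc A S a t ω i) μ :=
  (measurable_queue_apply_history A S a t i).stronglyMeasurable.aestronglyMeasurable

theorem softEta_aestronglyMeasurable (M δ : ℝ) (A S : ℕ → Ω → Fin K → ℝ) (a : ℕ → Ω → Fin K)
    (μ : Measure Ω) (t : ℕ) :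
    AEStronglyMeasurable[history A S a t] (fun ω => softEta M δ (queuePath A S a ω) (t + 1)) μ :=
  (@measurable_softEta K Ω (history A S a t) (queueProc A S a) M δ t fun _ hs =>
    measurable_queueProc_history A S a hs).stronglyMeasurable.aestronglyMeasurable

/-! ### Conditioning on the past -/

theorem indepFun_of_history (H : Model μ M α δ A S a x) {t : ℕ} {g : Ω → ℝ}
    (hg : Measurable[history A S a t ⊔ MeasurableSpace.comap (a (t + 1)) inferInstance] g)
    {ψ : (Fin K → ℝ) × (Fin K → ℝ) → ℝ} (hψ : Measurable ψ) :
    IndepFun g (fun ω => ψ (A (t + 1) ω, S (t + 1) ω)) μ := by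
  rw [IndepFun_iff_Indep]
  refine (indep_of_indep_of_le_left (indep_of_indep_of_le_right
    (H.alg.fresh (t + 1) (by omega)).symm ?_) hg.comap_le)
  rintro s ⟨u, hu, rfl⟩
  exact ⟨ψ ⁻¹' u, hψ hu, rfl⟩

/-- Independence from the fresh environment applies to functions measurable with respect to the past
and the action, while h is so only up to a null set. -/
theorem exists_measurable_indicator {t : ℕ} {h : Ω → ℝ}
    (hm : AEStronglyMeasurable[history A S a t] h μ) (i : Fin K) :
    ∃ g : Ω → ℝ, Measurable[history A S a t ⊔ MeasurableSpace.comap (a (t + 1)) inferInstance] g ∧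
      (fun ω => if a (t + 1) ω = i then h ω else 0) =ᵐ[μ] g := by
  obtain ⟨g, hg, hae⟩ := hm
  refine ⟨fun ω => if a (t + 1) ω = i then g ω else 0, ?_, ?_⟩
  · refine Measurable.ite ?_ (hg.measurable.mono le_sup_left le_rfl) measurable_const
    exact le_sup_right (a := history A S a t) _ ⟨{i}, measurableSet_singleton i, rfl⟩
  · filter_upwards [hae] with ω hω
    rw [hω]

theorem integrable_ite_mul (H : Model μ M α δ A S a x) {t : ℕ} {h : Ω → ℝ}
    (hm : AEStronglyMeasurable[history A S a t] h μ) (hi : Integrable h μ) (i : Fin K)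
    {ψ : (Fin K → ℝ) × (Fin K → ℝ) → ℝ} (hψ : Measurable ψ)
    (hψi : Integrable (fun ω => ψ (A (t + 1) ω, S (t + 1) ω)) μ) :
    Integrable (fun ω => (if a (t + 1) ω = i then h ω else 0) *
      ψ (A (t + 1) ω, S (t + 1) ω)) μ := by
  obtain ⟨g, hg, hae⟩ := exists_measurable_indicator hm i
  have h1 : Integrable (fun ω => if a (t + 1) ω = i then h ω else 0) μ :=
    (hi.indicator (H.measurable_action_eq t i)).congr (ae_of_all _ fun ω => by
      simp [Set.indicator_apply])
  have h2 := (H.indepFun_of_history hg hψ).integrable_mul (h1.congr hae) hψi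
  refine h2.congr ?_
  filter_upwards [hae] with ω hω
  simp [hω]

/-- Integrating out the fresh environment and the freshly sampled action. -/
theorem integral_ite_mul [IsProbabilityMeasure μ] (H : Model μ M α δ A S a x) {t : ℕ} {h : Ω → ℝ}
    (hm : AEStronglyMeasurable[history A S a t] h μ) (hi : Integrable h μ) (i : Fin K)
    {ψ : (Fin K → ℝ) × (Fin K → ℝ) → ℝ} (hψ : Measurable ψ) :
    ∫ ω, (if a (t + 1) ω = i then h ω else 0) * ψ (A (t + 1) ω, S (t + 1) ω) ∂μ =
      (∫ ω, h ω * mixed M δ A S a x (t + 1) ω i ∂μ) * ∫ ω, ψ (A (t + 1) ω, S (t + 1) ω) ∂μ := by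
  obtain ⟨g, hg, hae⟩ := exists_measurable_indicator hm i
  have hle : history A S a t ⊔ MeasurableSpace.comap (a (t + 1)) inferInstance ≤
      (inferInstance : MeasurableSpace Ω) :=
    sup_le (H.history_le t) (H.alg.measurable_action (t + 1) (by omega)).comap_le
  have h1 : ∫ ω, (if a (t + 1) ω = i then h ω else 0) * ψ (A (t + 1) ω, S (t + 1) ω) ∂μ =
      ∫ ω, g ω * ψ (A (t + 1) ω, S (t + 1) ω) ∂μ :=
    integral_congr_ae (by filter_upwards [hae] with ω hω; rw [hω])
  have hpair : Measurable fun ω => (A (t + 1) ω, S (t + 1) ω) :=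
    (H.env.measurable_arrival _ (by omega)).prodMk (H.env.measurable_service _ (by omega))
  rw [h1, (H.indepFun_of_history hg hψ).integral_fun_mul_eq_mul_integral
    (hg.mono hle le_rfl).aestronglyMeasurable (hψ.comp hpair).aestronglyMeasurable,
    ← integral_congr_ae hae]
  congr 1
  set ind : Ω → ℝ := {ω | a (t + 1) ω = i}.indicator fun _ => (1 : ℝ) with hind
  have e : (fun ω => if a (t + 1) ω = i then h ω else 0) = h * ind := by
    ext ω
    simp [hind, Set.indicator_apply]
  have hint : Integrable (h * ind) μ := by
    rw [← e]
    exact (hi.indicator (H.measurable_action_eq t i)).congr (ae_of_all _ fun ω => by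
      simp [Set.indicator_apply])
  have h2 := condExp_mul_of_aestronglyMeasurable_left hm hint
    ((integrable_const (1 : ℝ)).indicator (H.measurable_action_eq t i))
  -- Conditioning on the history pulls h out and turns the indicator of the action into its sampling
  -- probability.
  rw [e, ← integral_condExp (H.history_le t)]
  refine integral_congr_ae ?_
  filter_upwards [h2, H.alg.sampling (t + 1) (by omega) i] with ω hω1 hω2
  rw [hω1, Pi.mul_apply]
  congr 1

theorem integral_mul_fresh (H : Model μ M α δ A S a x) {t : ℕ} {h : Ω → ℝ}
    (hm : Measurable[history A S a t] h) {ψ : (Fin K → ℝ) × (Fin K → ℝ) → ℝ}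
    (hψ : Measurable ψ) :
    ∫ ω, h ω * ψ (A (t + 1) ω, S (t + 1) ω) ∂μ =
      (∫ ω, h ω ∂μ) * ∫ ω, ψ (A (t + 1) ω, S (t + 1) ω) ∂μ := by
  have hpair : Measurable fun ω => (A (t + 1) ω, S (t + 1) ω) :=
    (H.env.measurable_arrival _ (by omega)).prodMk (H.env.measurable_service _ (by omega))
  exact (H.indepFun_of_history (hm.mono le_sup_left le_rfl) hψ).integral_fun_mul_eq_mul_integral
    (hm.mono (H.history_le t) le_rfl).aestronglyMeasurable (hψ.comp hpair).aestronglyMeasurable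

end Model

/-! ### Moments -/

section Moments

variable [MeasurableSpace Ω] {μ : Measure Ω} {M α : ℝ} {X : Ω → ℝ}

/-- Weighted AM–GM for (y/M)^α and 1. The right side is affine in y^α and equals M^k at y^α = M^α,
so one pointwise inequality yields both integrability and the moment bound M^k. -/
theorem pow_le_of_rpow {y : ℝ} (hy : 0 ≤ y) (hM : 0 < M) (hα : 0 < α) {k : ℕ} (hk : (k : ℝ) ≤ α) :
    y ^ k ≤ M ^ k * (k / α) / M ^ α * y ^ α + M ^ k * (1 - k / α) := by
  have hw : (k : ℝ) / α ≤ 1 := (div_le_one hα).2 hk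
  have h1 := Real.geom_mean_le_arith_mean2_weighted (w₁ := k / α) (w₂ := 1 - k / α)
    (p₁ := (y / M) ^ α) (p₂ := 1) (by positivity) (by linarith) (by positivity) zero_le_one
    (by ring)
  rw [Real.one_rpow, mul_one, ← Real.rpow_mul (by positivity), mul_div_cancel₀ _ hα.ne',
    Real.rpow_natCast, div_pow, Real.div_rpow hy hM.le, mul_one, div_le_iff₀ (by positivity)] at h1
  calc y ^ k ≤ _ := h1
    _ = _ := by ring

theorem integrable_pow_of_rpow [IsFiniteMeasure μ] (hX : Measurable X) (h0 : ∀ᵐ ω ∂μ, 0 ≤ X ω) (hM : 0 < M)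
    (hα : 0 < α) (hi : Integrable (fun ω => X ω ^ α) μ) {k : ℕ} (hk : (k : ℝ) ≤ α) :
    Integrable (fun ω => X ω ^ k) μ := by
  refine ((hi.const_mul (M ^ k * (k / α) / M ^ α)).add
    (integrable_const (M ^ k * (1 - k / α)))).mono' (hX.pow_const k).aestronglyMeasurable ?_
  filter_upwards [h0] with ω hω
  rw [Real.norm_of_nonneg (pow_nonneg hω k)]
  exact pow_le_of_rpow hω hM hα hk

theorem integral_pow_le_of_rpow [IsProbabilityMeasure μ] (hX : Measurable X) (h0 : ∀ᵐ ω ∂μ, 0 ≤ X ω) (hM : 0 < M)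
    (hα : 0 < α) (hi : Integrable (fun ω => X ω ^ α) μ) (hle : ∫ ω, X ω ^ α ∂μ ≤ M ^ α) {k : ℕ}
    (hk : (k : ℝ) ≤ α) : ∫ ω, X ω ^ k ∂μ ≤ M ^ k := by
  have h1 : ∫ ω, X ω ^ k ∂μ ≤
      ∫ ω, (M ^ k * (k / α) / M ^ α * X ω ^ α + M ^ k * (1 - k / α)) ∂μ := by
    refine integral_mono_ae (integrable_pow_of_rpow hX h0 hM hα hi hk)
      ((hi.const_mul _).add (integrable_const _)) ?_
    filter_upwards [h0] with ω hω
    exact pow_le_of_rpow hω hM hα hk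
  rw [integral_add (hi.const_mul _) (integrable_const _), integral_const_mul] at h1
  simp only [integral_const, probReal_univ, one_smul] at h1
  have h2 : 0 ≤ M ^ k * (k / α) / M ^ α := by positivity
  have h3 := mul_le_mul_of_nonneg_left hle h2
  have h4 : M ^ k * (k / α) / M ^ α * M ^ α + M ^ k * (1 - k / α) = M ^ k := by
    have : 0 < M ^ α := by positivity
    field_simp
    ring
  linarith

/-- Where clipping acts, y exceeds B = Mt^{δ/4}, hence y ≤ y^α / B^{α−1}. -/
theorem sub_clip_le {δ y : ℝ} (hy : 0 ≤ y) (hM : 0 < M) (hα : 1 ≤ α) {t : ℕ} (ht : 1 ≤ t) :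
    y - clip M δ t y ≤ ((M * (t : ℝ) ^ (δ / 4)) ^ (α - 1))⁻¹ * y ^ α := by
  have ht' : (0 : ℝ) < t := by exact_mod_cast ht
  have hB : 0 < M * (t : ℝ) ^ (δ / 4) := by positivity
  unfold clip
  split_ifs with h
  · rw [sub_self]; positivity
  · push Not at h
    have hy' : 0 < y := hB.trans h
    have h1 : y ^ α = y * y ^ (α - 1) := by
      rw [← Real.rpow_one_add' hy'.le (by linarith)]; congr 1; ring
    have h2 := Real.rpow_le_rpow hB.le h.le (by linarith : 0 ≤ α - 1)
    rw [sub_zero, h1, inv_mul_eq_div, le_div_iff₀ (by positivity)]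
    gcongr

theorem integral_sub_clip_le {δ : ℝ} (h0 : ∀ᵐ ω ∂μ, 0 ≤ X ω) (hM : 0 < M)
    (hα : 2 ≤ α) (hδ : δ ≤ 1 / 2) (hδα : 7 < δ * α)
    (hi : Integrable (fun ω => X ω ^ α) μ) (hle : ∫ ω, X ω ^ α ∂μ ≤ M ^ α) {t : ℕ} (ht : 1 ≤ t) :
    ∫ ω, (X ω - clip M δ t (X ω)) ∂μ ≤ M * (t : ℝ) ^ (-(3 : ℝ) / 2) := by
  have ht' : (1 : ℝ) ≤ t := by exact_mod_cast ht
  have ht0 : (0 : ℝ) < t := by linarith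
  have h1 : ∫ ω, (X ω - clip M δ t (X ω)) ∂μ ≤
      ∫ ω, ((M * (t : ℝ) ^ (δ / 4)) ^ (α - 1))⁻¹ * X ω ^ α ∂μ := by
    refine integral_mono_of_nonneg ?_ (hi.const_mul _) ?_
    · filter_upwards [h0] with ω hω
      exact sub_nonneg.2 (clip_le_self t hω)
    · filter_upwards [h0] with ω hω
      exact sub_clip_le hω hM (by linarith) ht
  rw [integral_const_mul] at h1
  have h2 : 0 ≤ ((M * (t : ℝ) ^ (δ / 4)) ^ (α - 1))⁻¹ := by positivity
  refine h1.trans ((mul_le_mul_of_nonneg_left hle h2).trans ?_)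
  have h3 : ((M * (t : ℝ) ^ (δ / 4)) ^ (α - 1))⁻¹ * M ^ α =
      M * (t : ℝ) ^ (-(δ / 4 * (α - 1))) := by
    have hMα : M ^ α = M * M ^ (α - 1) := by
      rw [← Real.rpow_one_add' hM.le (by linarith)]; congr 1; ring
    rw [Real.mul_rpow hM.le (by positivity), hMα, ← Real.rpow_mul ht0.le, Real.rpow_neg ht0.le]
    have : 0 < M ^ (α - 1) := by positivity
    field_simp
  rw [h3]
  -- Here δ(α − 1)/4 > (7 − 1/2)/4 > 3/2. The rate t^{-3/2} beats mean queue lengths of order t in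
  -- `regret_apply_le`.
  refine mul_le_mul_of_nonneg_left (Real.rpow_le_rpow_of_exponent_le ht' ?_) hM.le
  linarith

theorem integral_combination {f₁ f₂ f₃ f₄ f₅ : Ω → ℝ} (h₁ : Integrable f₁ μ)
    (h₂ : Integrable f₂ μ) (h₃ : Integrable f₃ μ) (h₄ : Integrable f₄ μ) (h₅ : Integrable f₅ μ) :
    ∫ ω, (f₁ ω + 2 * f₂ ω - 2 * f₃ ω + f₄ ω + f₅ ω) ∂μ =
      ∫ ω, f₁ ω ∂μ + 2 * ∫ ω, f₂ ω ∂μ - 2 * ∫ ω, f₃ ω ∂μ + ∫ ω, f₄ ω ∂μ + ∫ ω, f₅ ω ∂μ := by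
  have h12 : Integrable (fun ω => f₁ ω + 2 * f₂ ω) μ := h₁.add (h₂.const_mul 2)
  have h123 : Integrable (fun ω => f₁ ω + 2 * f₂ ω - 2 * f₃ ω) μ := h12.sub (h₃.const_mul 2)
  have h1234 : Integrable (fun ω => f₁ ω + 2 * f₂ ω - 2 * f₃ ω + f₄ ω) μ := h123.add h₄
  rw [integral_add h1234 h₅, integral_add h123 h₄, integral_sub h12 (h₃.const_mul 2),
    integral_add h₁ (h₂.const_mul 2), integral_const_mul, integral_const_mul]

end Moments

namespace Model

theorem queue_nonneg (A S : ℕ → Ω → Fin K → ℝ) (a : ℕ → Ω → Fin K) (t : ℕ) (ω : Ω) (i : Fin K) :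
    0 ≤ queueProc A S a t ω i :=
  queueLength_nonneg _ _ _ t i

variable [MeasurableSpace Ω] {μ : Measure Ω} {M α δ : ℝ}
  {A S : ℕ → Ω → Fin K → ℝ} {a : ℕ → Ω → Fin K} {x : ℕ → Ω → Fin K → ℝ}

theorem le_alpha (H : Model μ M α δ A S a x) : 14 ≤ α := by
  have h1 := H.pos_delta
  have h2 := H.delta_le
  have h3 := H.lt_mul
  by_contra h
  push Not at h
  rcases le_total α 0 with h0 | h0 <;> nlinarith

theorem ae_nonneg (H : Model μ M α δ A S a x) :
    ∀ᵐ ω ∂μ, (∀ t, 1 ≤ t → ∀ i, 0 ≤ A t ω i) ∧ ∀ t, 1 ≤ t → ∀ i, 0 ≤ S t ω i := by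
  have h1 : ∀ᵐ ω ∂μ, ∀ t, 1 ≤ t → ∀ i, 0 ≤ A t ω i := by
    simp only [ae_all_iff]
    exact H.moments.nonneg_arrival
  have h2 : ∀ᵐ ω ∂μ, ∀ t, 1 ≤ t → ∀ i, 0 ≤ S t ω i := by
    simp only [ae_all_iff]
    exact H.moments.nonneg_service
  exact h1.and h2

theorem meanRate_arrival_nonneg (H : Model μ M α δ A S a x) (t : ℕ) (i : Fin K) :
    0 ≤ meanRate μ A (t + 1) i :=
  integral_nonneg_of_ae (H.moments.nonneg_arrival _ (by omega) i)

theorem meanRate_service_nonneg (H : Model μ M α δ A S a x) (t : ℕ) (i : Fin K) :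
    0 ≤ meanRate μ S (t + 1) i :=
  integral_nonneg_of_ae (H.moments.nonneg_service _ (by omega) i)

/-- The expected queue length. -/
def meanQueue (μ : Measure Ω) (A S : ℕ → Ω → Fin K → ℝ) (a : ℕ → Ω → Fin K) (t : ℕ)
    (i : Fin K) : ℝ :=
  ∫ ω, queueProc A S a t ω i ∂μ

theorem meanQueue_nonneg (t : ℕ) (i : Fin K) : 0 ≤ meanQueue μ A S a t i :=
  integral_nonneg fun ω => queue_nonneg A S a t ω i

theorem integrable_mul_mixed (H : Model μ M α δ A S a x) (t : ℕ) (i : Fin K) {h : Ω → ℝ}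
    (hi : Integrable h μ) : Integrable (fun ω => h ω * mixed M δ A S a x (t + 1) ω i) μ :=
  hi.mul_bdd (c := 1) ((H.mixed_aestronglyMeasurable t i).mono (H.history_le t))
    (ae_of_all _ fun ω => by
      rw [Real.norm_of_nonneg (H.mixed_pos t ω i).le]
      exact H.mixed_le_one t ω i)

variable [IsProbabilityMeasure μ]

theorem integral_arrival_rpow_le (H : Model μ M α δ A S a x) (t : ℕ) (i : Fin K) :
    ∫ ω, A (t + 1) ω i ^ α ∂μ ≤ M ^ α := by
  rw [← integral_condExp (H.history_le t)]
  have h := integral_mono_ae integrable_condExp (integrable_const (M ^ α))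
    (H.moments.moment_arrival (t + 1) (by omega) i)
  simpa using h

theorem integral_service_rpow_le (H : Model μ M α δ A S a x) (t : ℕ) (i : Fin K) :
    ∫ ω, S (t + 1) ω i ^ α ∂μ ≤ M ^ α := by
  rw [← integral_condExp (H.history_le t)]
  have h := integral_mono_ae integrable_condExp (integrable_const (M ^ α))
    (H.moments.moment_service (t + 1) (by omega) i)
  simpa using h

theorem integrable_arrival_pow (H : Model μ M α δ A S a x) (t : ℕ) (i : Fin K) {k : ℕ}
    (hk : k ≤ 2) : Integrable (fun ω => A (t + 1) ω i ^ k) μ := by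
  have hα := H.le_alpha
  have hk' : (k : ℝ) ≤ 2 := by exact_mod_cast hk
  exact integrable_pow_of_rpow (H.measurable_arrival_apply t i)
    (H.moments.nonneg_arrival _ (by omega) i) H.pos_moment (by linarith)
    (H.moments.integrable_arrival _ (by omega) i) (by linarith)

theorem integrable_service_pow (H : Model μ M α δ A S a x) (t : ℕ) (i : Fin K) {k : ℕ}
    (hk : k ≤ 2) : Integrable (fun ω => S (t + 1) ω i ^ k) μ := by
  have hα := H.le_alpha
  have hk' : (k : ℝ) ≤ 2 := by exact_mod_cast hk
  exact integrable_pow_of_rpow (H.measurable_service_apply t i)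
    (H.moments.nonneg_service _ (by omega) i) H.pos_moment (by linarith)
    (H.moments.integrable_service _ (by omega) i) (by linarith)

theorem integral_arrival_pow_le (H : Model μ M α δ A S a x) (t : ℕ) (i : Fin K) {k : ℕ}
    (hk : k ≤ 2) : ∫ ω, A (t + 1) ω i ^ k ∂μ ≤ M ^ k := by
  have hα := H.le_alpha
  have hk' : (k : ℝ) ≤ 2 := by exact_mod_cast hk
  exact integral_pow_le_of_rpow (H.measurable_arrival_apply t i)
    (H.moments.nonneg_arrival _ (by omega) i) H.pos_moment (by linarith)
    (H.moments.integrable_arrival _ (by omega) i) (H.integral_arrival_rpow_le t i) (by linarith)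

theorem integral_service_pow_le (H : Model μ M α δ A S a x) (t : ℕ) (i : Fin K) {k : ℕ}
    (hk : k ≤ 2) : ∫ ω, S (t + 1) ω i ^ k ∂μ ≤ M ^ k := by
  have hα := H.le_alpha
  have hk' : (k : ℝ) ≤ 2 := by exact_mod_cast hk
  exact integral_pow_le_of_rpow (H.measurable_service_apply t i)
    (H.moments.nonneg_service _ (by omega) i) H.pos_moment (by linarith)
    (H.moments.integrable_service _ (by omega) i) (H.integral_service_rpow_le t i) (by linarith)

theorem integrable_arrival (H : Model μ M α δ A S a x) (t : ℕ) (i : Fin K) :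
    Integrable (fun ω => A (t + 1) ω i) μ := by
  simpa using H.integrable_arrival_pow t i one_le_two

theorem integrable_service (H : Model μ M α δ A S a x) (t : ℕ) (i : Fin K) :
    Integrable (fun ω => S (t + 1) ω i) μ := by
  simpa using H.integrable_service_pow t i one_le_two

theorem meanRate_arrival_le (H : Model μ M α δ A S a x) (t : ℕ) (i : Fin K) :
    meanRate μ A (t + 1) i ≤ M := by
  simpa [meanRate] using H.integral_arrival_pow_le t i one_le_two

theorem meanRate_service_le (H : Model μ M α δ A S a x) (t : ℕ) (i : Fin K) :
    meanRate μ S (t + 1) i ≤ M := by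
  simpa [meanRate] using H.integral_service_pow_le t i one_le_two

/-! ### Moments of the queue lengths -/

theorem integrable_queue_sq (H : Model μ M α δ A S a x) (t : ℕ) (i : Fin K) :
    Integrable (fun ω => queueProc A S a t ω i ^ 2) μ := by
  induction t with
  | zero => simp [queueProc, queueLength]
  | succ t ih =>
    refine ((ih.const_mul 2).add ((H.integrable_arrival_pow t i le_rfl).const_mul 2)).mono'
      ((H.measurable_queue_apply (t + 1) i).pow_const 2).aestronglyMeasurable ?_
    filter_upwards [H.ae_nonneg] with ω hω
    have hA := hω.1 (t + 1) (by omega) i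
    have h1 : queueProc A S a (t + 1) ω i ≤ queueProc A S a t ω i + A (t + 1) ω i :=
      queueLength_succ_le (A := fun s => A s ω) hA (hω.2 (t + 1) (by omega) i)
    have h2 := queue_nonneg A S a (t + 1) ω i
    rw [Real.norm_of_nonneg (by positivity)]
    simp only [Pi.add_apply]
    nlinarith [sq_nonneg (queueProc A S a t ω i - A (t + 1) ω i)]

theorem integrable_queue (H : Model μ M α δ A S a x) (t : ℕ) (i : Fin K) :
    Integrable (fun ω => queueProc A S a t ω i) μ := by
  refine ((integrable_const (1 : ℝ)).add (H.integrable_queue_sq t i)).mono'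
    (H.measurable_queue_apply t i).aestronglyMeasurable (ae_of_all _ fun ω => ?_)
  rw [Real.norm_of_nonneg (queue_nonneg A S a t ω i)]
  simp only [Pi.add_apply]
  nlinarith [sq_nonneg (queueProc A S a t ω i - 1)]

theorem meanQueue_succ_le (H : Model μ M α δ A S a x) (t : ℕ) (i : Fin K) :
    meanQueue μ A S a (t + 1) i ≤ meanQueue μ A S a t i + M := by
  have h1 : meanQueue μ A S a (t + 1) i ≤
      ∫ ω, (queueProc A S a t ω i + A (t + 1) ω i) ∂μ := by
    refine integral_mono_ae (H.integrable_queue _ i)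
      ((H.integrable_queue t i).add (H.integrable_arrival t i)) ?_
    filter_upwards [H.ae_nonneg] with ω hω
    exact queueLength_succ_le (A := fun s => A s ω) (hω.1 (t + 1) (by omega) i)
      (hω.2 (t + 1) (by omega) i)
  rw [integral_add (H.integrable_queue t i) (H.integrable_arrival t i)] at h1
  have := H.meanRate_arrival_le t i
  unfold meanRate at this
  unfold meanQueue at *
  linarith

theorem le_meanQueue_succ (H : Model μ M α δ A S a x) (t : ℕ) (i : Fin K) :
    meanQueue μ A S a t i ≤ meanQueue μ A S a (t + 1) i + M := by
  have h1 : meanQueue μ A S a t i ≤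
      ∫ ω, (queueProc A S a (t + 1) ω i + S (t + 1) ω i) ∂μ := by
    refine integral_mono_ae (H.integrable_queue _ i)
      ((H.integrable_queue _ i).add (H.integrable_service t i)) ?_
    filter_upwards [H.ae_nonneg] with ω hω
    exact le_queueLength_succ (A := fun s => A s ω) (hω.1 (t + 1) (by omega) i)
      (hω.2 (t + 1) (by omega) i)
  rw [integral_add (H.integrable_queue _ i) (H.integrable_service t i)] at h1
  have := H.meanRate_service_le t i
  unfold meanRate at this
  unfold meanQueue at *
  linarith

theorem meanQueue_le (H : Model μ M α δ A S a x) (t : ℕ) (i : Fin K) :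
    meanQueue μ A S a t i ≤ M * t := by
  induction t with
  | zero => simp [meanQueue, queueProc, queueLength]
  | succ t ih =>
    have := H.meanQueue_succ_le t i
    push_cast
    linarith

/-! ### Drift -/

/-- Obtained from the indicators of the action, which add up to 1. This avoids the case Q = 0, where
e_t is not a distribution. -/
theorem sum_integral_action (H : Model μ M α δ A S a x) (t : ℕ) :
    ∑ i, ∫ ω, (1 : ℝ) * mixed M δ A S a x (t + 1) ω i ∂μ = 1 := by
  have h1 : ∀ i, ∫ ω, (1 : ℝ) * mixed M δ A S a x (t + 1) ω i ∂μ =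
      ∫ ω, (if a (t + 1) ω = i then (1 : ℝ) else 0) ∂μ := by
    intro i
    have h2 := H.integral_ite_mul (t := t) (h := fun _ => 1)
      (measurable_const.stronglyMeasurable.aestronglyMeasurable) (integrable_const _) i
      (ψ := fun _ => 1) measurable_const
    simp only [mul_one, integral_const, probReal_univ, one_smul] at h2
    exact h2.symm
  simp only [h1]
  rw [← integral_finsetSum]
  · simp
  · intro i _
    exact ((integrable_const (1 : ℝ)).indicator (H.measurable_action_eq t i)).congr
      (ae_of_all _ fun ω => by simp [Set.indicator_apply])

/-- The expected service rate received, weighted by queue lengths. -/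
def servedWeight (μ : Measure Ω) (M δ : ℝ) (A S : ℕ → Ω → Fin K → ℝ) (a : ℕ → Ω → Fin K)
    (x : ℕ → Ω → Fin K → ℝ) (t : ℕ) (i : Fin K) : ℝ :=
  ∫ ω, queueProc A S a t ω i * mixed M δ A S a x (t + 1) ω i ∂μ

/-- The past is independent of the fresh pair, so the cross terms factor. The squared service enters
only when queue i is served; the probability of that event is kept, so that summing over i gives (K
+ 1)M² instead of 2KM². -/
theorem drift_step_apply (H : Model μ M α δ A S a x) (t : ℕ) (i : Fin K) :
    ∫ ω, queueProc A S a (t + 1) ω i ^ 2 ∂μ ≤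
      ∫ ω, queueProc A S a t ω i ^ 2 ∂μ +
        2 * (meanQueue μ A S a t i * meanRate μ A (t + 1) i) -
        2 * (servedWeight μ M δ A S a x t i * meanRate μ S (t + 1) i) + M ^ 2 +
        (∫ ω, (1 : ℝ) * mixed M δ A S a x (t + 1) ω i ∂μ) * M ^ 2 := by
  have m1 : Measurable fun z : (Fin K → ℝ) × (Fin K → ℝ) => z.1 i :=
    (measurable_pi_apply i).comp measurable_fst
  have m2 : Measurable fun z : (Fin K → ℝ) × (Fin K → ℝ) => z.2 i :=
    (measurable_pi_apply i).comp measurable_snd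
  have hq := queue_aestronglyMeasurable A S a μ t i
  have hone : AEStronglyMeasurable[history A S a t] (fun _ : Ω => (1 : ℝ)) μ :=
    measurable_const.stronglyMeasurable.aestronglyMeasurable
  have i1 : Integrable (fun ω => queueProc A S a t ω i * A (t + 1) ω i) μ :=
    (H.indepFun_of_history ((measurable_queue_apply_history A S a t i).mono le_sup_left le_rfl)
      m1).integrable_mul (H.integrable_queue t i) (H.integrable_arrival t i)
  have i2 := H.integrable_ite_mul hq (H.integrable_queue t i) i m2 (H.integrable_service t i)
  have i3 := H.integrable_ite_mul hone (integrable_const 1) i (m2.pow_const 2)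
    (H.integrable_service_pow t i le_rfl)
  have i4 := H.integrable_arrival_pow t i (k := 2) le_rfl
  have i5 := H.integrable_queue_sq t i
  have e1 := H.integral_mul_fresh (measurable_queue_apply_history A S a t i) m1
  have e2 := H.integral_ite_mul hq (H.integrable_queue t i) i m2
  have e3 := H.integral_ite_mul hone (integrable_const 1) i (m2.pow_const 2)
  have h1 : ∫ ω, queueProc A S a (t + 1) ω i ^ 2 ∂μ ≤
      ∫ ω, (queueProc A S a t ω i ^ 2 + 2 * (queueProc A S a t ω i * A (t + 1) ω i) -
        2 * ((if a (t + 1) ω = i then queueProc A S a t ω i else 0) * S (t + 1) ω i) +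
        A (t + 1) ω i ^ 2 + (if a (t + 1) ω = i then (1 : ℝ) else 0) * S (t + 1) ω i ^ 2) ∂μ := by
    refine integral_mono_ae (H.integrable_queue_sq _ i)
      ((((i5.add (i1.const_mul 2)).sub (i2.const_mul 2)).add i4).add i3) ?_
    filter_upwards [H.ae_nonneg] with ω hω
    have h2 := queueLength_succ_sq_le (A := fun s => A s ω) (S := fun s => S s ω)
      (a := fun s => a s ω) (hω.1 (t + 1) (by omega) i) (hω.2 (t + 1) (by omega) i)
    refine h2.trans (le_of_eq ?_)
    by_cases h : a (t + 1) ω = i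
    · simp [h, queueProc]
    · simp [h, Ne.symm h, queueProc]
  have hsplit := integral_combination i5 i1 i2 i4 i3
  rw [e1, e2, e3] at hsplit
  replace h1 := h1.trans_eq hsplit
  have h2 := H.integral_arrival_pow_le t i (k := 2) le_rfl
  have h3 := H.integral_service_pow_le t i (k := 2) le_rfl
  have h4 : 0 ≤ ∫ ω, (1 : ℝ) * mixed M δ A S a x (t + 1) ω i ∂μ :=
    integral_nonneg fun ω => by simpa using (H.mixed_pos t ω i).le
  have h5 := mul_le_mul_of_nonneg_left h3 h4
  unfold meanQueue servedWeight meanRate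
  linarith

/-- Telescoping from Q_0 = 0 and dropping the final second moment. -/
theorem sum_drift_le (H : Model μ M α δ A S a x) (n : ℕ) :
    ∑ t ∈ Finset.range n, ∑ i, (servedWeight μ M δ A S a x t i * meanRate μ S (t + 1) i -
      meanQueue μ A S a t i * meanRate μ A (t + 1) i) ≤ (K + 1) * M ^ 2 / 2 * n := by
  have key : ∑ i, ∫ ω, queueProc A S a n ω i ^ 2 ∂μ +
      2 * ∑ t ∈ Finset.range n, ∑ i,
        (servedWeight μ M δ A S a x t i * meanRate μ S (t + 1) i -
          meanQueue μ A S a t i * meanRate μ A (t + 1) i) ≤ (K + 1) * M ^ 2 * n := by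
    induction n with
    | zero => simp [queueProc, queueLength]
    | succ n ih =>
      have h1 := Finset.sum_le_sum fun i (_ : i ∈ Finset.univ) => H.drift_step_apply n i
      rw [Finset.sum_add_distrib, Finset.sum_add_distrib, Finset.sum_sub_distrib,
        Finset.sum_add_distrib, ← Finset.sum_mul, H.sum_integral_action, ← Finset.mul_sum,
        ← Finset.mul_sum] at h1
      simp only [Finset.sum_const, Finset.card_univ, Fintype.card_fin, nsmul_eq_mul] at h1
      rw [Finset.sum_range_succ]
      simp only [Finset.sum_sub_distrib] at ih ⊢
      push_cast
      linarith
  have h0 : 0 ≤ ∑ i, ∫ ω, queueProc A S a n ω i ^ 2 ∂μ :=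
    Finset.sum_nonneg fun i _ => integral_nonneg fun ω => sq_nonneg _
  linarith

end Model

/-! ### Regret in expectation -/

theorem softEta_le {M δ : ℝ} (hM : 0 < M) (hK : 0 < K) (Q : ℕ → Fin K → ℝ) (t : ℕ) :
    softEta M δ Q (t + 1) ≤ ((t + 1 : ℕ) : ℝ) ^ (1 / 4 - δ / 2) / M ^ 2 := by
  have hML := le_maxIncrement M Q t
  have hK' : (1 : ℝ) ≤ K := by exact_mod_cast hK
  have ht1 : (1 : ℝ) ≤ ((t + 1 : ℕ) : ℝ) := by exact_mod_cast Nat.succ_pos t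
  have ht0 : (0 : ℝ) < ((t + 1 : ℕ) : ℝ) := by linarith
  have h1 : M ^ 2 ≤ softScale M Q (t + 1) := by
    rw [softScale, Nat.add_sub_cancel, sq]
    refine mul_le_mul hML (Real.le_sqrt_of_sq_le ?_) hM.le (hM.le.trans hML)
    have h2 : (1 : ℝ) ≤ (K : ℝ) ^ 6 * ((t + 1 : ℕ) : ℝ) ^ ((3 : ℝ) / 2) :=
      one_le_mul_of_one_le_of_one_le (one_le_pow₀ hK') (Real.one_le_rpow ht1 (by norm_num))
    have h3 : M ^ 2 ≤ maxIncrement M Q t ^ 2 := pow_le_pow_left₀ hM.le hML 2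
    have h4 := sqSum_nonneg Q (t + 1)
    nlinarith [sq_nonneg (maxIncrement M Q t),
      mul_le_mul_of_nonneg_left h2 (sq_nonneg (maxIncrement M Q t))]
  rw [softEta_eq, mul_inv, Real.rpow_neg ht0.le, inv_inv, div_eq_mul_inv]
  exact mul_le_mul_of_nonneg_left (inv_anti₀ (by positivity) h1) (by positivity)

theorem sum_rpow_neg_half_le (n : ℕ) :
    ∑ t ∈ Finset.range n, ((t + 1 : ℕ) : ℝ) ^ (-(1 : ℝ) / 2) ≤ 2 * Real.sqrt n := by
  induction n with
  | zero => simp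
  | succ n ih =>
    rw [Finset.sum_range_succ]
    have h0 : (0 : ℝ) < ((n + 1 : ℕ) : ℝ) := by positivity
    have e : ((n + 1 : ℕ) : ℝ) ^ (-(1 : ℝ) / 2) = (Real.sqrt ((n + 1 : ℕ) : ℝ))⁻¹ := by
      rw [Real.sqrt_eq_rpow, ← Real.rpow_neg h0.le]; norm_num
    rw [e]
    have hs := Real.sqrt_pos.2 h0
    have h1 := Real.sq_sqrt h0.le
    have h2 := Real.sq_sqrt (Nat.cast_nonneg n : (0 : ℝ) ≤ n)
    have h3 := Real.sqrt_nonneg (n : ℝ)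
    push_cast at ih h1 hs ⊢
    set s := Real.sqrt ((n : ℝ) + 1)
    set r := Real.sqrt (n : ℝ)
    have h4 : s⁻¹ ≤ 2 * (s - r) := by
      rw [inv_le_iff_one_le_mul₀ hs]
      nlinarith [sq_nonneg (s - r)]
    linarith

theorem integrable_sum_sum [MeasurableSpace Ω] {μ : Measure Ω} {f : ℕ → Fin K → Ω → ℝ}
    (h : ∀ t i, Integrable (f t i) μ) (n : ℕ) :
    Integrable (fun ω => ∑ t ∈ Finset.range n, ∑ i, f t i ω) μ :=
  integrable_finsetSum _ fun t _ => integrable_finsetSum _ fun i _ => h t i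

theorem integral_sum_sum [MeasurableSpace Ω] {μ : Measure Ω} {f : ℕ → Fin K → Ω → ℝ}
    (h : ∀ t i, Integrable (f t i) μ) (n : ℕ) :
    ∫ ω, ∑ t ∈ Finset.range n, ∑ i, f t i ω ∂μ =
      ∑ t ∈ Finset.range n, ∑ i, ∫ ω, f t i ω ∂μ := by
  rw [integral_finsetSum _ fun t _ => integrable_finsetSum _ fun i _ => h t i]
  exact Finset.sum_congr rfl fun t _ => integral_finsetSum _ fun i _ => h t i

namespace Model

/-- The service estimate of SoftMW+ at the sample point `ω`. -/
abbrev estimate (M δ : ℝ) (A S : ℕ → Ω → Fin K → ℝ) (a : ℕ → Ω → Fin K) (x : ℕ → Ω → Fin K → ℝ)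
    (t : ℕ) (ω : Ω) : Fin K → ℝ :=
  softEstimate M δ (queuePath A S a ω) (fun s => S s ω) (fun s => a s ω) (fun s => x s ω) t

/-- Separates the factor known after sampling from the fresh clipped service, the shape required by
`integral_ite_mul`. -/
theorem estimate_eq (M δ : ℝ) (A S : ℕ → Ω → Fin K → ℝ) (a : ℕ → Ω → Fin K)
    (x : ℕ → Ω → Fin K → ℝ) (t : ℕ) (ω : Ω) (i : Fin K) :
    estimate M δ A S a x (t + 1) ω i =
      (if a (t + 1) ω = i then
        queueProc A S a t ω i * (mixed M δ A S a x (t + 1) ω i)⁻¹ else 0) *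
        clip M δ (t + 1) (S (t + 1) ω i) := by
  unfold estimate softEstimate feedbackEstimate softFeedback
  by_cases h : a (t + 1) ω = i
  · simp [h, div_eq_mul_inv]
    ring
  · simp [h, Ne.symm h]

variable [MeasurableSpace Ω] {μ : Measure Ω} {M α δ : ℝ}
  {A S : ℕ → Ω → Fin K → ℝ} {a : ℕ → Ω → Fin K} {x : ℕ → Ω → Fin K → ℝ}

/-- The mean clipped service. -/
def clipRate (μ : Measure Ω) (M δ : ℝ) (S : ℕ → Ω → Fin K → ℝ) (t : ℕ) (i : Fin K) : ℝ :=
  ∫ ω, clip M δ t (S t ω i) ∂μ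

theorem measurable_clip_snd (M δ : ℝ) (t : ℕ) (i : Fin K) :
    Measurable fun z : (Fin K → ℝ) × (Fin K → ℝ) => clip M δ t (z.2 i) :=
  (measurable_clip M δ t).comp ((measurable_pi_apply i).comp measurable_snd)

theorem measurable_clip_service (H : Model μ M α δ A S a x) (t : ℕ) (i : Fin K) :
    Measurable fun ω => clip M δ (t + 1) (S (t + 1) ω i) :=
  (measurable_clip M δ (t + 1)).comp (H.measurable_service_apply t i)

theorem ae_clip_nonneg (H : Model μ M α δ A S a x) (t : ℕ) (i : Fin K) :
    ∀ᵐ ω ∂μ, 0 ≤ clip M δ (t + 1) (S (t + 1) ω i) ∧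
      clip M δ (t + 1) (S (t + 1) ω i) ≤ S (t + 1) ω i := by
  filter_upwards [H.ae_nonneg] with ω hω
  have := hω.2 (t + 1) (by omega) i
  exact ⟨clip_nonneg _ this, clip_le_self _ this⟩

theorem clipRate_nonneg (H : Model μ M α δ A S a x) (t : ℕ) (i : Fin K) :
    0 ≤ clipRate μ M δ S (t + 1) i :=
  integral_nonneg_of_ae ((H.ae_clip_nonneg t i).mono fun _ h => h.1)

/-- Serves integrability only; this bound grows with t and enters no estimate. -/
theorem mixed_inv_le (H : Model μ M α δ A S a x) (t : ℕ) (ω : Ω) (i : Fin K) :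
    (mixed M δ A S a x (t + 1) ω i)⁻¹ ≤ 2 / softBeta K (t + 1) := by
  have h1 := (H.iterate_mem t ω).2 i
  have h2 := H.half_le_mixed t ω i
  have h3 := softBeta_pos H.pos_types (Nat.succ_pos t)
  rw [inv_le_comm₀ (H.mixed_pos t ω i) (by positivity), inv_div]
  linarith

theorem iterate_mul_inv_mixed_le (H : Model μ M α δ A S a x) (t : ℕ) (ω : Ω) (i : Fin K) :
    x (t + 1) ω i * (mixed M δ A S a x (t + 1) ω i)⁻¹ ≤ 2 := by
  rw [← div_eq_mul_inv, div_le_iff₀ (H.mixed_pos t ω i)]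
  linarith [H.half_le_mixed t ω i]

variable [IsProbabilityMeasure μ]

theorem integrable_clip (H : Model μ M α δ A S a x) (t : ℕ) (i : Fin K) :
    Integrable (fun ω => clip M δ (t + 1) (S (t + 1) ω i)) μ := by
  refine (H.integrable_service t i).mono' (H.measurable_clip_service t i).aestronglyMeasurable ?_
  filter_upwards [H.ae_clip_nonneg t i] with ω hω
  rw [Real.norm_of_nonneg hω.1]
  exact hω.2

theorem integrable_clip_sq (H : Model μ M α δ A S a x) (t : ℕ) (i : Fin K) :
    Integrable (fun ω => clip M δ (t + 1) (S (t + 1) ω i) ^ 2) μ := by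
  refine (H.integrable_service_pow t i le_rfl).mono'
    ((H.measurable_clip_service t i).pow_const 2).aestronglyMeasurable ?_
  filter_upwards [H.ae_clip_nonneg t i] with ω hω
  rw [Real.norm_of_nonneg (sq_nonneg _)]
  exact pow_le_pow_left₀ hω.1 hω.2 2

theorem integral_clip_sq_le (H : Model μ M α δ A S a x) (t : ℕ) (i : Fin K) :
    ∫ ω, clip M δ (t + 1) (S (t + 1) ω i) ^ 2 ∂μ ≤ M ^ 2 := by
  refine le_trans ?_ (H.integral_service_pow_le t i le_rfl)
  refine integral_mono_ae (H.integrable_clip_sq t i) (H.integrable_service_pow t i le_rfl) ?_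
  filter_upwards [H.ae_clip_nonneg t i] with ω hω
  exact pow_le_pow_left₀ hω.1 hω.2 2

theorem clipRate_le_meanRate (H : Model μ M α δ A S a x) (t : ℕ) (i : Fin K) :
    clipRate μ M δ S (t + 1) i ≤ meanRate μ S (t + 1) i :=
  integral_mono_ae (H.integrable_clip t i) (H.integrable_service t i)
    ((H.ae_clip_nonneg t i).mono fun _ h => h.2)

theorem clipRate_le (H : Model μ M α δ A S a x) (t : ℕ) (i : Fin K) :
    clipRate μ M δ S (t + 1) i ≤ M :=
  (H.clipRate_le_meanRate t i).trans (H.meanRate_service_le t i)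

theorem meanRate_sub_clipRate_le (H : Model μ M α δ A S a x) (t : ℕ) (i : Fin K) :
    meanRate μ S (t + 1) i - clipRate μ M δ S (t + 1) i ≤
      M * ((t + 1 : ℕ) : ℝ) ^ (-(3 : ℝ) / 2) := by
  have h := integral_sub_clip_le (δ := δ) (H.moments.nonneg_service (t + 1) (by omega) i)
    H.pos_moment (by linarith [H.le_alpha]) H.delta_le H.lt_mul
    (H.moments.integrable_service (t + 1) (by omega) i) (H.integral_service_rpow_le t i)
    (Nat.succ_pos t)
  rwa [integral_sub (H.integrable_service t i) (H.integrable_clip t i)] at h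

theorem integrable_queue_mul_iterate (H : Model μ M α δ A S a x) (t : ℕ) (i : Fin K) :
    Integrable (fun ω => queueProc A S a t ω i * x (t + 1) ω i) μ :=
  (H.integrable_queue t i).mul_bdd (c := 1)
    ((H.iterate_aestronglyMeasurable t i).mono (H.history_le t)) (ae_of_all _ fun ω => by
      rw [Real.norm_of_nonneg (H.iterate_pos t ω i).le]
      exact H.iterate_le_one t ω i)

/-- Unbiasedness of importance weighting: the sampling probability cancels 1/p, and the fresh
clipped service integrates to its mean. -/
theorem estimate_mul_aux (H : Model μ M α δ A S a x) (t : ℕ) (i : Fin K) (u : ℝ) :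
    Integrable (fun ω => estimate M δ A S a x (t + 1) ω i * (u - x (t + 1) ω i)) μ ∧
    ∫ ω, estimate M δ A S a x (t + 1) ω i * (u - x (t + 1) ω i) ∂μ =
      clipRate μ M δ S (t + 1) i *
        (u * meanQueue μ A S a t i - ∫ ω, queueProc A S a t ω i * x (t + 1) ω i ∂μ) := by
  set h : Ω → ℝ := fun ω => queueProc A S a t ω i * (u - x (t + 1) ω i) *
    (mixed M δ A S a x (t + 1) ω i)⁻¹ with hh
  have hm : AEStronglyMeasurable[history A S a t] h μ :=
    ((queue_aestronglyMeasurable A S a μ t i).mul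
      ((measurable_const.stronglyMeasurable.aestronglyMeasurable).sub
        (H.iterate_aestronglyMeasurable t i))).mul
      (aestronglyMeasurable_inv (H.mixed_aestronglyMeasurable t i))
  have hi0 : Integrable (fun ω => queueProc A S a t ω i * (u - x (t + 1) ω i)) μ := by
    refine (((H.integrable_queue t i).const_mul u).sub
      (H.integrable_queue_mul_iterate t i)).congr (ae_of_all _ fun ω => ?_)
    simp only [Pi.sub_apply]
    ring
  have hi : Integrable h μ :=
    hi0.mul_bdd (c := 2 / softBeta K (t + 1))
      (aestronglyMeasurable_inv ((H.mixed_aestronglyMeasurable t i).mono (H.history_le t)))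
      (ae_of_all _ fun ω => by
        rw [Real.norm_of_nonneg (inv_pos.2 (H.mixed_pos t ω i)).le]
        exact H.mixed_inv_le t ω i)
  have e : ∀ ω, estimate M δ A S a x (t + 1) ω i * (u - x (t + 1) ω i) =
      (if a (t + 1) ω = i then h ω else 0) * clip M δ (t + 1) (S (t + 1) ω i) := by
    intro ω
    rw [estimate_eq, hh]
    split_ifs <;> ring
  simp only [e]
  refine ⟨H.integrable_ite_mul hm hi i (measurable_clip_snd M δ (t + 1) i)
    (H.integrable_clip t i), ?_⟩
  rw [H.integral_ite_mul hm hi i (measurable_clip_snd M δ (t + 1) i), mul_comm]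
  congr 1
  have e2 : ∀ ω, h ω * mixed M δ A S a x (t + 1) ω i =
      u * queueProc A S a t ω i - queueProc A S a t ω i * x (t + 1) ω i := by
    intro ω
    rw [hh]
    simp only
    rw [inv_mul_cancel_right₀ (H.mixed_pos t ω i).ne']
    ring
  simp only [e2]
  rw [integral_sub ((H.integrable_queue t i).const_mul u) (H.integrable_queue_mul_iterate t i),
    integral_const_mul, meanQueue]

theorem integrable_softEta_mul_sq (H : Model μ M α δ A S a x) (t : ℕ) (i : Fin K) :
    Integrable (fun ω => softEta M δ (queuePath A S a ω) (t + 1) *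
      queueProc A S a t ω i ^ 2) μ :=
  (H.integrable_queue_sq t i).bdd_mul (c := ((t + 1 : ℕ) : ℝ) ^ (1 / 4 - δ / 2) / M ^ 2)
    ((softEta_aestronglyMeasurable M δ A S a μ t).mono (H.history_le t))
    (ae_of_all _ fun ω => by
      rw [Real.norm_of_nonneg (softEta_pos δ H.pos_moment H.pos_types _ (Nat.succ_pos t)).le]
      exact softEta_le H.pos_moment H.pos_types _ t)

/-- Of the two factors 1/p, one is cancelled by the sampling probability and the other is absorbed
by x/p ≤ 2. The clipped service contributes its second moment, not the square of the clipping level.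
-/
theorem estimate_sq_aux (H : Model μ M α δ A S a x) (t : ℕ) (i : Fin K) :
    Integrable (fun ω => softEta M δ (queuePath A S a ω) (t + 1) *
      (x (t + 1) ω i * estimate M δ A S a x (t + 1) ω i ^ 2)) μ ∧
    ∫ ω, softEta M δ (queuePath A S a ω) (t + 1) *
      (x (t + 1) ω i * estimate M δ A S a x (t + 1) ω i ^ 2) ∂μ ≤
      2 * M ^ 2 * ∫ ω, softEta M δ (queuePath A S a ω) (t + 1) *
        queueProc A S a t ω i ^ 2 ∂μ := by
  set h : Ω → ℝ := fun ω => softEta M δ (queuePath A S a ω) (t + 1) *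
    queueProc A S a t ω i ^ 2 * (x (t + 1) ω i * (mixed M δ A S a x (t + 1) ω i)⁻¹) *
    (mixed M δ A S a x (t + 1) ω i)⁻¹ with hh
  have hinv := aestronglyMeasurable_inv (H.mixed_aestronglyMeasurable t i)
  have hm0 : AEStronglyMeasurable[history A S a t]
      (fun ω => x (t + 1) ω i * (mixed M δ A S a x (t + 1) ω i)⁻¹) μ :=
    (H.iterate_aestronglyMeasurable t i).mul hinv
  have hm : AEStronglyMeasurable[history A S a t] h μ :=
    (((softEta_aestronglyMeasurable M δ A S a μ t).mul
      ((queue_aestronglyMeasurable A S a μ t i).pow 2)).mul hm0).mul hinv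
  have hpos : ∀ ω, 0 < (mixed M δ A S a x (t + 1) ω i)⁻¹ := fun ω =>
    inv_pos.2 (H.mixed_pos t ω i)
  have hi0 : Integrable (fun ω => softEta M δ (queuePath A S a ω) (t + 1) *
      queueProc A S a t ω i ^ 2 * (x (t + 1) ω i * (mixed M δ A S a x (t + 1) ω i)⁻¹)) μ :=
    (H.integrable_softEta_mul_sq t i).mul_bdd (c := 2) (hm0.mono (H.history_le t))
      (ae_of_all _ fun ω => by
        rw [Real.norm_of_nonneg (mul_nonneg (H.iterate_pos t ω i).le (hpos ω).le)]
        exact H.iterate_mul_inv_mixed_le t ω i)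
  have hi : Integrable h μ :=
    hi0.mul_bdd (c := 2 / softBeta K (t + 1)) (hinv.mono (H.history_le t))
      (ae_of_all _ fun ω => by
        rw [Real.norm_of_nonneg (hpos ω).le]
        exact H.mixed_inv_le t ω i)
  have hψ := (measurable_clip_snd (K := K) M δ (t + 1) i).pow_const 2
  have e : ∀ ω, softEta M δ (queuePath A S a ω) (t + 1) *
      (x (t + 1) ω i * estimate M δ A S a x (t + 1) ω i ^ 2) =
      (if a (t + 1) ω = i then h ω else 0) * clip M δ (t + 1) (S (t + 1) ω i) ^ 2 := by
    intro ω
    rw [estimate_eq, hh]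
    split_ifs <;> ring
  simp only [e]
  refine ⟨H.integrable_ite_mul hm hi i hψ (H.integrable_clip_sq t i), ?_⟩
  rw [H.integral_ite_mul hm hi i hψ]
  have hη : ∀ ω, 0 ≤ softEta M δ (queuePath A S a ω) (t + 1) * queueProc A S a t ω i ^ 2 :=
    fun ω => mul_nonneg (softEta_pos δ H.pos_moment H.pos_types _ (Nat.succ_pos t)).le
      (sq_nonneg _)
  have h1 : ∫ ω, h ω * mixed M δ A S a x (t + 1) ω i ∂μ ≤
      ∫ ω, 2 * (softEta M δ (queuePath A S a ω) (t + 1) * queueProc A S a t ω i ^ 2) ∂μ := by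
    refine integral_mono (H.integrable_mul_mixed t i hi)
      ((H.integrable_softEta_mul_sq t i).const_mul 2) fun ω => ?_
    simp only [hh]
    rw [inv_mul_cancel_right₀ (H.mixed_pos t ω i).ne', mul_comm (2 : ℝ)]
    exact mul_le_mul_of_nonneg_left (H.iterate_mul_inv_mixed_le t ω i) (hη ω)
  rw [integral_const_mul] at h1
  have h2 := H.integral_clip_sq_le t i
  have h3 : 0 ≤ ∫ ω, clip M δ (t + 1) (S (t + 1) ω i) ^ 2 ∂μ :=
    integral_nonneg fun ω => sq_nonneg _
  have h4 : 0 ≤ ∫ ω, softEta M δ (queuePath A S a ω) (t + 1) *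
    queueProc A S a t ω i ^ 2 ∂μ := integral_nonneg hη
  calc _ ≤ (2 * ∫ ω, softEta M δ (queuePath A S a ω) (t + 1) * queueProc A S a t ω i ^ 2 ∂μ) *
        M ^ 2 := mul_le_mul h1 h2 h3 (by positivity)
    _ = _ := by ring

/-- `∑ᵢ E[η_{t+1} Q_{t,i}²]`. -/
def etaWeight (μ : Measure Ω) (M δ : ℝ) (A S : ℕ → Ω → Fin K → ℝ) (a : ℕ → Ω → Fin K)
    (t : ℕ) : ℝ :=
  ∑ i, ∫ ω, softEta M δ (queuePath A S a ω) (t + 1) * queueProc A S a t ω i ^ 2 ∂μ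

/-- Sampling from p instead of x loses at most γ in each coordinate, and γ‖Q‖₁ = Mt^{δ/4} η‖Q‖₁² ≤
KMt^{δ/4} η‖Q‖₂². The cost therefore has the same form as the second-order term. -/
theorem exploration_le (H : Model μ M α δ A S a x) (t : ℕ) :
    ∑ i, clipRate μ M δ S (t + 1) i *
      (∫ ω, queueProc A S a t ω i * x (t + 1) ω i ∂μ - servedWeight μ M δ A S a x t i) ≤
      K * M ^ 2 * ((t + 1 : ℕ) : ℝ) ^ (δ / 4) * etaWeight μ M δ A S a t := by
  have hM := H.pos_moment
  have hγ0 : ∀ ω, 0 ≤ softGamma M δ (queuePath A S a ω) (t + 1) := fun ω =>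
    softGamma_nonneg δ hM H.pos_types _ (Nat.succ_pos t)
  have hγ1 : ∀ ω, softGamma M δ (queuePath A S a ω) (t + 1) ≤ 1 / 2 := fun ω =>
    softGamma_le_half (isQueuePath_queuePath A S a ω) hM H.pos_delta H.pos_types t
  have hγm : Measurable fun ω => softGamma M δ (queuePath A S a ω) (t + 1) :=
    measurable_softGamma M δ fun s _ => H.measurable_queueProc s
  have hγi : ∀ i, Integrable (fun ω => softGamma M δ (queuePath A S a ω) (t + 1) *
      queueProc A S a t ω i) μ := fun i =>
    (H.integrable_queue t i).bdd_mul (c := 1 / 2) hγm.aestronglyMeasurable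
      (ae_of_all _ fun ω => by rw [Real.norm_of_nonneg (hγ0 ω)]; exact hγ1 ω)
  have h1 : ∀ i, clipRate μ M δ S (t + 1) i *
      (∫ ω, queueProc A S a t ω i * x (t + 1) ω i ∂μ - servedWeight μ M δ A S a x t i) ≤
      M * ∫ ω, softGamma M δ (queuePath A S a ω) (t + 1) * queueProc A S a t ω i ∂μ := by
    intro i
    have h2 : ∫ ω, queueProc A S a t ω i * x (t + 1) ω i ∂μ - servedWeight μ M δ A S a x t i ≤
        ∫ ω, softGamma M δ (queuePath A S a ω) (t + 1) * queueProc A S a t ω i ∂μ := by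
      rw [servedWeight, ← integral_sub (H.integrable_queue_mul_iterate t i)
        (H.integrable_mul_mixed t i (H.integrable_queue t i))]
      refine integral_mono ((H.integrable_queue_mul_iterate t i).sub
        (H.integrable_mul_mixed t i (H.integrable_queue t i))) (hγi i) fun ω => ?_
      have q0 := queue_nonneg A S a t ω i
      have e0 := softExplore_nonneg (isQueuePath_queuePath A S a ω) (t + 1) i
      have x1 := H.iterate_le_one t ω i
      have key : x (t + 1) ω i - mixed M δ A S a x (t + 1) ω i ≤
          softGamma M δ (queuePath A S a ω) (t + 1) := by
        have g0 := hγ0 ω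
        simp only [mixed, softMixed, mixedAction]
        nlinarith [mul_nonneg g0 e0, mul_le_mul_of_nonneg_left x1 g0]
      simp only
      nlinarith [mul_le_mul_of_nonneg_left key q0]
    have h3 : 0 ≤ ∫ ω, softGamma M δ (queuePath A S a ω) (t + 1) * queueProc A S a t ω i ∂μ :=
      integral_nonneg fun ω => mul_nonneg (hγ0 ω) (queue_nonneg A S a t ω i)
    exact (mul_le_mul_of_nonneg_left h2 (H.clipRate_nonneg t i)).trans
      (mul_le_mul_of_nonneg_right (H.clipRate_le t i) h3)
  refine (Finset.sum_le_sum fun i _ => h1 i).trans ?_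
  rw [← Finset.mul_sum, etaWeight, ← integral_finsetSum _ fun i _ => hγi i,
    ← integral_finsetSum _ fun i _ => H.integrable_softEta_mul_sq t i,
    ← integral_const_mul, ← integral_const_mul]
  refine integral_mono ((integrable_finsetSum _ fun i _ => hγi i).const_mul M)
    ((integrable_finsetSum _ fun i _ => H.integrable_softEta_mul_sq t i).const_mul _)
    fun ω => ?_
  simp only
  rw [← Finset.mul_sum, ← Finset.mul_sum]
  have hl1 : ∑ i, queueProc A S a t ω i = l1norm (queueProc A S a t ω) :=
    (l1norm_of_nonneg (queue_nonneg A S a t ω)).symm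
  have hη := softEta_pos δ hM H.pos_types (queuePath A S a ω) (Nat.succ_pos t)
  have hsq := sq_l1norm_le (queueProc A S a t ω)
  rw [hl1, softGamma, Nat.add_sub_cancel]
  have hc : 0 ≤ M ^ 2 * ((t + 1 : ℕ) : ℝ) ^ (δ / 4) *
      softEta M δ (queuePath A S a ω) (t + 1) := by positivity
  calc _ = M ^ 2 * ((t + 1 : ℕ) : ℝ) ^ (δ / 4) * softEta M δ (queuePath A S a ω) (t + 1) *
        l1norm (queueProc A S a t ω) ^ 2 := by ring
    _ ≤ M ^ 2 * ((t + 1 : ℕ) : ℝ) ^ (δ / 4) * softEta M δ (queuePath A S a ω) (t + 1) *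
        (K * ∑ i, queueProc A S a t ω i ^ 2) := mul_le_mul_of_nonneg_left hsq hc
    _ = _ := by ring

end Model

/-! ### Expected regret and the drift of the reference policy -/

namespace Model

variable [MeasurableSpace Ω] {μ : Measure Ω} [IsProbabilityMeasure μ] {M α δ : ℝ}
  {A S : ℕ → Ω → Fin K → ℝ} {a : ℕ → Ω → Fin K} {x : ℕ → Ω → Fin K → ℝ}

/-- The expectation of the pathwise bound. Self-bounding has to happen before integration, because
it couples L, Z and X on one path. -/
theorem clipped_regret_le (H : Model μ M α δ A S a x) {ε CV : ℝ} (hε : 0 < ε) (hCV : 0 < CV)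
    {θ : ℕ → Fin K → ℝ} (hθ : ∀ t, 1 ≤ t → θ t ∈ stdSimplex ℝ (Fin K))
    (hV : ReferenceStationary θ CV δ) (T : ℕ) :
    ∑ t ∈ Finset.range (T + 1), ∑ i, clipRate μ M δ S (t + 1) i *
        (comparator θ (t + 1) i * meanQueue μ A S a t i - servedWeight μ M δ A S a x t i) ≤
      ε / 2 * ∑ t ∈ Finset.range (T + 1), ∑ i, meanQueue μ A S a t i +
        regretConst K M δ ε CV * (((T + 1 : ℕ) : ℝ) ^ (1 - δ / 7) * (1 + (2 * K + 1) * M ^ α)) := by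
  have hM := H.pos_moment
  have hδ := H.pos_delta
  have hτ1 : (1 : ℝ) ≤ ((T + 1 : ℕ) : ℝ) := by exact_mod_cast Nat.succ_pos T
  have hC := regretConst_nonneg K (M := M) hδ hε hCV
  set τ := ((T + 1 : ℕ) : ℝ) with hτ
  set C := regretConst K M δ ε CV
  -- D ∑ η‖Q‖₂² is added to the left side of the pathwise bound. After integration 2M² covers the
  -- second-order term and KM² the exploration cost, so both cancel.
  set D := (2 * M ^ 2 + K * M ^ 2) * τ ^ (δ / 4) with hD
  have hτ0 : 0 < τ := by linarith
  have hMα : 0 < M ^ α := by positivity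
  have hpath : ∀ᵐ ω ∂μ,
      ∑ t ∈ Finset.range (T + 1), ∑ i, estimate M δ A S a x (t + 1) ω i *
        (comparator θ (t + 1) i - x (t + 1) ω i) +
      D * ∑ t ∈ Finset.range (T + 1), ∑ i,
        softEta M δ (queuePath A S a ω) (t + 1) * queueProc A S a t ω i ^ 2 ≤
      ∑ t ∈ Finset.range (T + 1), ∑ i, softEta M δ (queuePath A S a ω) (t + 1) *
        (x (t + 1) ω i * estimate M δ A S a x (t + 1) ω i ^ 2) +
      (ε / 2 * ∑ t ∈ Finset.range (T + 1), ∑ i, queueProc A S a t ω i +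
        C * τ ^ (1 - δ / 7) * (1 + M ^ α / τ + τ⁻¹ * ∑ t ∈ Finset.range T, ∑ i,
          (A (t + 1) ω i ^ α + S (t + 1) ω i ^ α))) := by
    filter_upwards [H.ae_nonneg] with ω hω
    have h1 := sum_softEstimate_mul_add_le (M := M) (α := α) (isQueuePath_queuePath A S a ω) hM
      (by linarith [H.le_alpha]) hδ H.delta_le hε hCV H.lt_mul H.pos_types (H.alg.exp3 ω)
      (fun t ht => hω.2 t ht _) hθ hV T
    have h2 := maxIncrement_rpow_le (A := fun s => A s ω) (S := fun s => S s ω)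
      (a := fun s => a s ω) hM (by linarith [H.le_alpha] : 0 < α) hω.1 hω.2 T
    have h3 : l1Sum (queuePath A S a ω) (T + 1) =
        ∑ t ∈ Finset.range (T + 1), ∑ i, queueProc A S a t ω i :=
      Finset.sum_congr rfl fun t _ => l1norm_of_nonneg (queue_nonneg A S a t ω)
    have h4 : C * (τ ^ (1 - δ / 7) * (1 + maxIncrement M (queuePath A S a ω) T ^ α / τ)) ≤
        C * τ ^ (1 - δ / 7) * (1 + M ^ α / τ + τ⁻¹ * ∑ t ∈ Finset.range T, ∑ i,
          (A (t + 1) ω i ^ α + S (t + 1) ω i ^ α)) := by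
      rw [mul_assoc]
      refine mul_le_mul_of_nonneg_left (mul_le_mul_of_nonneg_left ?_ (by positivity)) hC
      have h5 := div_le_div_of_nonneg_right h2 hτ0.le
      rw [add_div, div_eq_inv_mul (∑ t ∈ Finset.range T, _)] at h5
      have h6 : maxIncrement M (queuePath A S a ω) T ^ α / τ ≤ M ^ α / τ +
        τ⁻¹ * ∑ t ∈ Finset.range T, ∑ i, (A (t + 1) ω i ^ α + S (t + 1) ω i ^ α) := h5
      linarith
    rw [h3] at h1
    simp only [Finset.mul_sum] at h1 h4 ⊢
    exact h1.trans (add_le_add_right (add_le_add_right h4 _) _)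
  have j1 : ∀ t i, Integrable (fun ω => estimate M δ A S a x (t + 1) ω i *
      (comparator θ (t + 1) i - x (t + 1) ω i)) μ := fun t i => (H.estimate_mul_aux t i _).1
  have j2 := H.integrable_softEta_mul_sq
  have j3 : ∀ t i, Integrable (fun ω => softEta M δ (queuePath A S a ω) (t + 1) *
      (x (t + 1) ω i * estimate M δ A S a x (t + 1) ω i ^ 2)) μ :=
    fun t i => (H.estimate_sq_aux t i).1
  have j4 := H.integrable_queue
  have j5 : ∀ t i, Integrable (fun ω => A (t + 1) ω i ^ α + S (t + 1) ω i ^ α) μ := fun t i =>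
    (H.moments.integrable_arrival (t + 1) (by omega) i).add
      (H.moments.integrable_service (t + 1) (by omega) i)
  have k1 := integrable_sum_sum j1 (T + 1)
  have k2 := (integrable_sum_sum j2 (T + 1)).const_mul D
  have k3 := integrable_sum_sum j3 (T + 1)
  have k4 := (integrable_sum_sum j4 (T + 1)).const_mul (ε / 2)
  have k5a : Integrable (fun ω => 1 + M ^ α / τ + τ⁻¹ * ∑ t ∈ Finset.range T, ∑ i,
      (A (t + 1) ω i ^ α + S (t + 1) ω i ^ α)) μ :=
    (integrable_const _).add ((integrable_sum_sum j5 T).const_mul τ⁻¹)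
  have k5 := k5a.const_mul (C * τ ^ (1 - δ / 7))
  have hint := integral_mono_ae (k1.add k2) (k3.add (k4.add k5)) hpath
  have e1 := integral_add k1 k2
  have e2 := integral_add k3 (k4.add k5)
  have e3 := integral_add k4 k5
  simp only [Pi.add_apply] at hint e1 e2 e3
  rw [e1, e2, e3, integral_const_mul, integral_const_mul, integral_const_mul,
    integral_add (integrable_const _) ((integrable_sum_sum j5 T).const_mul τ⁻¹),
    integral_const_mul, integral_sum_sum j1, integral_sum_sum j2, integral_sum_sum j3,
    integral_sum_sum j4, integral_sum_sum j5] at hint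
  simp only [integral_const, probReal_univ, one_smul] at hint
  -- The sum replacing L^α has 2KT terms of mean at most M^α, and τ⁻¹ removes the factor T.
  have m5 : 1 + M ^ α / τ + τ⁻¹ * ∑ t ∈ Finset.range T, ∑ i,
      ∫ ω, (A (t + 1) ω i ^ α + S (t + 1) ω i ^ α) ∂μ ≤ 1 + (2 * K + 1) * M ^ α := by
    have h1 : ∑ t ∈ Finset.range T, ∑ i : Fin K,
        ∫ ω, (A (t + 1) ω i ^ α + S (t + 1) ω i ^ α) ∂μ ≤
        ∑ t ∈ Finset.range T, ∑ i : Fin K, 2 * M ^ α := by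
      refine Finset.sum_le_sum fun t _ => Finset.sum_le_sum fun i _ => ?_
      rw [integral_add (H.moments.integrable_arrival (t + 1) (by omega) i)
        (H.moments.integrable_service (t + 1) (by omega) i)]
      linarith [H.integral_arrival_rpow_le t i, H.integral_service_rpow_le t i]
    simp only [Finset.sum_const, Finset.card_univ, Fintype.card_fin, nsmul_eq_mul,
      Finset.card_range] at h1
    have h2 : (T : ℝ) ≤ τ := by rw [hτ]; exact_mod_cast Nat.le_succ T
    have h3 : τ⁻¹ * ∑ t ∈ Finset.range T, ∑ i,
        ∫ ω, (A (t + 1) ω i ^ α + S (t + 1) ω i ^ α) ∂μ ≤ 2 * K * M ^ α := by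
      rw [inv_mul_le_iff₀ hτ0]
      refine h1.trans ?_
      have h4 : 0 ≤ 2 * K * M ^ α := by positivity
      nlinarith [mul_le_mul_of_nonneg_right h2 h4]
    have h4 : M ^ α / τ ≤ M ^ α := div_le_self hMα.le hτ1
    linarith
  have m5' := mul_le_mul_of_nonneg_left m5 (by positivity : 0 ≤ C * τ ^ (1 - δ / 7))
  have hη0 : ∀ t, 0 ≤ etaWeight μ M δ A S a t := fun t =>
    Finset.sum_nonneg fun i _ => integral_nonneg fun ω =>
      mul_nonneg (softEta_pos δ hM H.pos_types _ (Nat.succ_pos t)).le (sq_nonneg _)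
  set Y := ∑ t ∈ Finset.range (T + 1), etaWeight μ M δ A S a t with hY
  have hY0 : 0 ≤ Y := Finset.sum_nonneg fun t _ => hη0 t
  have m3 : ∑ t ∈ Finset.range (T + 1), ∑ i, ∫ ω, softEta M δ (queuePath A S a ω) (t + 1) *
      (x (t + 1) ω i * estimate M δ A S a x (t + 1) ω i ^ 2) ∂μ ≤ 2 * M ^ 2 * Y := by
    rw [hY, Finset.mul_sum]
    refine Finset.sum_le_sum fun t _ => ?_
    rw [etaWeight, Finset.mul_sum]
    exact Finset.sum_le_sum fun i _ => (H.estimate_sq_aux t i).2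
  have hp1 : (1 : ℝ) ≤ τ ^ (δ / 4) := Real.one_le_rpow hτ1 (by positivity)
  have m3' : 2 * M ^ 2 * Y ≤ 2 * M ^ 2 * τ ^ (δ / 4) * Y := by
    have : 0 ≤ 2 * M ^ 2 * Y := by positivity
    nlinarith [mul_le_mul_of_nonneg_right hp1 this]
  have mexp : ∑ t ∈ Finset.range (T + 1), ∑ i, clipRate μ M δ S (t + 1) i *
      (∫ ω, queueProc A S a t ω i * x (t + 1) ω i ∂μ - servedWeight μ M δ A S a x t i) ≤
      K * M ^ 2 * τ ^ (δ / 4) * Y := by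
    rw [hY, Finset.mul_sum]
    refine Finset.sum_le_sum fun t ht => (H.exploration_le t).trans ?_
    refine mul_le_mul_of_nonneg_right (mul_le_mul_of_nonneg_left ?_ (by positivity)) (hη0 t)
    exact Real.rpow_le_rpow (by positivity)
      (by rw [hτ]; exact_mod_cast Nat.succ_le_of_lt (Finset.mem_range.mp ht)) (by positivity)
  have m1 : ∑ t ∈ Finset.range (T + 1), ∑ i, clipRate μ M δ S (t + 1) i *
        (comparator θ (t + 1) i * meanQueue μ A S a t i - servedWeight μ M δ A S a x t i) =
      ∑ t ∈ Finset.range (T + 1), ∑ i, ∫ ω, estimate M δ A S a x (t + 1) ω i *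
        (comparator θ (t + 1) i - x (t + 1) ω i) ∂μ +
      ∑ t ∈ Finset.range (T + 1), ∑ i, clipRate μ M δ S (t + 1) i *
      (∫ ω, queueProc A S a t ω i * x (t + 1) ω i ∂μ - servedWeight μ M δ A S a x t i) := by
    simp only [(H.estimate_mul_aux _ _ _).2]
    rw [← Finset.sum_add_distrib]
    refine Finset.sum_congr rfl fun t _ => ?_
    rw [← Finset.sum_add_distrib]
    exact Finset.sum_congr rfl fun i _ => by ring
  rw [m1]
  have hYD : D * Y = 2 * M ^ 2 * τ ^ (δ / 4) * Y + K * M ^ 2 * τ ^ (δ / 4) * Y := by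
    rw [hD]; ring
  have hint' : ∑ t ∈ Finset.range (T + 1), ∑ i, ∫ ω, estimate M δ A S a x (t + 1) ω i *
        (comparator θ (t + 1) i - x (t + 1) ω i) ∂μ + D * Y ≤
      ∑ t ∈ Finset.range (T + 1), ∑ i, ∫ ω, softEta M δ (queuePath A S a ω) (t + 1) *
        (x (t + 1) ω i * estimate M δ A S a x (t + 1) ω i ^ 2) ∂μ +
      (ε / 2 * ∑ t ∈ Finset.range (T + 1), ∑ i, meanQueue μ A S a t i +
        C * τ ^ (1 - δ / 7) * (1 + M ^ α / τ + τ⁻¹ * ∑ t ∈ Finset.range T, ∑ i,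
          ∫ ω, (A (t + 1) ω i ^ α + S (t + 1) ω i ^ α) ∂μ)) := hint
  linarith

/-- The constant in front of the sublinear part of the drift bound. -/
def driftConst (K : ℕ) (M α δ ε CV : ℝ) : ℝ :=
  regretConst K M δ ε CV * (1 + (2 * K + 1) * M ^ α) + 4 * K * M ^ 2

/-- Undoes clipping and truncation. The mean queue is at most Mt, clipping costs Mt^{-3/2} in the
rate and truncation t⁻⁴ in the policy, so each replacement costs at most M²t^{-1/2}. -/
theorem regret_apply_le (H : Model μ M α δ A S a x) {θ : ℕ → Fin K → ℝ}
    (hθ : ∀ t, 1 ≤ t → θ t ∈ stdSimplex ℝ (Fin K)) (t : ℕ) (i : Fin K) :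
    meanRate μ S (t + 1) i *
        (θ (t + 1) i * meanQueue μ A S a t i - servedWeight μ M δ A S a x t i) ≤
      clipRate μ M δ S (t + 1) i *
        (comparator θ (t + 1) i * meanQueue μ A S a t i - servedWeight μ M δ A S a x t i) +
      2 * M ^ 2 * ((t + 1 : ℕ) : ℝ) ^ (-(1 : ℝ) / 2) := by
  have hM := H.pos_moment
  have ht1 : (1 : ℝ) ≤ ((t + 1 : ℕ) : ℝ) := by exact_mod_cast Nat.succ_pos t
  have ht0 : (0 : ℝ) < ((t + 1 : ℕ) : ℝ) := by linarith
  have hq0 := meanQueue_nonneg (μ := μ) (A := A) (S := S) (a := a) t i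
  have hq : meanQueue μ A S a t i ≤ M * ((t + 1 : ℕ) : ℝ) :=
    (H.meanQueue_le t i).trans (mul_le_mul_of_nonneg_left
      (by exact_mod_cast Nat.le_succ t) hM.le)
  have hθ0 := (hθ (t + 1) (by omega)).1 i
  have hθ1 : θ (t + 1) i ≤ 1 := by
    rw [← (hθ (t + 1) (by omega)).2]
    exact Finset.single_le_sum (fun j _ => (hθ (t + 1) (by omega)).1 j) (Finset.mem_univ i)
  have hw : 0 ≤ servedWeight μ M δ A S a x t i := integral_nonneg fun ω =>
    mul_nonneg (queue_nonneg A S a t ω i) (H.mixed_pos t ω i).le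
  have hc0 := H.clipRate_nonneg t i
  have hc1 := H.clipRate_le t i
  have hd := H.meanRate_sub_clipRate_le t i
  have hd0 := sub_nonneg.2 (H.clipRate_le_meanRate t i)
  have hu : θ (t + 1) i - comparator θ (t + 1) i ≤ (((t + 1 : ℕ) : ℝ) ^ 4)⁻¹ := by
    have h1 := (softBeta_pos H.pos_types (Nat.succ_pos t)).le
    have h2 : 0 ≤ (((t + 1 : ℕ) : ℝ) ^ 4)⁻¹ := by positivity
    have h3 := mul_le_mul_of_nonneg_left hθ1 h2
    simp only [comparator, Nat.succ_eq_add_one] at h1 ⊢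
    linarith
  have b1 : (((t + 1 : ℕ) : ℝ) ^ 4)⁻¹ * ((t + 1 : ℕ) : ℝ) ≤
      ((t + 1 : ℕ) : ℝ) ^ (-(1 : ℝ) / 2) := by
    have e : (((t + 1 : ℕ) : ℝ) ^ 4)⁻¹ * ((t + 1 : ℕ) : ℝ) = ((t + 1 : ℕ) : ℝ) ^ (-3 : ℝ) := by
      rw [Real.rpow_neg ht0.le, show (3 : ℝ) = ((3 : ℕ) : ℝ) by norm_num, Real.rpow_natCast]
      field_simp
    rw [e]
    exact Real.rpow_le_rpow_of_exponent_le ht1 (by norm_num)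
  have b2 : ((t + 1 : ℕ) : ℝ) ^ (-(3 : ℝ) / 2) * ((t + 1 : ℕ) : ℝ) =
      ((t + 1 : ℕ) : ℝ) ^ (-(1 : ℝ) / 2) := by
    rw [← Real.rpow_add_one ht0.ne']
    norm_num
  set q := meanQueue μ A S a t i
  set s := ((t + 1 : ℕ) : ℝ)
  have t1 : clipRate μ M δ S (t + 1) i * (q * (θ (t + 1) i - comparator θ (t + 1) i)) ≤
      M ^ 2 * s ^ (-(1 : ℝ) / 2) := by
    have p0 : 0 ≤ (s ^ 4)⁻¹ := by positivity
    calc _ ≤ clipRate μ M δ S (t + 1) i * (M * s * (s ^ 4)⁻¹) := by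
          refine mul_le_mul_of_nonneg_left ?_ hc0
          exact (mul_le_mul_of_nonneg_left hu hq0).trans (mul_le_mul_of_nonneg_right hq p0)
      _ ≤ M * (M * s * (s ^ 4)⁻¹) := mul_le_mul_of_nonneg_right hc1 (by positivity)
      _ = M ^ 2 * ((s ^ 4)⁻¹ * s) := by ring
      _ ≤ _ := mul_le_mul_of_nonneg_left b1 (by positivity)
  have t2 : (meanRate μ S (t + 1) i - clipRate μ M δ S (t + 1) i) *
      (θ (t + 1) i * q - servedWeight μ M δ A S a x t i) ≤ M ^ 2 * s ^ (-(1 : ℝ) / 2) := by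
    have h1 : θ (t + 1) i * q - servedWeight μ M δ A S a x t i ≤ M * s := by
      nlinarith [mul_le_mul_of_nonneg_right hθ1 hq0]
    calc _ ≤ (meanRate μ S (t + 1) i - clipRate μ M δ S (t + 1) i) * (M * s) :=
          mul_le_mul_of_nonneg_left h1 hd0
      _ ≤ M * s ^ (-(3 : ℝ) / 2) * (M * s) := mul_le_mul_of_nonneg_right hd (by positivity)
      _ = M ^ 2 * (s ^ (-(3 : ℝ) / 2) * s) := by ring
      _ = _ := by rw [b2]
  linarith

/-- The drift of θ is the drift of the algorithm plus its regret against θ; the replacement costs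
sum to O(√n). -/
theorem sum_reference_drift_le (H : Model μ M α δ A S a x) {ε CV : ℝ} (hε : 0 < ε) (hCV : 0 < CV)
    {θ : ℕ → Fin K → ℝ} (hθ : ∀ t, 1 ≤ t → θ t ∈ stdSimplex ℝ (Fin K))
    (hV : ReferenceStationary θ CV δ) {n : ℕ} (hn : 1 ≤ n) :
    ∑ t ∈ Finset.range n, ∑ i, meanQueue μ A S a t i *
        (θ (t + 1) i * meanRate μ S (t + 1) i - meanRate μ A (t + 1) i) ≤
      (K + 1) * M ^ 2 / 2 * n + ε / 2 * ∑ t ∈ Finset.range n, ∑ i, meanQueue μ A S a t i +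
        driftConst K M α δ ε CV * (n : ℝ) ^ (1 - δ / 7) := by
  obtain ⟨T, rfl⟩ : ∃ T, n = T + 1 := ⟨n - 1, by omega⟩
  have h1 := H.clipped_regret_le hε hCV hθ hV T
  have h2 := H.sum_drift_le (T + 1)
  have h3 := Finset.sum_le_sum fun t (_ : t ∈ Finset.range (T + 1)) =>
    Finset.sum_le_sum fun i (_ : i ∈ Finset.univ) => H.regret_apply_le hθ t i
  simp only [Finset.sum_add_distrib, Finset.sum_const, Finset.card_univ, Fintype.card_fin,
    nsmul_eq_mul] at h3
  rw [← Finset.mul_sum, ← Finset.mul_sum] at h3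
  have h4 := sum_rpow_neg_half_le (T + 1)
  have h5 : Real.sqrt ((T + 1 : ℕ) : ℝ) ≤ ((T + 1 : ℕ) : ℝ) ^ (1 - δ / 7) := by
    rw [Real.sqrt_eq_rpow]
    exact Real.rpow_le_rpow_of_exponent_le (by exact_mod_cast Nat.succ_pos T)
      (by linarith [H.delta_le])
  have h6 : (K : ℝ) * (2 * M ^ 2 *
      ∑ t ∈ Finset.range (T + 1), ((t + 1 : ℕ) : ℝ) ^ (-(1 : ℝ) / 2)) ≤
      4 * K * M ^ 2 * ((T + 1 : ℕ) : ℝ) ^ (1 - δ / 7) := by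
    have hc : 0 ≤ (K : ℝ) * (2 * M ^ 2) := by positivity
    have := mul_le_mul_of_nonneg_left (h4.trans (mul_le_mul_of_nonneg_left h5 zero_le_two)) hc
    linarith
  have h7 : ∑ t ∈ Finset.range (T + 1), ∑ i, meanQueue μ A S a t i *
        (θ (t + 1) i * meanRate μ S (t + 1) i - meanRate μ A (t + 1) i) =
      ∑ t ∈ Finset.range (T + 1), ∑ i, meanRate μ S (t + 1) i *
        (θ (t + 1) i * meanQueue μ A S a t i - servedWeight μ M δ A S a x t i) +
      ∑ t ∈ Finset.range (T + 1), ∑ i, (servedWeight μ M δ A S a x t i * meanRate μ S (t + 1) i -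
        meanQueue μ A S a t i * meanRate μ A (t + 1) i) := by
    rw [← Finset.sum_add_distrib]
    refine Finset.sum_congr rfl fun t _ => ?_
    rw [← Finset.sum_add_distrib]
    exact Finset.sum_congr rfl fun i _ => by ring
  rw [h7, driftConst]
  linarith

end Model

/-! ### Stabilizability over the windows of the partition -/

/-- L(L − 1)/2 ≤ (L − 1)² for integers L ≥ 1; a window of one slot costs nothing. -/
theorem sum_range_cast_le_sq {L : ℕ} (hL : 1 ≤ L) :
    ∑ k ∈ Finset.range L, (k : ℝ) ≤ ((L : ℝ) - 1) ^ 2 := by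
  induction L, hL using Nat.le_induction with
  | base => simp
  | succ L hL ih =>
    rw [Finset.sum_range_succ]
    have : (1 : ℝ) ≤ L := by exact_mod_cast hL
    push_cast
    nlinarith

/-- If the increments of `y` are at most `M` and `c` is on average at least `ε` over a window, then
`y` weighted by `c` is at least `ε` times the sum of `y`, up to the square of the window length. -/
theorem le_sum_mul_of_average {y c : ℕ → ℝ} {M ε : ℝ} (hM : 0 ≤ M) (hε : 0 ≤ ε) {L : ℕ}
    (hL : 1 ≤ L) (hy0 : 0 ≤ y 0) (hy : ∀ k < L, |y (k + 1) - y k| ≤ M)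
    (hc : ∀ k < L, |c k| ≤ M) (havg : ε * L ≤ ∑ k ∈ Finset.range L, c k) :
    ε * ∑ k ∈ Finset.range L, y k - (M ^ 2 + ε * M) * ((L : ℝ) - 1) ^ 2 ≤
      ∑ k ∈ Finset.range L, y k * c k := by
  have hdev : ∀ k ≤ L, |y k - y 0| ≤ M * k := by
    intro k hk
    induction k with
    | zero => simp
    | succ k ih =>
      have h1 := ih (by omega)
      have h2 := hy k (by omega)
      have h3 := abs_add_le (y (k + 1) - y k) (y k - y 0)
      rw [sub_add_sub_cancel] at h3
      push_cast
      linarith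
  -- Freezing y at y_0 costs at most M²k in y_k c_k and εMk in ε y_k. The coefficient c_k − ε of y_0
  -- then has nonnegative sum over the window.
  have key : ∀ k ∈ Finset.range L,
      y 0 * (c k - ε) + ε * y k - (M ^ 2 + ε * M) * k ≤ y k * c k := by
    intro k hk
    have hk := Finset.mem_range.mp hk
    have h1 := hdev k hk.le
    have h2 := hc k hk
    have h3 : |(y k - y 0) * c k| ≤ M * k * M := by
      rw [abs_mul]
      exact mul_le_mul h1 h2 (abs_nonneg _) (by positivity)
    have h4 := (abs_le.1 h3).1
    have h5 := mul_le_mul_of_nonneg_left (abs_le.1 h1).2 hε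
    nlinarith
  have h1 := Finset.sum_le_sum key
  rw [Finset.sum_sub_distrib, Finset.sum_add_distrib, ← Finset.mul_sum, ← Finset.mul_sum,
    ← Finset.mul_sum, Finset.sum_sub_distrib] at h1
  simp only [Finset.sum_const, Finset.card_range, nsmul_eq_mul] at h1
  have h2 := mul_le_mul_of_nonneg_left (sum_range_cast_le_sq hL)
    (by positivity : 0 ≤ M ^ 2 + ε * M)
  have h3 := mul_nonneg hy0 (by linarith : 0 ≤ ∑ k ∈ Finset.range L, c k - L * ε)
  linarith

namespace Model

variable [MeasurableSpace Ω] {μ : Measure Ω} [IsProbabilityMeasure μ] {M α δ : ℝ}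
  {A S : ℕ → Ω → Fin K → ℝ} {a : ℕ → Ω → Fin K} {x : ℕ → Ω → Fin K → ℝ}

theorem window_drift_ge (H : Model μ M α δ A S a x) {ε : ℝ} (hε : 0 < ε) {θ : ℕ → Fin K → ℝ}
    (hθ : ∀ t, 1 ≤ t → θ t ∈ stdSimplex ℝ (Fin K)) {s e : ℕ} (hse : s < e) (j : Fin K)
    (havg : ε + (1 / ((Finset.Ico (s + 1) (e + 1)).card : ℝ)) *
          ∑ t ∈ Finset.Ico (s + 1) (e + 1), meanRate μ A t j ≤
        (1 / ((Finset.Ico (s + 1) (e + 1)).card : ℝ)) *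
          ∑ t ∈ Finset.Ico (s + 1) (e + 1), θ t j * meanRate μ S t j) :
    ε * ∑ t ∈ Finset.Ico s e, meanQueue μ A S a t j -
        (M ^ 2 + ε * M) * (((Finset.Ico (s + 1) (e + 1)).card : ℝ) - 1) ^ 2 ≤
      ∑ t ∈ Finset.Ico s e, meanQueue μ A S a t j *
        (θ (t + 1) j * meanRate μ S (t + 1) j - meanRate μ A (t + 1) j) := by
  have hcard : (Finset.Ico (s + 1) (e + 1)).card = e - s := by simp
  rw [hcard] at havg ⊢
  have hL : (0 : ℝ) < ((e - s : ℕ) : ℝ) := by exact_mod_cast Nat.sub_pos_of_lt hse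
  rw [Finset.sum_Ico_eq_sum_range, Finset.sum_Ico_eq_sum_range] at havg ⊢
  refine le_sum_mul_of_average (y := fun k => meanQueue μ A S a (s + k) j)
    (c := fun k => θ (s + k + 1) j * meanRate μ S (s + k + 1) j - meanRate μ A (s + k + 1) j)
    H.pos_moment.le hε.le (Nat.sub_pos_of_lt hse) (meanQueue_nonneg _ _)
    (fun k _ => ?_) (fun k _ => ?_) ?_
  · have h1 := H.meanQueue_succ_le (s + k) j
    have h2 := H.le_meanQueue_succ (s + k) j
    exact abs_le.2 ⟨by rw [← add_assoc]; linarith, by rw [← add_assoc]; linarith⟩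
  · have hθ0 := (hθ (s + k + 1) (by omega)).1 j
    have hθ1 : θ (s + k + 1) j ≤ 1 := by
      rw [← (hθ (s + k + 1) (by omega)).2]
      exact Finset.single_le_sum (fun i _ => (hθ (s + k + 1) (by omega)).1 i) (Finset.mem_univ j)
    have h1 := H.meanRate_service_nonneg (s + k) j
    have h2 := H.meanRate_service_le (s + k) j
    have h3 := H.meanRate_arrival_nonneg (s + k) j
    have h4 := H.meanRate_arrival_le (s + k) j
    have h5 := mul_nonneg hθ0 h1
    have h6 := mul_le_mul_of_nonneg_right hθ1 h1
    exact abs_le.2 ⟨by linarith, by linarith⟩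
  · rw [Finset.sum_sub_distrib]
    simp only [one_div, add_right_comm s 1, Nat.add_sub_add_right] at havg
    have h1 := mul_le_mul_of_nonneg_left havg hL.le
    rw [mul_add, mul_inv_cancel_left₀ hL.ne', mul_inv_cancel_left₀ hL.ne'] at h1
    linarith

end Model

section Windows

variable {τ : ℕ → ℕ}

theorem succ_le_window (hτ : StrictMono τ) (h0 : τ 0 = 1) (n : ℕ) : n + 1 ≤ τ n := by
  induction n with
  | zero => omega
  | succ n ih => have := hτ (Nat.lt_add_one n); omega

theorem sum_card_sub_one_sq_le (hτ : StrictMono τ) (h0 : τ 0 = 1) {CW : ℝ}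
    (h : ∀ T : ℕ, 1 ≤ T → ∑ n ∈ (Finset.range T).filter (fun n => τ n < T),
        (((Finset.Ico (τ n) (τ (n + 1))).card : ℝ) - 1) ^ 2 ≤ CW * T) {N : ℕ} (hN : 1 ≤ N) :
    ∑ n ∈ Finset.range N, (((Finset.Ico (τ n) (τ (n + 1))).card : ℝ) - 1) ^ 2 ≤
      CW * ((τ N - 1 : ℕ) : ℝ) := by
  have hτN := succ_le_window hτ h0 N
  refine le_trans ?_ (h (τ N - 1) (by omega))
  -- The assumption at horizon τ_N − 1 omits a window starting exactly there, but such a window has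
  -- a single slot and contributes 0.
  rw [← Finset.sum_filter_of_ne (p := fun n => τ n < τ N - 1)]
  · refine Finset.sum_le_sum_of_subset_of_nonneg ?_ fun _ _ _ => sq_nonneg _
    intro n hn
    simp only [Finset.mem_filter, Finset.mem_range] at hn ⊢
    have := succ_le_window hτ h0 n
    exact ⟨by omega, hn.2⟩
  · intro n hn hne
    by_contra hcon
    refine hne ?_
    have h1 : n + 1 ≤ N := Finset.mem_range.mp hn
    have h2 := hτ.monotone h1
    have h3 := hτ (Nat.lt_add_one n)
    rw [Nat.card_Ico, show τ (n + 1) - τ n = 1 by omega]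
    simp

/-- Every slot is followed by the end of a window at a distance of the order of its square root. -/
theorem exists_window_end (hτ : StrictMono τ) (h0 : τ 0 = 1) {CW : ℝ} (hCW : 0 ≤ CW)
    (h : ∀ T : ℕ, 1 ≤ T → ∑ n ∈ (Finset.range T).filter (fun n => τ n < T),
        (((Finset.Ico (τ n) (τ (n + 1))).card : ℝ) - 1) ^ 2 ≤ CW * T) {T : ℕ} (hT : 1 ≤ T) :
    ∃ N, 1 ≤ N ∧ T + 1 ≤ τ N - 1 ∧
      ((τ N - 1 : ℕ) : ℝ) ≤ T + 1 + Real.sqrt (3 * CW) * Real.sqrt T := by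
  have hex : ∃ N, T + 1 < τ N := ⟨T + 1, succ_le_window hτ h0 (T + 1)⟩
  classical
  set N := Nat.find hex with hN
  have hspec : T + 1 < τ N := Nat.find_spec hex
  have hN1 : 1 ≤ N := by
    by_contra hcon
    have : N = 0 := by omega
    rw [this, h0] at hspec
    omega
  obtain ⟨k, hk⟩ : ∃ k, N = k + 1 := ⟨N - 1, by omega⟩
  -- By minimality of N, the window before the end point starts no later than T + 1, so its length
  -- bounds the overshoot.
  have hkT : τ k ≤ T + 1 := by
    have := Nat.find_min hex (m := k) (by omega)
    omega
  refine ⟨N, hN1, by omega, ?_⟩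
  -- Horizon T + 2 because the sum only counts windows starting strictly before it; T + 2 ≤ 3T gives
  -- the factor 3.
  have h1 := h (T + 2) (by omega)
  have hk1 := succ_le_window hτ h0 k
  have h2 : (((Finset.Ico (τ k) (τ (k + 1))).card : ℝ) - 1) ^ 2 ≤ CW * ((T + 2 : ℕ) : ℝ) := by
    refine le_trans ?_ h1
    exact Finset.single_le_sum
      (f := fun n => (((Finset.Ico (τ n) (τ (n + 1))).card : ℝ) - 1) ^ 2)
      (fun _ _ => sq_nonneg _)
      (Finset.mem_filter.2 ⟨Finset.mem_range.2 (by omega), by omega⟩)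
  have hT' : (1 : ℝ) ≤ T := by exact_mod_cast hT
  have h3 : ((Finset.Ico (τ k) (τ (k + 1))).card : ℝ) - 1 ≤
      Real.sqrt (3 * CW) * Real.sqrt T := by
    rw [← Real.sqrt_mul (by positivity)]
    refine Real.le_sqrt_of_sq_le (h2.trans ?_)
    push_cast
    nlinarith
  rw [Nat.card_Ico, Nat.cast_sub (hτ (Nat.lt_add_one k)).le] at h3
  have h4 : (τ k : ℝ) ≤ T + 1 := by exact_mod_cast hkT
  rw [Nat.cast_sub (by omega), hk]
  push_cast
  linarith

end Windows

namespace Model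

variable [MeasurableSpace Ω] {μ : Measure Ω} [IsProbabilityMeasure μ] {M α δ : ℝ}
  {A S : ℕ → Ω → Fin K → ℝ} {a : ℕ → Ω → Fin K} {x : ℕ → Ω → Fin K → ℝ}

theorem sum_window_drift_ge (H : Model μ M α δ A S a x) {ε : ℝ} (hε : 0 < ε)
    {θ : ℕ → Fin K → ℝ} (hθ : ∀ t, 1 ≤ t → θ t ∈ stdSimplex ℝ (Fin K)) {τ : ℕ → ℕ}
    (hτ : StrictMono τ) (h0 : τ 0 = 1)
    (havg : ∀ (n : ℕ) (j : Fin K),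
      ε + (1 / ((Finset.Ico (τ n) (τ (n + 1))).card : ℝ)) *
          ∑ t ∈ Finset.Ico (τ n) (τ (n + 1)), meanRate μ A t j ≤
        (1 / ((Finset.Ico (τ n) (τ (n + 1))).card : ℝ)) *
          ∑ t ∈ Finset.Ico (τ n) (τ (n + 1)), θ t j * meanRate μ S t j) (N : ℕ) (j : Fin K) :
    ε * ∑ t ∈ Finset.range (τ N - 1), meanQueue μ A S a t j -
        (M ^ 2 + ε * M) * ∑ n ∈ Finset.range N,
          (((Finset.Ico (τ n) (τ (n + 1))).card : ℝ) - 1) ^ 2 ≤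
      ∑ t ∈ Finset.range (τ N - 1), meanQueue μ A S a t j *
        (θ (t + 1) j * meanRate μ S (t + 1) j - meanRate μ A (t + 1) j) := by
  induction N with
  | zero => simp [h0]
  | succ N ih =>
    have h1 := succ_le_window hτ h0 N
    have h2 := hτ (Nat.lt_add_one N)
    have h3 := havg N j
    obtain ⟨s, hs⟩ : ∃ s, τ N = s + 1 := ⟨τ N - 1, by omega⟩
    obtain ⟨e, he⟩ : ∃ e, τ (N + 1) = e + 1 := ⟨τ (N + 1) - 1, by omega⟩
    rw [Finset.sum_range_succ (fun n => (((Finset.Ico (τ n) (τ (n + 1))).card : ℝ) - 1) ^ 2)]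
    rw [hs, Nat.add_sub_cancel] at ih
    rw [hs, he] at h3
    rw [hs, he, Nat.add_sub_cancel]
    have hse : s < e := by omega
    have h4 := H.window_drift_ge hε hθ hse j h3
    rw [← Finset.sum_range_add_sum_Ico _ hse.le,
      ← Finset.sum_range_add_sum_Ico (fun t => meanQueue μ A S a t j *
        (θ (t + 1) j * meanRate μ S (t + 1) j - meanRate μ A (t + 1) j)) hse.le]
    linarith

/-- At the end of a window both estimates of the drift of θ apply: at least ε times the queue sum,
and at most ε/2 times it, each up to lower-order and linear terms. -/
theorem sum_meanQueue_window_le (H : Model μ M α δ A S a x) {ε CV CW : ℝ} (hε : 0 < ε)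
    (hCV : 0 < CV) {θ : ℕ → Fin K → ℝ}
    (hθ : ∀ t, 1 ≤ t → θ t ∈ stdSimplex ℝ (Fin K)) (hV : ReferenceStationary θ CV δ)
    {τ : ℕ → ℕ} (hτ : StrictMono τ) (h0 : τ 0 = 1)
    (hW : ∀ T : ℕ, 1 ≤ T → ∑ n ∈ (Finset.range T).filter (fun n => τ n < T),
        (((Finset.Ico (τ n) (τ (n + 1))).card : ℝ) - 1) ^ 2 ≤ CW * T)
    (havg : ∀ (n : ℕ) (j : Fin K),
      ε + (1 / ((Finset.Ico (τ n) (τ (n + 1))).card : ℝ)) *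
          ∑ t ∈ Finset.Ico (τ n) (τ (n + 1)), meanRate μ A t j ≤
        (1 / ((Finset.Ico (τ n) (τ (n + 1))).card : ℝ)) *
          ∑ t ∈ Finset.Ico (τ n) (τ (n + 1)), θ t j * meanRate μ S t j) {N : ℕ} (hN : 1 ≤ N) :
    ∑ t ∈ Finset.range (τ N - 1), ∑ i, meanQueue μ A S a t i ≤
      ((K + 1) * M ^ 2 + 2 * CW * (K * M ^ 2 + ε * K * M)) / ε * ((τ N - 1 : ℕ) : ℝ) +
        2 / ε * driftConst K M α δ ε CV * ((τ N - 1 : ℕ) : ℝ) ^ (1 - δ / 7) := by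
  have hτN := succ_le_window hτ h0 N
  have h1 := H.sum_reference_drift_le hε hCV hθ hV (n := τ N - 1) (by omega)
  have h2 := Finset.sum_le_sum fun j (_ : j ∈ Finset.univ) =>
    H.sum_window_drift_ge hε hθ hτ h0 havg N j
  rw [Finset.sum_sub_distrib, ← Finset.mul_sum, Finset.sum_comm,
    Finset.sum_comm (s := Finset.univ) (t := Finset.range (τ N - 1)) (f := fun j t =>
      meanQueue μ A S a t j *
        (θ (t + 1) j * meanRate μ S (t + 1) j - meanRate μ A (t + 1) j))] at h2
  simp only [Finset.sum_const, Finset.card_univ, Fintype.card_fin, nsmul_eq_mul] at h2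
  have h3 := sum_card_sub_one_sq_le hτ h0 hW hN
  have hc : 0 ≤ (K : ℝ) * (M ^ 2 + ε * M) := by
    have := H.pos_moment
    positivity
  have h4 := mul_le_mul_of_nonneg_left h3 hc
  set X := ∑ t ∈ Finset.range (τ N - 1), ∑ i, meanQueue μ A S a t i
  set n := ((τ N - 1 : ℕ) : ℝ)
  have h5 : ε / 2 * X ≤ (K + 1) * M ^ 2 / 2 * n + CW * (K * M ^ 2 + ε * K * M) * n +
      driftConst K M α δ ε CV * n ^ (1 - δ / 7) := by
    linarith
  have h6 := mul_le_mul_of_nonneg_left h5 (by positivity : 0 ≤ 2 / ε)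
  have e1 : 2 / ε * (ε / 2 * X) = X := by field_simp
  rw [e1] at h6
  refine h6.trans (le_of_eq ?_)
  field_simp

end Model

/-! ### The remainder -/

/-- The vanishing remainder in the bound on the average queue length. -/
def remainder (K : ℕ) (M α δ ε CW CV : ℝ) (T : ℕ) : ℝ :=
  (2 * (K + 1) * M ^ 2 + 4 * CW * (K * M ^ 2 + ε * K * M)) / ε *
      ((T : ℝ) ^ (-1 : ℝ) + Real.sqrt (3 * CW) * (T : ℝ) ^ (-(1 / 2) : ℝ)) +
    2 / ε * Model.driftConst K M α δ ε CV * (2 + Real.sqrt (3 * CW)) * (T : ℝ) ^ (-(δ / 7))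

theorem tendsto_remainder (K : ℕ) (M α ε CW CV : ℝ) {δ : ℝ} (hδ : 0 < δ) :
    Tendsto (remainder K M α δ ε CW CV) atTop (𝓝 0) := by
  have h : ∀ y : ℝ, 0 < y → Tendsto (fun T : ℕ => (T : ℝ) ^ (-y)) atTop (𝓝 0) := fun y hy =>
    (tendsto_rpow_neg_atTop hy).comp tendsto_natCast_atTop_atTop
  have h1 := (((h 1 one_pos).add ((h (1 / 2) (by norm_num)).const_mul
    (Real.sqrt (3 * CW)))).const_mul
      ((2 * (K + 1) * M ^ 2 + 4 * CW * (K * M ^ 2 + ε * K * M)) / ε)).add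
    ((h (δ / 7) (by positivity)).const_mul
      (2 / ε * Model.driftConst K M α δ ε CV * (2 + Real.sqrt (3 * CW))))
  simp only [mul_zero, add_zero] at h1
  exact h1

namespace Model

variable [MeasurableSpace Ω] {μ : Measure Ω} [IsProbabilityMeasure μ] {M α δ : ℝ}
  {A S : ℕ → Ω → Fin K → ℝ} {a : ℕ → Ω → Fin K} {x : ℕ → Ω → Fin K → ℝ}

/-- The horizon is extended to the next end of a window, which only adds nonnegative terms; the
O(√T) overshoot goes into the remainder. -/
theorem average_meanQueue_le (H : Model μ M α δ A S a x) {ε CV CW : ℝ} (hε : 0 < ε)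
    (hCV : 0 < CV) (hCW : 0 ≤ CW) {θ : ℕ → Fin K → ℝ}
    (hP : PiecewiseStabilizable (meanRate μ A) (meanRate μ S) θ CW ε)
    (hV : ReferenceStationary θ CV δ) {T : ℕ} (hT : 1 ≤ T) :
    (1 / (T : ℝ)) * ∑ t ∈ Finset.range (T + 1), ∑ i, meanQueue μ A S a t i ≤
      (2 * (K + 1) * M ^ 2 + 4 * CW * (K * M ^ 2 + ε * K * M)) / ε +
        remainder K M α δ ε CW CV T := by
  obtain ⟨hθ, τ, hτ, h0, hW, havg⟩ := hP
  obtain ⟨N, hN, hNT, hNle⟩ := exists_window_end hτ h0 hCW hW hT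
  have h1 := H.sum_meanQueue_window_le hε hCV hθ hV hτ h0 hW havg hN
  have hM := H.pos_moment
  have h2 : ∑ t ∈ Finset.range (T + 1), ∑ i, meanQueue μ A S a t i ≤
      ∑ t ∈ Finset.range (τ N - 1), ∑ i, meanQueue μ A S a t i :=
    Finset.sum_le_sum_of_subset_of_nonneg (Finset.range_mono hNT)
      fun t _ _ => Finset.sum_nonneg fun i _ => meanQueue_nonneg t i
  have hT1 : (1 : ℝ) ≤ T := by exact_mod_cast hT
  have hT0 : (0 : ℝ) < T := by linarith
  have hD : 0 ≤ driftConst K M α δ ε CV := by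
    have := regretConst_nonneg K (M := M) H.pos_delta hε hCV
    unfold driftConst
    positivity
  set n := ((τ N - 1 : ℕ) : ℝ)
  have hn0 : 0 ≤ n := Nat.cast_nonneg _
  set w := Real.sqrt (3 * CW)
  have hw : 0 ≤ w := Real.sqrt_nonneg _
  set p := (2 * (K + 1) * M ^ 2 + 4 * CW * (K * M ^ 2 + ε * K * M)) / ε with hp
  have hp0 : 0 ≤ p := by positivity
  have hhalf : ((K + 1) * M ^ 2 + 2 * CW * (K * M ^ 2 + ε * K * M)) / ε = p / 2 := by
    rw [hp]; ring
  rw [hhalf] at h1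
  have hsqrt : Real.sqrt T ≤ T := by
    rw [Real.sqrt_le_left hT0.le]
    nlinarith
  have hn : n ≤ (2 + w) * T := by nlinarith
  have hexp : 0 ≤ 1 - δ / 7 := by linarith [H.delta_le]
  have hpow : n ^ (1 - δ / 7) ≤ (2 + w) * (T : ℝ) ^ (1 - δ / 7) := by
    calc n ^ (1 - δ / 7) ≤ ((2 + w) * T) ^ (1 - δ / 7) := Real.rpow_le_rpow hn0 hn hexp
      _ = (2 + w) ^ (1 - δ / 7) * (T : ℝ) ^ (1 - δ / 7) :=
          Real.mul_rpow (by positivity) hT0.le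
      _ ≤ (2 + w) ^ (1 : ℝ) * (T : ℝ) ^ (1 - δ / 7) := by
          refine mul_le_mul_of_nonneg_right
            (Real.rpow_le_rpow_of_exponent_le (by linarith) ?_) (by positivity)
          linarith [H.pos_delta]
      _ = _ := by rw [Real.rpow_one]
  have e1 : (1 / (T : ℝ)) * (T : ℝ) ^ (1 - δ / 7) = (T : ℝ) ^ (-(δ / 7)) := by
    rw [sub_eq_add_neg, Real.rpow_add hT0, Real.rpow_one]
    field_simp
  have e2 : (1 / (T : ℝ)) * Real.sqrt T = (T : ℝ) ^ (-(1 / 2) : ℝ) := by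
    rw [Real.rpow_neg hT0.le, ← Real.sqrt_eq_rpow]
    have h3 := Real.sqrt_pos.2 hT0
    have h4 := Real.mul_self_sqrt hT0.le
    field_simp
    rw [sq, h4]
  have e3 : (1 / (T : ℝ)) = (T : ℝ) ^ (-1 : ℝ) := by rw [Real.rpow_neg_one, one_div]
  have h3 : ∑ t ∈ Finset.range (T + 1), ∑ i, meanQueue μ A S a t i ≤
      p * (T + 1 + w * Real.sqrt T) +
        2 / ε * driftConst K M α δ ε CV * ((2 + w) * (T : ℝ) ^ (1 - δ / 7)) := by
    -- The window bound has half of the final constant; the spare factor 2 is given away here.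
    have h4 : p / 2 * n ≤ p * (T + 1 + w * Real.sqrt T) := by
      have := mul_le_mul_of_nonneg_left hNle hp0
      have := mul_nonneg hp0 hn0
      linarith
    have h5 := mul_le_mul_of_nonneg_left hpow
      (by positivity : 0 ≤ 2 / ε * driftConst K M α δ ε CV)
    linarith
  have h6 := mul_le_mul_of_nonneg_left h3 (by positivity : 0 ≤ 1 / (T : ℝ))
  refine h6.trans (le_of_eq ?_)
  unfold remainder
  rw [← hp, ← e1, ← e2, ← e3]
  field_simp
  ring

end Model

end SoftMWPlus

end

theorem mainTheorem4 (K : ℕ) (M α δ ε CW CV : ℝ) (hM : 0 < M) (hα : 2 ≤ α) (hδ : 0 < δ)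
    (hδ' : δ ≤ 1 / 2) (hε : 0 < ε) (hCW : 0 ≤ CW) (hCV : 0 < CV) (hδα : 7 < δ * α) :
    ∃ r : ℕ → ℝ, Tendsto r atTop (𝓝 0) ∧
      ∀ (Ω : Type*) [MeasurableSpace Ω] (μ : Measure Ω) [IsProbabilityMeasure μ]
        (A S : ℕ → Ω → Fin K → ℝ) (a : ℕ → Ω → Fin K) (x : ℕ → Ω → Fin K → ℝ)
        (θ : ℕ → Fin K → ℝ),
        IsEnvironment μ A S →
        IsSoftMWPlus μ M δ A S a x →
        PiecewiseStabilizable (meanRate μ A) (meanRate μ S) θ CW ε →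
        ReferenceStationary θ CV δ →
        BoundedMoments μ M α A S a →
        (∀ t i, Integrable (fun ω => queueProc A S a t ω i) μ) ∧
        (∀ T : ℕ, 1 ≤ T →
          (1 / (T : ℝ)) * ∫ ω, ∑ t ∈ Finset.Icc 1 T, l1norm (queueProc A S a t ω) ∂μ ≤
            (2 * (K + 1) * M ^ 2 + 4 * CW * (K * M ^ 2 + ε * K * M)) / ε + r T) ∧
        IsStable μ (queueProc A S a) := by
  refine ⟨remainder K M α δ ε CW CV, tendsto_remainder K M α ε CW CV hδ, ?_⟩
  intro Ω _ μ _ A S a x θ hE hX hP hV hB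
  obtain ⟨ω₀⟩ := nonempty_of_isProbabilityMeasure μ
  -- The never used action at index 0 still shows that there is at least one job type.
  have hK : 0 < K := (a 0 ω₀).pos
  have H : Model μ M α δ A S a x := ⟨hM, hδ, hδ', hδα, hK, hE, hX, hB⟩
  have havg := fun (T : ℕ) (hT : 1 ≤ T) => H.average_meanQueue_le hε hCV hCW hP hV hT
  refine ⟨H.integrable_queue, fun T hT => le_trans ?_ (havg T hT), H.integrable_queue, ?_⟩
  · refine mul_le_mul_of_nonneg_left ?_ (by positivity)
    have e : ∀ ω, ∑ t ∈ Finset.Icc 1 T, l1norm (queueProc A S a t ω) ≤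
        ∑ t ∈ Finset.range (T + 1), ∑ i, queueProc A S a t ω i := fun ω => by
      refine le_trans (Finset.sum_le_sum_of_subset_of_nonneg (t := Finset.range (T + 1)) ?_
        fun _ _ _ => l1norm_nonneg _) (Finset.sum_le_sum fun t _ => ?_)
      · intro t ht
        simp only [Finset.mem_Icc, Finset.mem_range] at ht ⊢
        omega
      · exact (l1norm_of_nonneg (Model.queue_nonneg A S a t ω)).le
    calc _ ≤ ∫ ω, ∑ t ∈ Finset.range (T + 1), ∑ i, queueProc A S a t ω i ∂μ :=
          integral_mono_of_nonneg
            (ae_of_all _ fun ω => Finset.sum_nonneg fun _ _ => l1norm_nonneg _)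
            (integrable_sum_sum H.integrable_queue _) (ae_of_all _ e)
      _ = _ := integral_sum_sum H.integrable_queue _
  · set p := (2 * (K + 1) * M ^ 2 + 4 * CW * (K * M ^ 2 + ε * K * M)) / ε
    refine Asymptotics.IsBigO.of_bound (p + 1) ?_
    have hr := (tendsto_remainder K M α ε CW CV hδ).eventually_le_const one_pos
    filter_upwards [hr, eventually_ge_atTop 1] with T hT1 hT
    have hnn : ∀ t, 0 ≤ ∑ i, ∫ ω, queueProc A S a t ω i ∂μ := fun t =>
      Finset.sum_nonneg fun i _ => Model.meanQueue_nonneg t i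
    rw [Real.norm_of_nonneg (mul_nonneg (by positivity) (Finset.sum_nonneg fun t _ => hnn t)),
      norm_one, mul_one]
    refine le_trans (mul_le_mul_of_nonneg_left ?_ (by positivity)) ((havg T hT).trans
      (by linarith))
    -- Stability sums over Q_0, …, Q_{T−1}, while the bound at hand also includes Q_T.
    rw [Finset.sum_range_succ]
    exact le_add_of_nonneg_right (hnn T)
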